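/- Let $(W,S)$ be a Coxeter system with Coxeter matrix $(m_{st})$, identity $e$ and length function $\ell$, ordered by the Bruhat order $\le$; write $u\lhd v$ if $v$ covers $u$ and $\mathrm{coat}(v)=\{u : u\lhd v\}$. For $J\subseteq S$ let $\langle J\rangle$ be the subgroup generated by $J$. A *partial matching* is a pair $(Q,\varphi)$ where $Q\subseteq W$ is a lower set and $\varphi:Q\to Q$ is an involution such that for every $u\in Q$ either $u\lhd\varphi(u)$ or $\varphi(u)\lhd u$, and such that $u\lhd \varphi(u)$ implies $\mathrm{coat}(\varphi(u))=\{u\}\cup\{\varphi(v) : v\lhd u,\ v\lhd\varphi(v)\}$. It is *maximal* if it has no proper extension to a partial matching. An element $w\in W$ is *full* if for all $s,t\in S$ one has $m_{st}<\infty$ and $sts\cdots\le w$ ($m_{st}$ factors); $(Q,\varphi)$ is *full* if $Q$ contains a full element. A generator $s\in S$ is *left regular* if $sQ\subseteq Q$ and $\varphi(sx)=s\varphi(x)$ for all $x\in Q$; *right regular* is defined symmetrically. The pair $(Q,\varphi)$ is *reducible* if $|S|\le 2$ or if for every $m\in Q$ with $m\lhd\varphi(m)$ and $\varphi(m)$ full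 there is a left regular $s\in S$ with $\ell(sm)<\ell(m)$ or a right regular $s\in S$ with $\ell(ms)<\ell(m)$. Let $(Q,\varphi)$ be a maximal partial matching (with $Q\neq\emptyset$), $a=\varphi(e)\in S$, and $$C=\{s\in S: sa=as\},\quad U=\{s\in S\setminus C:\varphi(s)=sa\},\quad V=\{s\in S\setminus C:\varphi(s)=as\}.$$ **Proposition.** Suppose $(Q,\varphi)$ is crossed, i.e. $U\ne\emptyset$ and $V\neq\emptyset$. Then $(Q,\varphi)$ is reducible. More precisely, if $(Q,\varphi)$ is moreover full, then at least one of the following holds: 1. $Q=\langle U\cup C\rangle\,(\langle V\cup C\rangle\cap Q)$, and $\varphi(xy)=x\varphi(y)$ for all $x\in\langle U\cup C\rangle$ and $y\in\langle V\cup C\rangle\cap Q$; 2. $Q=(\langle U\cup C\rangle\cap Q)\,\langle V\cup C\rangle$, and $\varphi(xy)=\varphi(x)y$ for all $x\in\langle U\cup C\rangle\cap Q$ and $y\in\langle V\cup C\rangle$. -/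

import Mathlib

open scoped Pointwise

namespace CoxeterSystem

variable {B W : Type*} [Group W] {M : CoxeterMatrix B}

/-- The Bruhat order: the reflexive transitive closure of the relation `u → u * t`, with `t` a
reflection and `ℓ u < ℓ (u * t)`. -/
def BruhatLE (cs : CoxeterSystem M W) : W → W → Prop :=
  Relation.ReflTransGen
    (fun u v => ∃ t, cs.IsReflection t ∧ v = u * t ∧ cs.length u < cs.length v)

/-- The strict Bruhat order. -/
def BruhatLT (cs : CoxeterSystem M W) (u v : W) : Prop :=
  cs.BruhatLE u v ∧ u ≠ v

/-- `u ⋖ v` in the Bruhat order: `u < v` with nothing strictly between. -/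
def BruhatCovBy (cs : CoxeterSystem M W) (u v : W) : Prop :=
  cs.BruhatLT u v ∧ ¬ ∃ z, cs.BruhatLT u z ∧ cs.BruhatLT z v

/-- The set of coatoms of `v`. -/
def coat (cs : CoxeterSystem M W) (v : W) : Set W :=
  {u | cs.BruhatCovBy u v}

/-- `(Q, φ)` is a partial distinguished (special) matching of `W`: `Q` is a lower set of the Bruhat
order and `φ` restricts to a distinguished matching of `Q`. Only the values of `φ` on `Q` matter.
As `Q` is a lower set, covering relations and coatoms inside `Q` are the same as those in `W`. -/
structure IsPartialMatching (cs : CoxeterSystem M W) (Q : Set W) (φ : W → W) : Prop where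
  lower : ∀ q ∈ Q, ∀ x, cs.BruhatLE x q → x ∈ Q
  mapsTo : ∀ u ∈ Q, φ u ∈ Q
  involutive : ∀ u ∈ Q, φ (φ u) = u
  covBy : ∀ u ∈ Q, cs.BruhatCovBy u (φ u) ∨ cs.BruhatCovBy (φ u) u
  coat_eq : ∀ u ∈ Q, cs.BruhatCovBy u (φ u) →
    cs.coat (φ u) = {u} ∪ {x | ∃ v, cs.BruhatCovBy v u ∧ cs.BruhatCovBy v (φ v) ∧ x = φ v}

/-- `(Q, φ)` is maximal among partial matchings ordered by extension: every partial matching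
extending it has the same domain. -/
structure IsMaximalMatching (cs : CoxeterSystem M W) (Q : Set W) (φ : W → W) : Prop where
  isPartialMatching : cs.IsPartialMatching Q φ
  maximal : ∀ (Q' : Set W) (φ' : W → W), cs.IsPartialMatching Q' φ' → Q ⊆ Q' →
    (∀ x ∈ Q, φ' x = φ x) → Q' = Q

/-- The standard parabolic subgroup `⟨J⟩`. -/
def parabolic (cs : CoxeterSystem M W) (J : Set B) : Subgroup W :=
  Subgroup.closure (cs.simple '' J)

/-- `w` is full: all entries of the Coxeter matrix are finite (Mathlib encodes `∞` by `0`) and the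
alternating product `s t s ⋯` with `m(s,t)` factors is below `w`, for all generators `s, t`. -/
def IsFull (cs : CoxeterSystem M W) (w : W) : Prop :=
  ∀ s t : B, M s t ≠ 0 ∧ cs.BruhatLE (cs.wordProd (alternatingWord s t (M s t))) w

/-- A matching is full if its domain contains a full element. -/
def IsFullMatching (cs : CoxeterSystem M W) (Q : Set W) : Prop :=
  ∃ w ∈ Q, cs.IsFull w

/-- The generator `s` is left regular for `(Q, φ)`. -/
def IsLeftRegular (cs : CoxeterSystem M W) (Q : Set W) (φ : W → W) (s : B) : Prop :=
  ∀ x ∈ Q, cs.simple s * x ∈ Q ∧ φ (cs.simple s * x) = cs.simple s * φ x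

/-- The generator `s` is right regular for `(Q, φ)`. -/
def IsRightRegular (cs : CoxeterSystem M W) (Q : Set W) (φ : W → W) (s : B) : Prop :=
  ∀ x ∈ Q, x * cs.simple s ∈ Q ∧ φ (x * cs.simple s) = φ x * cs.simple s

/-- The orbit `{m, φ m}`, with `m ⋖ φ m`, is reducible on the left or on the right. -/
def IsReducibleOrbit (cs : CoxeterSystem M W) (Q : Set W) (φ : W → W) (m : W) : Prop :=
  (∃ s : B, cs.IsLeftDescent m s ∧ cs.IsLeftRegular Q φ s) ∨
  (∃ s : B, cs.IsRightDescent m s ∧ cs.IsRightRegular Q φ s)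

/-- `(Q, φ)` is reducible: the rank is at most `2`, or every full orbit `{m, φ m}`
(`m ⋖ φ m`, `φ m` full) is reducible. -/
def IsReducibleMatching (cs : CoxeterSystem M W) (Q : Set W) (φ : W → W) : Prop :=
  ENat.card B ≤ 2 ∨
  ∀ m ∈ Q, cs.BruhatCovBy m (φ m) → cs.IsFull (φ m) → cs.IsReducibleOrbit Q φ m

/-- `C`: the generators commuting with `a = φ e` (so `a` itself belongs to `C`). -/
def setC (cs : CoxeterSystem M W) (φ : W → W) : Set B :=
  {s | cs.simple s * φ 1 = φ 1 * cs.simple s}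

/-- `U`: the generators `s ∉ C` with `φ s = s a`, where `a = φ e`. -/
def setU (cs : CoxeterSystem M W) (Q : Set W) (φ : W → W) : Set B :=
  {s | s ∉ cs.setC φ ∧ cs.simple s ∈ Q ∧ φ (cs.simple s) = cs.simple s * φ 1}

/-- `V`: the generators `s ∉ C` with `φ s = a s`, where `a = φ e`. -/
def setV (cs : CoxeterSystem M W) (Q : Set W) (φ : W → W) : Set B :=
  {s | s ∉ cs.setC φ ∧ cs.simple s ∈ Q ∧ φ (cs.simple s) = φ 1 * cs.simple s}

/-- The matching is crossed: both `U` and `V` are non-empty. -/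
def IsCrossed (cs : CoxeterSystem M W) (Q : Set W) (φ : W → W) : Prop :=
  (cs.setU Q φ).Nonempty ∧ (cs.setV Q φ).Nonempty

end CoxeterSystem

/-! Suppose first that the matching is full. Since `φ` preserves every parabolic subgroup containing
`a`, each generator outside `C` lies in `U` or `V`. An element `y ∈ Q` not above `a` is matched
upwards, and `φ y` arises by inserting `a` into a reduced word of `y` (`exists_insert`). As `φ` is
monotone towards elements matched upwards, `y ≥ u, v` with `u ∈ U`, `v ∈ V` implies `φ y ≥ ua, av`:
some reduced word of `y` has a `u` to the left and a `v` to the right of the inserted `a`. So `U`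
and `V` commute (`commute_of_mem`), and `vau ∉ Q` (`wordProd_notMem`), because otherwise `uav` and
`vau` would both lie below an element of length at most 4. Reduced words of elements of `Q` thus
avoid the subword `v, a, u`. Letters of `U` can then be moved to the left of letters of `V`, which
gives a reduced factorization of every element of `Q` along `⟨U ∪ C⟩⟨V ∪ C⟩` (`exists_factor`).

On `⟨a, u⟩` the matching is `x ↦ xa`, unless it deviates by extending some word `⋯au` on the left.
Deviations for some `u ∈ U` and, symmetrically, for some `v ∈ V` exclude each other
(`false_of_deviations`). A full element lies above long words `⋯au` and `va⋯`; avoiding `v, a, u`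
forces them side by side, so `⋯auva⋯` lies in `Q`. Its only reduced words differ by swapping the
middle `u` and `v`, and the one letter that `φ` may add cannot serve both deviations.

Inversion exchanges `U` and `V`, so one may assume that `φ` is `x ↦ xa` on `⟨a, r⟩` for every `r ∈ U
∪ C`. Then `φ(sx) = sφ(x)` for `s ∈ U ∪ C` by induction on length (`map_simple_mul`): in the
critical case both sides have the same coatoms, and distinct elements with equal coatoms lie in a
common dihedral parabolic subgroup (`exists_mem_parabolic_pair_of_coat_eq`), where the claim is
checked directly. Maximality turns this into left regularity (`IsMaximalMatching.isLeftRegular`),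
and the factorization gives alternative 1; inversion gives alternative 2. For reducibility, fullness
of `φ m` makes the matching full, and `m` has a left descent in `U ∪ C`, since otherwise `m` and `φ
m` would lie in `⟨V ∪ C⟩`. -/

namespace CoxeterSystem

variable {B W : Type*} [Group W] {M : CoxeterMatrix B}

/-! ### The strong exchange property -/

open scoped Classical in
/-- The permutation of `W × ZMod 2` attached to a generator; it records inversions. -/
noncomputable def invPerm (cs : CoxeterSystem M W) (i : B) : Equiv.Perm (W × ZMod 2) :=
  Function.Involutive.toPerm
    (fun p => (cs.simple i * p.1 * cs.simple i, p.2 + if p.1 = cs.simple i then 1 else 0)) (by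
      rintro ⟨t, e⟩
      have h : cs.simple i * t * cs.simple i = cs.simple i ↔ t = cs.simple i := by
        constructor
        · intro h
          have := congrArg (fun x => cs.simple i * x * cs.simple i) h
          simpa [mul_assoc] using this
        · rintro rfl
          simp
      have h2 : (1 : ZMod 2) + 1 = 0 := rfl
      ext
      · simp [mul_assoc]
      · simp only [h]
        split_ifs <;> simp [add_assoc, h2])

open scoped Classical in
theorem invPerm_apply (cs : CoxeterSystem M W) (i : B) (t : W) (e : ZMod 2) :
    cs.invPerm i (t, e) =
      (cs.simple i * t * cs.simple i, e + if t = cs.simple i then 1 else 0) := rfl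

-- The head letter of a word flips the sign exactly when it equals the conjugate of `t` by the tail,
-- that is, when `t` is the leading entry of the right inversion sequence.
open scoped Classical in
theorem prod_map_invPerm_apply (cs : CoxeterSystem M W) (ω : List B) (t : W) (e : ZMod 2) :
    (ω.map cs.invPerm).prod (t, e) =
      (cs.wordProd ω * t * (cs.wordProd ω)⁻¹, e + ((cs.rightInvSeq ω).count t : ZMod 2)) := by
  induction ω with
  | nil => simp
  | cons i ω ih =>
    rw [List.map_cons, List.prod_cons, Equiv.Perm.mul_apply, ih, invPerm_apply, rightInvSeq,
      List.count_cons, wordProd_cons]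
    have h : cs.wordProd ω * t * (cs.wordProd ω)⁻¹ = cs.simple i ↔
        (cs.wordProd ω)⁻¹ * cs.simple i * cs.wordProd ω = t := by
      rw [mul_inv_eq_iff_eq_mul, mul_assoc, inv_mul_eq_iff_eq_mul, eq_comm]
    simp only [Prod.mk.injEq, mul_inv_rev, inv_simple, mul_assoc, beq_iff_eq, true_and] at h ⊢
    simp only [h]
    push_cast
    rw [add_assoc]

-- Since `(s_i s_j) ^ m = 1`, the inversion sequence has period `m`: its two halves coincide, and
-- every reflection is counted twice.
open scoped Classical in
theorem even_count_leftInvSeq_alternatingWord (cs : CoxeterSystem M W) (i j : B) (t : W) :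
    Even ((cs.leftInvSeq (alternatingWord i j (2 * M i j))).count t) := by
  set m := M i j with hm
  set L := cs.leftInvSeq (alternatingWord i j (2 * m)) with hL
  have hlen : L.length = 2 * m := by simp [hL]
  have key : L.drop m = L.take m := by
    apply List.ext_getElem
    · simp [hlen]; omega
    · intro k h1 h2
      have hk : k < m := by simp at h2; omega
      rw [List.getElem_drop, List.getElem_take]
      simp only [hL]
      rw [cs.getElem_leftInvSeq_alternatingWord i j m (m + k) (by omega),
        cs.getElem_leftInvSeq_alternatingWord i j m k (by omega),
        prod_alternatingWord_eq_mul_pow, prod_alternatingWord_eq_mul_pow]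
      have h1 : ¬ Even (2 * (m + k) + 1) := by simp
      have h2 : ¬ Even (2 * k + 1) := by simp
      have h3 : (2 * (m + k) + 1) / 2 = m + k := by omega
      have h4 : (2 * k + 1) / 2 = k := by omega
      rw [if_neg h1, if_neg h2, h3, h4, pow_add, hm, simple_mul_simple_pow', one_mul]
  rw [← List.take_append_drop m L, List.count_append, key]
  exact ⟨_, rfl⟩

theorem isLiftable_invPerm (cs : CoxeterSystem M W) : M.IsLiftable cs.invPerm := by
  classical
  intro i j
  have h : ∀ n, (cs.invPerm i * cs.invPerm j) ^ n =
      ((alternatingWord i j (2 * n)).map cs.invPerm).prod := by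
    intro n
    induction n with
    | zero => simp [alternatingWord]
    | succ n ih =>
      rw [pow_succ, ih, show 2 * (n + 1) = 2 * n + 1 + 1 by ring, alternatingWord_succ,
        alternatingWord_succ]
      simp
  rw [h]
  ext1 ⟨t, e⟩
  rw [prod_map_invPerm_apply, prod_alternatingWord_eq_mul_pow]
  -- Reversal turns the right inversion sequence into a left one, for which the parity of the counts
  -- is known.
  have h1 : alternatingWord i j (2 * M i j) = (alternatingWord j i (2 * M j i)).reverse := by
    rw [M.symmetric j i]
    have : ∀ n, alternatingWord i j (2 * n) = (alternatingWord j i (2 * n)).reverse := by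
      intro n
      induction n with
      | zero => simp [alternatingWord]
      | succ n ih =>
        rw [show 2 * (n + 1) = 2 * n + 1 + 1 by ring, alternatingWord_succ' j i,
          alternatingWord_succ' j i, alternatingWord_succ, alternatingWord_succ, ih]
        simp [parity_simps]
    exact this _
  rw [h1, rightInvSeq_reverse, List.count_reverse]
  have := cs.even_count_leftInvSeq_alternatingWord j i t
  rw [(ZMod.natCast_eq_zero_iff_even).2 this]
  simp

/-- The action of `W` on `W × ZMod 2` recording inversions. -/
noncomputable def invHom (cs : CoxeterSystem M W) : W →* Equiv.Perm (W × ZMod 2) :=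
  cs.lift ⟨cs.invPerm, cs.isLiftable_invPerm⟩

theorem invHom_wordProd (cs : CoxeterSystem M W) (ω : List B) :
    cs.invHom (cs.wordProd ω) = (ω.map cs.invPerm).prod := by
  induction ω with
  | nil => simp
  | cons i ω ih =>
    rw [wordProd_cons, map_mul, ih, List.map_cons, List.prod_cons, invHom, lift_apply_simple]

/-- The parity of the number of occurrences of `t` in the right inversion sequence of `w`. -/
noncomputable def invParity (cs : CoxeterSystem M W) (w t : W) : ZMod 2 :=
  (cs.invHom w (t, 0)).2

open scoped Classical in
theorem invParity_wordProd (cs : CoxeterSystem M W) (ω : List B) (t : W) :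
    cs.invParity (cs.wordProd ω) t = ((cs.rightInvSeq ω).count t : ZMod 2) := by
  rw [invParity, invHom_wordProd, prod_map_invPerm_apply]
  simp

theorem invHom_apply (cs : CoxeterSystem M W) (w t : W) (e : ZMod 2) :
    cs.invHom w (t, e) = (w * t * w⁻¹, e + cs.invParity w t) := by
  classical
  obtain ⟨ω, rfl⟩ := cs.wordProd_surjective w
  rw [invParity_wordProd, invHom_wordProd, prod_map_invPerm_apply]

theorem invParity_mul (cs : CoxeterSystem M W) (w w' t : W) :
    cs.invParity (w * w') t = cs.invParity w' t + cs.invParity w (w' * t * w'⁻¹) := by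
  rw [invParity, map_mul, Equiv.Perm.mul_apply, invHom_apply, invHom_apply]
  simp

theorem invParity_simple_self (cs : CoxeterSystem M W) (i : B) :
    cs.invParity (cs.simple i) (cs.simple i) = 1 := by
  classical
  have := cs.invParity_wordProd [i] (cs.simple i)
  simpa using this

/-- For `t = u s u⁻¹` the contributions of `u` and `u⁻¹` cancel modulo 2, as they do for `u u⁻¹ =
1`; the middle letter `s` contributes 1. -/
theorem IsReflection.invParity_self {cs : CoxeterSystem M W} {t : W} (ht : cs.IsReflection t) :
    cs.invParity t t = 1 := by
  obtain ⟨u, i, rfl⟩ := ht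
  have h1 : cs.invParity (u * u⁻¹) (u * cs.simple i * u⁻¹) = 0 := by
    simp [invParity]
  rw [invParity_mul] at h1
  rw [invParity_mul, invParity_mul]
  have e1 : u⁻¹ * (u * cs.simple i * u⁻¹) * u⁻¹⁻¹ = cs.simple i := by group
  have e2 : cs.simple i * (cs.simple i) * (cs.simple i)⁻¹ = cs.simple i := by group
  rw [e1] at h1 ⊢
  rw [e2, invParity_simple_self, ← add_assoc, add_right_comm, h1, zero_add]

/-- The strong exchange property. -/
theorem strong_exchange (cs : CoxeterSystem M W) (ω : List B) {t : W} (ht : cs.IsReflection t)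
    (hlt : cs.length (cs.wordProd ω * t) < cs.length (cs.wordProd ω)) :
    ∃ j < ω.length, cs.wordProd ω * t = cs.wordProd (ω.eraseIdx j) := by
  classical
  -- If `t` had parity 0 for `w`, it would have parity 1 for `w t` and so be an inversion of `w t`.
  -- Then `w = (w t) t` would be shorter than `w t`.
  have h1 : cs.invParity (cs.wordProd ω) t ≠ 0 := by
    intro h0
    have h2 : cs.invParity (cs.wordProd ω * t) t = 1 := by
      rw [invParity_mul, ht.invParity_self, mul_inv_cancel_right, h0, add_zero]
    obtain ⟨ω', hω', he⟩ := cs.exists_isReduced (cs.wordProd ω * t)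
    rw [he, invParity_wordProd] at h2
    have hmem : t ∈ cs.rightInvSeq ω' := by
      by_contra hn
      rw [List.count_eq_zero_of_not_mem hn] at h2
      simp at h2
    have h3 := (cs.isRightInversion_of_mem_rightInvSeq hω' hmem).2
    rw [← he, mul_assoc, ht.mul_self, mul_one] at h3
    omega
  rw [invParity_wordProd] at h1
  have hmem : t ∈ cs.rightInvSeq ω := by
    by_contra hn
    rw [List.count_eq_zero_of_not_mem hn] at h1
    simp at h1
  obtain ⟨j, hj, he⟩ := List.mem_iff_getElem.mp hmem
  refine ⟨j, by simpa using hj, ?_⟩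
  rw [← wordProd_mul_getD_rightInvSeq, List.getD_eq_getElem _ 1 hj, he]

/-- Every word has a reduced subword with the same product. -/
theorem exists_isReduced_sublist (cs : CoxeterSystem M W) (ω : List B) :
    ∃ ω', ω'.Sublist ω ∧ cs.IsReduced ω' ∧ cs.wordProd ω' = cs.wordProd ω := by
  induction ω with
  | nil => exact ⟨[], by simp, by simp [IsReduced], rfl⟩
  | cons i ω ih =>
    obtain ⟨τ, hs, hr, hp⟩ := ih
    by_cases h : cs.IsLeftDescent (cs.wordProd τ) i
    · have h' : cs.length ((cs.wordProd τ.reverse) * cs.simple i) <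
          cs.length (cs.wordProd τ.reverse) := by
        have := cs.isRightDescent_inv_iff.2 h
        rwa [← wordProd_reverse] at this
      obtain ⟨j, hj, he⟩ := cs.strong_exchange τ.reverse (cs.isReflection_simple i) h'
      refine ⟨(τ.reverse.eraseIdx j).reverse, ?_, ?_, ?_⟩
      · have := (List.eraseIdx_sublist τ.reverse j).reverse
        rw [List.reverse_reverse] at this
        exact (this.trans hs).cons i
      · rw [isReduced_reverse_iff, IsReduced, ← he]
        have h1 : cs.length (cs.wordProd τ.reverse) = τ.length := by
          rw [wordProd_reverse, length_inv, hr]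
        have h2 := cs.length_mul_simple (cs.wordProd τ.reverse) i
        have h3 := List.length_eraseIdx_add_one hj
        simp at h3
        omega
      · rw [wordProd_reverse, ← he, wordProd_cons, ← hp]
        simp
    · refine ⟨i :: τ, hs.cons_cons i, ?_, by rw [wordProd_cons, hp, wordProd_cons]⟩
      rw [not_isLeftDescent_iff] at h
      rw [IsReduced, wordProd_cons, h, hr, List.length_cons]

/-! ### The order of a product of two generators -/

section Geometric

open Real Polynomial.Chebyshev

/-- The coroots of the geometric representation. -/
noncomputable def coroot (M : CoxeterMatrix B) (i : B) : Module.Dual ℝ (B →₀ ℝ) :=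
  Finsupp.linearCombination ℝ (fun j => -2 * cos (π / M i j))

theorem coroot_single (M : CoxeterMatrix B) (i j : B) :
    coroot M i (Finsupp.single j 1) = -2 * cos (π / M i j) := by
  simp [coroot]

theorem coroot_self (M : CoxeterMatrix B) (i : B) : coroot M i (Finsupp.single i 1) = 2 := by
  simp [coroot_single]

/-- The reflections of the geometric representation. -/
noncomputable def geomReflection (M : CoxeterMatrix B) (i : B) :
    (B →₀ ℝ) ≃ₗ[ℝ] (B →₀ ℝ) := Module.reflection (coroot_self M i)

theorem coroot_mul_coroot (M : CoxeterMatrix B) (i j : B) :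
    2 * cos (2 * π / M i j) =
      coroot M i (Finsupp.single j 1) * coroot M j (Finsupp.single i 1) - 2 := by
  rw [coroot_single, coroot_single, M.symmetric j i,
    show 2 * π / (M i j : ℝ) = 2 * (π / M i j) by ring, cos_two_mul]
  ring

theorem S_eval_two_mul_cos {θ : ℝ} (h : sin θ ≠ 0) (n : ℤ) :
    (S ℝ n).eval (2 * cos θ) = sin ((n + 1) * θ) / sin θ := by
  rw [eq_div_iff h, S_two_mul_real_cos]

theorem sin_two_pi_div_pos {m : ℕ} (hm : 3 ≤ m) : 0 < sin (2 * π / m) := by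
  have h3 : (3 : ℝ) ≤ m := by exact_mod_cast hm
  apply sin_pos_of_pos_of_lt_pi
  · positivity
  · rw [div_lt_iff₀ (by positivity)]
    nlinarith [pi_pos]

/-- For `m ≥ 3` the powers of a product of two reflections are governed by Chebyshev polynomials at
`2 cos θ` with `m θ = 2π`; the factors that must vanish depend on the parity of `m`. The cases 0
(infinite order, trivial exponent), 1 and 2 are separate. -/
theorem isLiftable_geomReflection (M : CoxeterMatrix B) : M.IsLiftable (geomReflection M) := by
  intro i j
  rcases Nat.lt_or_ge (M i j) 3 with h3 | h3
  · have hcase : M i j = 0 ∨ M i j = 1 ∨ M i j = 2 := by omega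
    rcases hcase with h | h | h
    · rw [h, pow_zero]
    · have hij : i = j := by
        by_contra hij
        exact M.off_diagonal i j hij h
      subst hij
      ext1 z
      rw [h, pow_one]
      exact Module.involutive_reflection (coroot_self M i) z
    · have h1 : coroot M i (Finsupp.single j 1) = 0 := by rw [coroot_single, h]; simp
      have h2 : coroot M j (Finsupp.single i 1) = 0 := by
        rw [coroot_single, M.symmetric j i, h]; simp
      ext1 z
      rw [h, pow_two]
      simp only [geomReflection, LinearEquiv.mul_apply, Module.reflection_apply, map_sub, map_smul,
        h1, h2, coroot_self, LinearEquiv.coe_one, id]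
      module
  · ext1 z
    rw [geomReflection, geomReflection,
      Module.reflection_mul_reflection_pow_apply _ _ _ _ _ (coroot_mul_coroot M i j)]
    have hs := (sin_two_pi_div_pos h3).ne'
    set m := M i j with hm
    set θ := 2 * π / (m : ℝ) with hθ
    have hm0 : (m : ℝ) ≠ 0 := by positivity
    have hmθ : m * θ = 2 * π := by rw [hθ]; field_simp
    rcases Nat.even_or_odd' m with ⟨p, hp | hp⟩
    · have e1 : ((m : ℤ) - 2) / 2 = p - 1 := by omega
      have e2 : ((m : ℤ) - 1) / 2 = p - 1 := by omega
      have h0 : (S ℝ ((p : ℤ) - 1)).eval (2 * cos θ) = 0 := by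
        have : (p : ℝ) * θ = π := by
          rw [hp] at hmθ; push_cast at hmθ; linarith
        rw [S_eval_two_mul_cos hs]
        push_cast
        rw [sub_add_cancel, this, sin_pi, zero_div]
      rw [e1, e2, h0]
      simp
    · have e1 : ((m : ℤ) - 2) / 2 = p - 1 := by omega
      have e2 : ((m : ℤ) - 1) / 2 = p := by omega
      have e3 : ((m : ℤ) - 3) / 2 = p - 1 := by omega
      have e4 : (m : ℤ) / 2 = p := by omega
      have h0 : (S ℝ (p : ℤ)).eval (2 * cos θ) + (S ℝ ((p : ℤ) - 1)).eval (2 * cos θ) = 0 := by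
        have : ((p : ℝ) + 1) * θ = 2 * π - p * θ := by
          rw [hp] at hmθ; push_cast at hmθ; linarith
        rw [S_eval_two_mul_cos hs, S_eval_two_mul_cos hs]
        push_cast
        rw [sub_add_cancel, this, sin_two_pi_sub]
        ring
      rw [e1, e2, e3, e4, h0]
      simp

/-- The entries of the Coxeter matrix are the orders of the products of two generators. -/
theorem dvd_of_simple_mul_simple_pow_eq_one (cs : CoxeterSystem M W) {i j : B}
    {n : ℕ} (hn : (cs.simple i * cs.simple j) ^ n = 1) : M i j ∣ n := by
  have hg := congrArg (cs.lift ⟨geomReflection M, isLiftable_geomReflection M⟩) hn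
  rw [map_pow, map_mul, lift_apply_simple, lift_apply_simple, map_one] at hg
  by_cases hij : i = j
  · subst hij; simp
  have hm1 : M i j ≠ 1 := M.off_diagonal i j hij
  -- Compare coordinates of the image of the simple root at `i`. For `m ≥ 3` the `j`-coordinate
  -- gives `sin (n θ) = 0`; then the `i`-coordinate gives `cos (n θ) = 1`, so `n` is a multiple of
  -- `m`.
  have hg' := LinearEquiv.congr_fun hg (Finsupp.single i 1)
  rw [geomReflection, geomReflection,
    Module.reflection_mul_reflection_pow_apply_self _ _ _ _ (coroot_mul_coroot M i j)] at hg'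
  have hi := DFunLike.congr_fun hg' i
  have hj := DFunLike.congr_fun hg' j
  simp [hij, Ne.symm hij, coroot_single, M.symmetric j i] at hi hj
  rcases Nat.lt_or_ge (M i j) 3 with h3 | h3
  · have h02 : M i j = 0 ∨ M i j = 2 := by omega
    rcases h02 with h2 | h2
    · rw [h2] at hi ⊢
      -- The value 0 encodes infinite order. Division by zero makes the angle 0, so the
      -- `i`-coordinate is `2n + 1` and equals 1 only for `n = 0`.
      simp only [Nat.cast_zero, div_zero, cos_zero, mul_one, S_eval_two] at hi
      push_cast at hi
      have : (n : ℝ) = 0 := by linarith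
      simpa using this
    rw [h2] at hi ⊢
    have : 2 * cos (2 * π / (2 : ℕ)) = -2 := by
      push_cast
      rw [mul_div_cancel_left₀ _ (two_ne_zero), cos_pi]; ring
    rw [this, S_eval_neg_two, S_eval_neg_two] at hi
    rcases Nat.even_or_odd n with he | ho
    · exact he.two_dvd
    · exfalso
      have e1 : (n : ℤ).negOnePow = -1 := Int.negOnePow_odd _ (by exact_mod_cast ho)
      have e2 : ((n : ℤ) - 1).negOnePow = 1 := by
        apply Int.negOnePow_even
        have : Odd (n : ℤ) := by exact_mod_cast ho
        exact this.sub_odd odd_one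
      rw [e1, e2] at hi
      push_cast at hi
      linarith
  · have hs := (sin_two_pi_div_pos h3).ne'
    set m := M i j with hm
    set θ := 2 * π / (m : ℝ) with hθ
    have hm0 : (m : ℝ) ≠ 0 := by positivity
    have hcos : cos (π / m) ≠ 0 := by
      have h3' : (3 : ℝ) ≤ m := by exact_mod_cast h3
      apply (cos_pos_of_mem_Ioo ⟨?_, ?_⟩).ne'
      · have : 0 < π / m := by positivity
        linarith [pi_pos]
      · rw [div_lt_div_iff₀ (by positivity) (by positivity)]
        nlinarith [pi_pos]
    have hS : (S ℝ ((n : ℤ) - 1)).eval (2 * cos θ) = 0 := by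
      rcases hj with h | h
      · exact h
      · exact absurd h hcos
    rw [hS, S_eval_two_mul_cos hs, add_zero, div_eq_one_iff_eq hs] at hi
    rw [S_eval_two_mul_cos hs, div_eq_zero_iff, or_iff_left hs] at hS
    push_cast at hi hS
    rw [sub_add_cancel] at hS
    rw [add_mul, one_mul, sin_add, hS, zero_mul, zero_add] at hi
    have hc : cos (n * θ) = 1 := mul_right_cancel₀ hs (by rw [hi, one_mul])
    rw [cos_eq_one_iff] at hc
    obtain ⟨k, hk⟩ := hc
    have h5 : (k : ℝ) * m = n := by
      rw [hθ] at hk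
      field_simp at hk
      linarith
    have h6 : k * (m : ℤ) = n := by exact_mod_cast h5
    exact Int.natCast_dvd_natCast.1 ⟨k, by rw [← h6, mul_comm]⟩

theorem simple_injective (cs : CoxeterSystem M W) : Function.Injective cs.simple := by
  intro i j h
  have h1 : (cs.simple i * cs.simple j) ^ 1 = 1 := by rw [h, pow_one, simple_mul_simple_self]
  have h2 := Nat.dvd_one.1 (cs.dvd_of_simple_mul_simple_pow_eq_one h1)
  by_contra hij
  exact M.off_diagonal i j hij h2

end Geometric

end CoxeterSystem

namespace CoxeterSystem

variable {B W : Type*} [Group W] {M : CoxeterMatrix B} {cs : CoxeterSystem M W}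

/-! ### Bruhat order -/

theorem left_exchange (cs : CoxeterSystem M W) (ω : List B) {i : B}
    (h : cs.IsLeftDescent (cs.wordProd ω) i) :
    ∃ j < ω.length, cs.simple i * cs.wordProd ω = cs.wordProd (ω.eraseIdx j) := by
  have ht : cs.IsReflection ((cs.wordProd ω)⁻¹ * cs.simple i * cs.wordProd ω) :=
    ⟨(cs.wordProd ω)⁻¹, i, by rw [inv_inv]⟩
  have e : cs.wordProd ω * ((cs.wordProd ω)⁻¹ * cs.simple i * cs.wordProd ω) =
      cs.simple i * cs.wordProd ω := by group
  obtain ⟨j, hj, h1⟩ := cs.strong_exchange ω ht (by rw [e]; exact h)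
  exact ⟨j, hj, by rw [← h1, e]⟩

theorem BruhatLE.refl (cs : CoxeterSystem M W) (x : W) : cs.BruhatLE x x :=
  Relation.ReflTransGen.refl

theorem BruhatLE.trans {x y z : W} (h : cs.BruhatLE x y) (h' : cs.BruhatLE y z) :
    cs.BruhatLE x z := Relation.ReflTransGen.trans h h'

theorem bruhatLE_of_reflection {u t : W} (ht : cs.IsReflection t)
    (h : cs.length u < cs.length (u * t)) : cs.BruhatLE u (u * t) :=
  Relation.ReflTransGen.single ⟨t, ht, rfl, h⟩

theorem bruhatLE_of_left_reflection {u t : W} (ht : cs.IsReflection t)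
    (h : cs.length u < cs.length (t * u)) : cs.BruhatLE u (t * u) := by
  have e : t * u = u * (u⁻¹ * t * u) := by group
  have ht' : cs.IsReflection (u⁻¹ * t * u) := by simpa using ht.conj u⁻¹
  rw [e] at h ⊢
  exact bruhatLE_of_reflection ht' h

theorem BruhatLE.length_le {x y : W} (h : cs.BruhatLE x y) : cs.length x ≤ cs.length y := by
  induction h with
  | refl => exact le_rfl
  | tail _ h ih =>
    obtain ⟨t, _, _, h⟩ := h
    omega

theorem BruhatLE.eq_of_length_le {x y : W} (h : cs.BruhatLE x y)
    (h' : cs.length y ≤ cs.length x) : x = y := by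
  rcases Relation.ReflTransGen.cases_tail h with h1 | ⟨z, hz, t, _, _, h2⟩
  · exact h1.symm
  · have := BruhatLE.length_le hz
    omega

theorem BruhatLE.length_lt {x y : W} (h : cs.BruhatLE x y) (hne : x ≠ y) :
    cs.length x < cs.length y := by
  by_contra hc
  exact hne (h.eq_of_length_le (not_lt.1 hc))

theorem BruhatLE.inv {x y : W} (h : cs.BruhatLE x y) : cs.BruhatLE x⁻¹ y⁻¹ := by
  induction h with
  | refl => exact BruhatLE.refl cs _
  | @tail b c _ h ih =>
    obtain ⟨t, ht, rfl, hl⟩ := h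
    refine ih.trans ?_
    have e : (b * t)⁻¹ = t * b⁻¹ := by rw [mul_inv_rev, ht.inv]
    rw [e]
    apply bruhatLE_of_left_reflection ht
    rwa [← e, length_inv, length_inv]

theorem bruhatLE_inv_iff {x y : W} : cs.BruhatLE x⁻¹ y⁻¹ ↔ cs.BruhatLE x y :=
  ⟨fun h => by simpa using h.inv, BruhatLE.inv⟩

theorem exists_sublist_of_bruhatLE {x : W} {ω : List B} (hω : cs.IsReduced ω)
    (h : cs.BruhatLE x (cs.wordProd ω)) :
    ∃ τ, τ.Sublist ω ∧ cs.IsReduced τ ∧ cs.wordProd τ = x := by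
  induction h using Relation.ReflTransGen.head_induction_on with
  | refl => exact ⟨ω, List.Sublist.refl _, hω, rfl⟩
  | @head a c h _ ih =>
    obtain ⟨t, ht, h1, hl⟩ := h
    obtain ⟨τ, hs, hr, hp⟩ := ih
    have e : cs.wordProd τ * t = a := by rw [hp, h1, mul_assoc, ht.mul_self, mul_one]
    obtain ⟨j, _, h2⟩ := cs.strong_exchange τ ht (by rw [e, hp]; exact hl)
    obtain ⟨τ', hs', hr', hp'⟩ := cs.exists_isReduced_sublist (τ.eraseIdx j)
    exact ⟨τ', hs'.trans ((List.eraseIdx_sublist _ _).trans hs), hr', by rw [hp', ← h2, e]⟩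

/-- Consider one upward step `x < xt`. If `sx < sxt`, the step is simply translated. Otherwise
exchange deletes a letter from a word `s ξ`, with `ξ` reduced for `x`; deleting from `ξ` would make
`xt` shorter than `x`, so `s` is deleted and `sx = xt`. -/
theorem BruhatLE.simple_mul {x y : W} (h : cs.BruhatLE x y) (i : B) :
    cs.BruhatLE (cs.simple i * x) (cs.simple i * y) ∨ cs.BruhatLE (cs.simple i * x) y := by
  induction h using Relation.ReflTransGen.head_induction_on with
  | refl => exact Or.inl (BruhatLE.refl cs _)
  | @head x z h hzy ih =>
    obtain ⟨t, ht, rfl, hl⟩ := h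
    by_cases hlt : cs.length (cs.simple i * x) < cs.length (cs.simple i * (x * t))
    · rw [← mul_assoc] at hlt
      have h1 := bruhatLE_of_reflection ht hlt
      rw [mul_assoc] at h1
      exact ih.imp h1.trans h1.trans
    · right
      have hlt' : cs.length (cs.simple i * x * t) < cs.length (cs.simple i * x) := by
        have := ht.length_mul_left_ne (cs.simple i * x)
        rw [mul_assoc] at this ⊢
        omega
      have h1 := cs.length_simple_mul x i
      have h2 := cs.length_simple_mul (x * t) i
      rw [mul_assoc] at hlt'
      obtain ⟨ξ, hξ, hx⟩ := cs.exists_isReduced x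
      have hp : cs.wordProd (i :: ξ) = cs.simple i * x := by rw [wordProd_cons, hx]
      obtain ⟨j, hj, he⟩ := cs.strong_exchange (i :: ξ) ht (by rw [hp, mul_assoc]; exact hlt')
      rw [hp] at he
      cases j with
      | zero =>
        rw [List.eraseIdx_zero, List.tail_cons, ← hx] at he
        have : cs.simple i * x = x * t := by
          rw [eq_comm, ← ht.inv, mul_inv_eq_iff_eq_mul, he]
        rw [this]
        exact hzy
      | succ j =>
        exfalso
        rw [List.eraseIdx_cons_succ, wordProd_cons, mul_assoc, mul_right_inj] at he
        have h3 := cs.length_wordProd_le (ξ.eraseIdx j)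
        have h4 := List.length_eraseIdx_add_one (l := ξ) (i := j) (by simpa using hj)
        rw [← he] at h3
        have : cs.length x = ξ.length := by rw [hx, hξ]
        omega

theorem bruhatLE_simple_mul_self {x : W} {i : B} (h : ¬ cs.IsLeftDescent x i) :
    cs.BruhatLE x (cs.simple i * x) := by
  rw [not_isLeftDescent_iff] at h
  exact bruhatLE_of_left_reflection (cs.isReflection_simple i) (by omega)

theorem simple_mul_bruhatLE_self {x : W} {i : B} (h : cs.IsLeftDescent x i) :
    cs.BruhatLE (cs.simple i * x) x := by
  have h1 := bruhatLE_simple_mul_self (cs.isLeftDescent_iff_not_isLeftDescent_mul.1 h)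
  rwa [simple_mul_simple_cancel_left] at h1

theorem BruhatLE.simple_mul_simple_mul {x y : W} (h : cs.BruhatLE x y) {i : B}
    (hy : ¬ cs.IsLeftDescent y i) : cs.BruhatLE (cs.simple i * x) (cs.simple i * y) :=
  (h.simple_mul i).elim id fun h => h.trans (bruhatLE_simple_mul_self hy)

theorem BruhatLE.simple_mul_le {x y : W} (h : cs.BruhatLE x y) {i : B}
    (hy : cs.IsLeftDescent y i) : cs.BruhatLE (cs.simple i * x) y :=
  (h.simple_mul i).elim (fun h => h.trans (simple_mul_bruhatLE_self hy)) id

theorem IsReduced.tail {i : B} {ω : List B} (h : cs.IsReduced (i :: ω)) : cs.IsReduced ω := by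
  simpa using h.drop 1

theorem IsReduced.append_left {ω ω' : List B} (h : cs.IsReduced (ω ++ ω')) : cs.IsReduced ω := by
  simpa using h.take ω.length

theorem IsReduced.not_isLeftDescent {i : B} {ω : List B} (h : cs.IsReduced (i :: ω)) :
    ¬ cs.IsLeftDescent (cs.wordProd ω) i := by
  rw [not_isLeftDescent_iff, ← wordProd_cons, h.eq, h.tail.eq, List.length_cons]

theorem IsReduced.isLeftDescent {i : B} {ω : List B} (h : cs.IsReduced (i :: ω)) :
    cs.IsLeftDescent (cs.wordProd (i :: ω)) i := by
  rw [isLeftDescent_iff_not_isLeftDescent_mul, wordProd_cons, simple_mul_simple_cancel_left]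
  exact h.not_isLeftDescent

theorem isReduced_cons_iff {i : B} {ω : List B} :
    cs.IsReduced (i :: ω) ↔ cs.IsReduced ω ∧ ¬ cs.IsLeftDescent (cs.wordProd ω) i := by
  refine ⟨fun h => ⟨h.tail, h.not_isLeftDescent⟩, fun ⟨h, h'⟩ => ?_⟩
  rw [not_isLeftDescent_iff] at h'
  rw [IsReduced, wordProd_cons, h', h.eq, List.length_cons]

theorem bruhatLE_of_sublist {τ ω : List B} (hs : τ.Sublist ω) (hω : cs.IsReduced ω) :
    cs.BruhatLE (cs.wordProd τ) (cs.wordProd ω) := by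
  induction hs with
  | slnil => exact BruhatLE.refl cs _
  | cons i _ ih =>
    refine (ih hω.tail).trans ?_
    rw [wordProd_cons]
    exact bruhatLE_simple_mul_self hω.not_isLeftDescent
  | cons_cons i _ ih =>
    rw [wordProd_cons, wordProd_cons]
    exact (ih hω.tail).simple_mul_simple_mul hω.not_isLeftDescent

theorem exists_isReduced_cons {x : W} {i : B} (h : cs.IsLeftDescent x i) :
    ∃ ω, cs.IsReduced (i :: ω) ∧ cs.wordProd (i :: ω) = x := by
  obtain ⟨ω, hω, he⟩ := cs.exists_isReduced (cs.simple i * x)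
  have e : cs.wordProd (i :: ω) = x := by rw [wordProd_cons, ← he, simple_mul_simple_cancel_left]
  refine ⟨ω, isReduced_cons_iff.2 ⟨hω, ?_⟩, e⟩
  rw [← he]
  exact cs.isLeftDescent_iff_not_isLeftDescent_mul.1 h

/-- The lifting property, by subwords: take a reduced word of `y` starting with `i`. A reduced
subword for `x` cannot use that letter, since `i` would then be a descent of `x`. -/
theorem BruhatLE.le_simple_mul {x y : W} (h : cs.BruhatLE x y) {i : B}
    (hy : cs.IsLeftDescent y i) (hx : ¬ cs.IsLeftDescent x i) :
    cs.BruhatLE x (cs.simple i * y) := by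
  obtain ⟨ω, hω, rfl⟩ := exists_isReduced_cons hy
  obtain ⟨τ, hs, hr, rfl⟩ := exists_sublist_of_bruhatLE hω h
  rw [wordProd_cons, simple_mul_simple_cancel_left]
  cases hs with
  | cons _ hs => exact bruhatLE_of_sublist hs hω.tail
  | cons_cons _ hs => exact absurd hr.isLeftDescent hx

theorem one_bruhatLE (cs : CoxeterSystem M W) (x : W) : cs.BruhatLE 1 x := by
  obtain ⟨ω, hω, rfl⟩ := cs.exists_isReduced x
  exact cs.wordProd_nil ▸ bruhatLE_of_sublist (List.nil_sublist ω) hω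

theorem simple_bruhatLE_of_mem {ω : List B} (hω : cs.IsReduced ω) {i : B} (h : i ∈ ω) :
    cs.BruhatLE (cs.simple i) (cs.wordProd ω) := by
  rw [← wordProd_singleton]
  exact bruhatLE_of_sublist (List.singleton_sublist.2 h) hω

theorem isReduced_singleton (i : B) : cs.IsReduced [i] := by
  rw [IsReduced, wordProd_singleton, length_simple, List.length_singleton]

theorem eq_singleton_of_wordProd_eq_simple {τ : List B} (hτ : cs.IsReduced τ) {i : B}
    (h : cs.wordProd τ = cs.simple i) : τ = [i] := by
  have hl : τ.length = 1 := by rw [← hτ.eq, h, length_simple]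
  obtain ⟨j, rfl⟩ := List.length_eq_one_iff.1 hl
  rw [wordProd_singleton] at h
  rw [cs.simple_injective h]

theorem simple_bruhatLE_iff_mem {ω : List B} (hω : cs.IsReduced ω) {i : B} :
    cs.BruhatLE (cs.simple i) (cs.wordProd ω) ↔ i ∈ ω := by
  refine ⟨fun h => ?_, simple_bruhatLE_of_mem hω⟩
  obtain ⟨τ, hs, hr, hp⟩ := exists_sublist_of_bruhatLE hω h
  rw [eq_singleton_of_wordProd_eq_simple hr hp] at hs
  exact List.singleton_sublist.1 hs

/-- This makes the Bruhat order graded by length. Strip a left descent `i` from `y`, and from `x` as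
well if `i` is a descent there, and lift the coatom found by induction back through `i`. -/
theorem exists_bruhatLE_length_eq {x y : W} (h : cs.BruhatLE x y) (hne : x ≠ y) :
    ∃ c, cs.BruhatLE x c ∧ cs.BruhatLE c y ∧ cs.length y = cs.length c + 1 := by
  induction hn : cs.length y using Nat.strong_induction_on generalizing x y with
  | _ n ih =>
    subst hn
    have hy1 : y ≠ 1 := by
      rintro rfl
      have := h.length_lt hne
      simp at this
    obtain ⟨i, hi⟩ := cs.exists_leftDescent_of_ne_one hy1
    have hlen := cs.isLeftDescent_iff.1 hi
    have hle := simple_mul_bruhatLE_self hi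
    by_cases hx : cs.IsLeftDescent x i
    · have hsx : ¬ cs.IsLeftDescent (cs.simple i * x) i :=
        cs.isLeftDescent_iff_not_isLeftDescent_mul.1 hx
      have h1 := ((simple_mul_bruhatLE_self hx).trans h).le_simple_mul hi hsx
      obtain ⟨c, h2, h3, h4⟩ := ih _ (by omega) h1 (by simpa using hne) rfl
      by_cases hc : cs.IsLeftDescent c i
      · have h5 := h2.simple_mul_le hc
        rw [simple_mul_simple_cancel_left] at h5
        exact ⟨_, h5.trans h3, hle, hlen.symm⟩
      · have h5 := h2.simple_mul_simple_mul hc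
        rw [simple_mul_simple_cancel_left] at h5
        have h6 := h3.simple_mul_simple_mul (cs.isLeftDescent_iff_not_isLeftDescent_mul.1 hi)
        rw [simple_mul_simple_cancel_left] at h6
        have h7 := cs.not_isLeftDescent_iff.1 hc
        exact ⟨_, h5, h6, by omega⟩
    · exact ⟨_, h.le_simple_mul hi hx, hle, hlen.symm⟩

theorem bruhatCovBy_iff {x y : W} :
    cs.BruhatCovBy x y ↔ cs.BruhatLE x y ∧ cs.length y = cs.length x + 1 := by
  constructor
  · rintro ⟨⟨h, hne⟩, h2⟩
    refine ⟨h, ?_⟩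
    obtain ⟨c, h3, h4, h5⟩ := exists_bruhatLE_length_eq h hne
    by_cases hc : x = c
    · rw [hc, h5]
    · exact absurd ⟨c, ⟨h3, hc⟩, h4, by rintro rfl; omega⟩ h2
  · rintro ⟨h, h2⟩
    refine ⟨⟨h, by rintro rfl; omega⟩, ?_⟩
    rintro ⟨z, ⟨h3, h4⟩, h5, h6⟩
    have := h3.length_lt h4
    have := h5.length_lt h6
    omega

theorem BruhatCovBy.le {x y : W} (h : cs.BruhatCovBy x y) : cs.BruhatLE x y := h.1.1

theorem BruhatCovBy.length_eq {x y : W} (h : cs.BruhatCovBy x y) :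
    cs.length y = cs.length x + 1 := (bruhatCovBy_iff.1 h).2

theorem exists_le_covBy {x y : W} (h : cs.BruhatLE x y) (hne : x ≠ y) :
    ∃ c, cs.BruhatLE x c ∧ cs.BruhatCovBy c y := by
  obtain ⟨c, h1, h2, h3⟩ := exists_bruhatLE_length_eq h hne
  exact ⟨c, h1, bruhatCovBy_iff.2 ⟨h2, h3⟩⟩

theorem bruhatCovBy_inv_iff {x y : W} : cs.BruhatCovBy x⁻¹ y⁻¹ ↔ cs.BruhatCovBy x y := by
  rw [bruhatCovBy_iff, bruhatCovBy_iff, bruhatLE_inv_iff, length_inv, length_inv]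

theorem simple_mul_covBy {x : W} {i : B} (h : cs.IsLeftDescent x i) :
    cs.BruhatCovBy (cs.simple i * x) x :=
  bruhatCovBy_iff.2 ⟨simple_mul_bruhatLE_self h, (cs.isLeftDescent_iff.1 h).symm⟩

theorem covBy_simple_mul {x : W} {i : B} (h : ¬ cs.IsLeftDescent x i) :
    cs.BruhatCovBy x (cs.simple i * x) :=
  bruhatCovBy_iff.2 ⟨bruhatLE_simple_mul_self h, cs.not_isLeftDescent_iff.1 h⟩

theorem mul_simple_covBy {x : W} {i : B} (h : cs.IsRightDescent x i) :
    cs.BruhatCovBy (x * cs.simple i) x := by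
  rw [← bruhatCovBy_inv_iff, mul_inv_rev, inv_simple]
  exact simple_mul_covBy (cs.isLeftDescent_inv_iff.2 h)

theorem BruhatLE.le_mul_simple {x y : W} (h : cs.BruhatLE x y) {i : B}
    (hy : cs.IsRightDescent y i) (hx : ¬ cs.IsRightDescent x i) :
    cs.BruhatLE x (y * cs.simple i) := by
  rw [← bruhatLE_inv_iff, mul_inv_rev, inv_simple]
  exact h.inv.le_simple_mul (cs.isLeftDescent_inv_iff.2 hy)
    (fun hc => hx (cs.isLeftDescent_inv_iff.1 hc))

theorem exists_erase_of_covBy {c : W} {ω : List B} (hω : cs.IsReduced ω)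
    (h : cs.BruhatCovBy c (cs.wordProd ω)) :
    ∃ ω₁ r ω₂, ω = ω₁ ++ r :: ω₂ ∧ cs.IsReduced (ω₁ ++ ω₂) ∧ c = cs.wordProd (ω₁ ++ ω₂) := by
  obtain ⟨τ, hs, hr, rfl⟩ := exists_sublist_of_bruhatLE hω h.le
  have hl : ω.length = τ.length + 1 := by rw [← hω.eq, ← hr.eq, h.length_eq]
  clear h
  suffices ∃ ω₁ r ω₂, ω = ω₁ ++ r :: ω₂ ∧ τ = ω₁ ++ ω₂ by
    obtain ⟨ω₁, r, ω₂, h1, rfl⟩ := this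
    exact ⟨ω₁, r, ω₂, h1, hr, rfl⟩
  clear hω hr
  induction hs with
  | slnil => simp at hl
  | @cons l₁ l₂ i hs _ =>
    have : l₁ = l₂ := hs.eq_of_length (by simpa using hl.symm)
    exact ⟨[], i, l₂, rfl, this⟩
  | @cons_cons l₁ l₂ i hs ih =>
    obtain ⟨ω₁, r, ω₂, h1, h2⟩ := ih (by simpa using hl)
    exact ⟨i :: ω₁, r, ω₂, by simp [h1], by simp [h2]⟩

/-- Left multiplication by a generator satisfies the same coatom recursion as a partial matching;
both inclusions are instances of the lifting property. -/
theorem covBy_simple_mul_iff {y z : W} {i : B} (hz : ¬ cs.IsLeftDescent z i) :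
    cs.BruhatCovBy y (cs.simple i * z) ↔
      y = z ∨ ∃ v, cs.BruhatCovBy v z ∧ ¬ cs.IsLeftDescent v i ∧ y = cs.simple i * v := by
  have hsz : cs.IsLeftDescent (cs.simple i * z) i := by
    rw [isLeftDescent_iff_not_isLeftDescent_mul, simple_mul_simple_cancel_left]
    exact hz
  have hlz := cs.not_isLeftDescent_iff.1 hz
  constructor
  · intro h
    have hl := h.length_eq
    by_cases hy : cs.IsLeftDescent y i
    · right
      have h1 := cs.isLeftDescent_iff_not_isLeftDescent_mul.1 hy
      have h2 := ((simple_mul_bruhatLE_self hy).trans h.le).le_simple_mul hsz h1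
      rw [simple_mul_simple_cancel_left] at h2
      refine ⟨_, bruhatCovBy_iff.2 ⟨h2, ?_⟩, h1, (simple_mul_simple_cancel_left cs i).symm⟩
      have := cs.isLeftDescent_iff.1 hy
      omega
    · left
      have h2 := h.le.le_simple_mul hsz hy
      rw [simple_mul_simple_cancel_left] at h2
      exact h2.eq_of_length_le (by omega)
  · rintro (rfl | ⟨v, h1, h2, rfl⟩)
    · exact covBy_simple_mul hz
    · refine bruhatCovBy_iff.2 ⟨h1.le.simple_mul_simple_mul hz, ?_⟩
      have := h1.length_eq
      have := cs.not_isLeftDescent_iff.1 h2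
      omega

/-! ### Parabolic subgroups -/

theorem simple_mem_parabolic {J : Set B} {i : B} (h : i ∈ J) : cs.simple i ∈ cs.parabolic J :=
  Subgroup.subset_closure ⟨i, h, rfl⟩

theorem wordProd_mem_parabolic {J : Set B} {ω : List B} (h : ∀ i ∈ ω, i ∈ J) :
    cs.wordProd ω ∈ cs.parabolic J := by
  induction ω with
  | nil => rw [wordProd_nil]; exact one_mem _
  | cons i ω ih =>
    rw [wordProd_cons]
    exact mul_mem (simple_mem_parabolic (h i (by simp)))
      (ih fun j hj => h j (List.mem_cons_of_mem _ hj))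

theorem exists_word_of_mem_parabolic {J : Set B} {x : W} (h : x ∈ cs.parabolic J) :
    ∃ ω : List B, (∀ i ∈ ω, i ∈ J) ∧ cs.wordProd ω = x := by
  induction h using Subgroup.closure_induction with
  | mem x hx =>
    obtain ⟨i, hi, rfl⟩ := hx
    exact ⟨[i], by simpa using hi, by simp⟩
  | one => exact ⟨[], by simp, by simp⟩
  | mul x y _ _ hx hy =>
    obtain ⟨ω, h1, rfl⟩ := hx
    obtain ⟨ω', h2, rfl⟩ := hy
    refine ⟨ω ++ ω', fun i hi => ?_, wordProd_append _ _ _⟩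
    exact (List.mem_append.1 hi).elim (h1 i) (h2 i)
  | inv x _ hx =>
    obtain ⟨ω, h1, rfl⟩ := hx
    exact ⟨ω.reverse, fun i hi => h1 i (List.mem_reverse.1 hi), wordProd_reverse _ _⟩

theorem exists_isReduced_of_mem_parabolic {J : Set B} {x : W} (h : x ∈ cs.parabolic J) :
    ∃ ω : List B, (∀ i ∈ ω, i ∈ J) ∧ cs.IsReduced ω ∧ cs.wordProd ω = x := by
  obtain ⟨ω, h1, rfl⟩ := exists_word_of_mem_parabolic h
  obtain ⟨τ, h2, h3, h4⟩ := cs.exists_isReduced_sublist ω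
  exact ⟨τ, fun i hi => h1 i (h2.subset hi), h3, h4⟩

/-- The letters of a reduced word are exactly the generators below its product, hence do not depend
on the word. -/
theorem IsReduced.mem_of_mem_parabolic {J : Set B} {ω : List B} (hω : cs.IsReduced ω)
    (h : cs.wordProd ω ∈ cs.parabolic J) {i : B} (hi : i ∈ ω) : i ∈ J := by
  obtain ⟨τ, h1, h2, h3⟩ := exists_isReduced_of_mem_parabolic h
  have h4 := simple_bruhatLE_of_mem hω hi
  rw [← h3, simple_bruhatLE_iff_mem h2] at h4
  exact h1 i h4

theorem BruhatLE.mem_parabolic {J : Set B} {x y : W} (h : cs.BruhatLE x y)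
    (hy : y ∈ cs.parabolic J) : x ∈ cs.parabolic J := by
  obtain ⟨ω, h1, h2, rfl⟩ := exists_isReduced_of_mem_parabolic hy
  obtain ⟨τ, h3, _, rfl⟩ := exists_sublist_of_bruhatLE h2 h
  exact wordProd_mem_parabolic fun i hi => h1 i (h3.subset hi)

theorem simple_mem_parabolic_iff {J : Set B} {i : B} :
    cs.simple i ∈ cs.parabolic J ↔ i ∈ J := by
  refine ⟨fun h => ?_, simple_mem_parabolic⟩
  rw [← wordProd_singleton] at h
  exact (isReduced_singleton i).mem_of_mem_parabolic h (by simp)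

/-- If a letter of `J` put in front of a reduced word `τ ω` were a descent, exchange would delete a
letter of `τ`, against reducedness of the `J`-part, or a letter of `ω`, yielding a coset element
shorter than `m`. -/
theorem length_mul_of_forall_length_le {J : Set B} {m : W}
    (hm : ∀ g ∈ cs.parabolic J, cs.length m ≤ cs.length (g * m)) {α : W}
    (hα : α ∈ cs.parabolic J) : cs.length (α * m) = cs.length α + cs.length m := by
  obtain ⟨τ, h1, h2, rfl⟩ := exists_isReduced_of_mem_parabolic hα
  obtain ⟨ω, hω, rfl⟩ := cs.exists_isReduced m
  suffices cs.IsReduced (τ ++ ω) by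
    rw [← wordProd_append, this.eq, h2.eq, hω.eq, List.length_append]
  clear hα
  induction τ with
  | nil => exact hω
  | cons i τ ih =>
    have hi : i ∈ J := h1 i (by simp)
    have hτ : ∀ j ∈ τ, j ∈ J := fun j hj => h1 j (List.mem_cons_of_mem _ hj)
    have ih' := ih hτ h2.tail
    rw [List.cons_append, isReduced_cons_iff]
    refine ⟨ih', fun hd => ?_⟩
    obtain ⟨j, hj, he⟩ := cs.left_exchange _ hd
    by_cases hjt : j < τ.length
    · rw [List.eraseIdx_append_of_lt_length hjt, wordProd_append, wordProd_append, ← mul_assoc,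
        mul_left_inj, ← wordProd_cons] at he
      have h3 := cs.length_wordProd_le (τ.eraseIdx j)
      have h4 := List.length_eraseIdx_add_one hjt
      rw [← he, h2.eq, List.length_cons] at h3
      omega
    · rw [List.eraseIdx_append_of_length_le (not_lt.1 hjt), wordProd_append, wordProd_append]
        at he
      have hT := wordProd_mem_parabolic (cs := cs) hτ
      have h3 := hm ((cs.wordProd τ)⁻¹ * cs.simple i * cs.wordProd τ)
        (mul_mem (mul_mem (inv_mem hT) (simple_mem_parabolic hi)) hT)
      rw [mul_assoc, mul_assoc, he, inv_mul_cancel_left] at h3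
      have h4 := cs.length_wordProd_le (ω.eraseIdx (j - τ.length))
      have h5 := List.length_eraseIdx_add_one (l := ω) (i := j - τ.length)
        (by rw [List.length_append] at hj; omega)
      rw [hω.eq] at h3
      omega

/-- Local minimality implies global minimality: if `g x` is shortest in the coset and `g ≠ 1`, the
first letter of a reduced word of `g⁻¹` is a left descent of `x = g⁻¹ (g x)`. -/
theorem length_mul_of_not_isLeftDescent {J : Set B} {x : W}
    (hx : ∀ i ∈ J, ¬ cs.IsLeftDescent x i) {α : W} (hα : α ∈ cs.parabolic J) :
    cs.length (α * x) = cs.length α + cs.length x := by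
  classical
  have hex : ∃ n, ∃ g ∈ cs.parabolic J, cs.length (g * x) = n := ⟨_, 1, one_mem _, rfl⟩
  obtain ⟨g, hg, hgn⟩ := Nat.find_spec hex
  have hmin : ∀ h ∈ cs.parabolic J, cs.length (g * x) ≤ cs.length (h * (g * x)) := by
    intro h hh
    rw [hgn, ← mul_assoc]
    exact Nat.find_min' hex ⟨h * g, mul_mem hh hg, rfl⟩
  have hadd := fun {β : W} => length_mul_of_forall_length_le (α := β) hmin
  have hg1 : g⁻¹ = 1 := by
    by_contra hne
    obtain ⟨τ, h1, h2, h3⟩ := exists_isReduced_of_mem_parabolic (inv_mem hg)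
    cases τ with
    | nil => exact hne (by rw [← h3, wordProd_nil])
    | cons i τ =>
      have hi : i ∈ J := h1 i (by simp)
      have hd := h2.isLeftDescent
      rw [h3] at hd
      have h4 := hadd (inv_mem hg)
      have h5 := hadd (mul_mem (simple_mem_parabolic hi) (inv_mem hg))
      have h6 : cs.simple i * g⁻¹ * (g * x) = cs.simple i * x := by group
      rw [inv_mul_cancel_left] at h4
      rw [h6] at h5
      have := hx i hi
      rw [IsLeftDescent] at this hd
      omega
  have hg2 : g = 1 := by simpa using hg1
  rw [hg2, one_mul] at hadd
  exact hadd hα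

theorem exists_parabolic_factor (cs : CoxeterSystem M W) (J : Set B) (x : W) :
    ∃ α ∈ cs.parabolic J, ∃ x', x = α * x' ∧ ∀ i ∈ J, ¬ cs.IsLeftDescent x' i := by
  induction hn : cs.length x using Nat.strong_induction_on generalizing x with
  | _ n ih =>
    subst hn
    by_cases h : ∃ i ∈ J, cs.IsLeftDescent x i
    · obtain ⟨i, hi, hd⟩ := h
      obtain ⟨α, hα, x', h1, h2⟩ := ih _ hd _ rfl
      refine ⟨cs.simple i * α, mul_mem (simple_mem_parabolic hi) hα, x', ?_, h2⟩
      rw [mul_assoc, ← h1, simple_mul_simple_cancel_left]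
    · push Not at h
      exact ⟨1, one_mem _, x, (one_mul x).symm, h⟩

/-! ### Elements with the same coatoms -/

theorem coat_nonempty {x : W} (hx : x ≠ 1) : (cs.coat x).Nonempty := by
  obtain ⟨c, _, hc⟩ := exists_le_covBy (cs.one_bruhatLE x) hx.symm
  exact ⟨c, hc⟩

theorem length_eq_of_coat_eq {x y : W} (h : cs.coat x = cs.coat y) :
    cs.length x = cs.length y := by
  by_cases hx : x = 1
  · by_cases hy : y = 1
    · rw [hx, hy]
    · obtain ⟨c, hc⟩ := coat_nonempty (cs := cs) hy
      have hc' : c ∈ cs.coat x := h ▸ hc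
      rw [hc'.length_eq, hc.length_eq]
  · obtain ⟨c, hc⟩ := coat_nonempty (cs := cs) hx
    have hc' : c ∈ cs.coat y := h ▸ hc
    rw [hc'.length_eq, hc.length_eq]

/-- For a common descent `i`, the coatom `s_i y` lies below `x` without having `i` as a descent.
Lifting puts it below `s_i x`, which has the same length. -/
theorem not_isLeftDescent_of_coat_eq {x y : W} (h : cs.coat x = cs.coat y) (hne : x ≠ y) {i : B}
    (hx : cs.IsLeftDescent x i) : ¬ cs.IsLeftDescent y i := by
  intro hy
  have hc : cs.simple i * y ∈ cs.coat x := h ▸ simple_mul_covBy hy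
  have h1 := hc.le.le_simple_mul hx (cs.isLeftDescent_iff_not_isLeftDescent_mul.1 hy)
  have h2 := h1.eq_of_length_le (by
    have := length_eq_of_coat_eq h
    have := cs.isLeftDescent_iff.1 hx
    have := cs.isLeftDescent_iff.1 hy
    omega)
  exact hne (mul_left_cancel h2).symm

theorem not_isRightDescent_of_coat_eq {x y : W} (h : cs.coat x = cs.coat y) (hne : x ≠ y) {i : B}
    (hx : cs.IsRightDescent x i) : ¬ cs.IsRightDescent y i := by
  intro hy
  have hc : y * cs.simple i ∈ cs.coat x := h ▸ mul_simple_covBy hy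
  have h1 := hc.le.le_mul_simple hx (cs.isRightDescent_iff_not_isRightDescent_mul.1 hy)
  have h2 := h1.eq_of_length_le (by
    have := length_eq_of_coat_eq h
    have := cs.isRightDescent_iff.1 hx
    have := cs.isRightDescent_iff.1 hy
    omega)
  exact hne (mul_right_cancel h2).symm

/-- Distinct elements with the same coatoms lie in a common parabolic subgroup of rank two. -/
theorem exists_mem_parabolic_pair_of_coat_eq {x y : W} (h : cs.coat x = cs.coat y)
    (hne : x ≠ y) : ∃ p q : B, x ∈ cs.parabolic {p, q} ∧ y ∈ cs.parabolic {p, q} := by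
  have hlen := length_eq_of_coat_eq h
  have hx1 : x ≠ 1 := by
    rintro rfl
    rw [length_one, eq_comm, length_eq_zero_iff] at hlen
    exact hne hlen.symm
  have hy1 : y ≠ 1 := by
    rintro rfl
    rw [length_one, length_eq_zero_iff] at hlen
    exact hne hlen
  obtain ⟨p, hp⟩ := cs.exists_leftDescent_of_ne_one hx1
  obtain ⟨q, hq⟩ := cs.exists_leftDescent_of_ne_one hy1
  have hqx : ¬ cs.IsLeftDescent x q := fun hc => not_isLeftDescent_of_coat_eq h hne hc hq
  obtain ⟨α, hα, x', hxe, hx'⟩ := cs.exists_parabolic_factor {p, q} x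
  have hadd := fun {β : W} => length_mul_of_not_isLeftDescent (α := β) hx'
  have hP : cs.simple p ∈ cs.parabolic {p, q} := simple_mem_parabolic (by simp)
  have hQ : cs.simple q ∈ cs.parabolic {p, q} := simple_mem_parabolic (by simp)
  -- a coatom of `y` that does not have `q` as a left descent determines `y`
  have hlift : ∀ c ∈ cs.coat x, ¬ cs.IsLeftDescent c q → y = cs.simple q * c := by
    intro c hc hcq
    have hcy : cs.BruhatCovBy c y := by
      have : c ∈ cs.coat y := h ▸ hc
      exact this
    have h1 := hcy.le.simple_mul_le hq
    refine (h1.eq_of_length_le ?_).symm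
    rw [hcy.length_eq, cs.not_isLeftDescent_iff.1 hcq]
  have hbeta : ∃ β ∈ cs.parabolic {p, q}, y = β * x' := by
    have hpα : cs.IsLeftDescent α p := by
      have h1 := hadd hα
      have h2 := hadd (mul_mem hP hα)
      rw [mul_assoc] at h2
      rw [IsLeftDescent, hxe] at hp
      rw [IsLeftDescent]
      omega
    have hqα : ¬ cs.IsLeftDescent α q := by
      have h1 := hadd hα
      have h2 := hadd (mul_mem hQ hα)
      rw [mul_assoc] at h2
      rw [IsLeftDescent, hxe] at hqx
      rw [IsLeftDescent]
      omega
    have hα1 : α ≠ 1 := by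
      rintro rfl
      exact cs.not_isLeftDescent_one p hpα
    obtain ⟨r, hr⟩ := cs.exists_rightDescent_of_ne_one hα1
    have hR : cs.simple r ∈ cs.parabolic {p, q} := by
      have h1 := (mul_simple_covBy hr).le.mem_parabolic hα
      have h2 : (α * cs.simple r)⁻¹ * α = cs.simple r := by simp
      rw [← h2]
      exact mul_mem (inv_mem h1) hα
    have hαr := mul_mem hα hR
    -- Dropping the last letter `r` of `α` gives a coatom of `x` without left descent `q`, as `q` is
    -- not a descent of `α`. So `y` is `s_q` times this coatom and lies in the same coset as `x`.
    refine ⟨cs.simple q * (α * cs.simple r), mul_mem hQ hαr, ?_⟩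
    rw [mul_assoc]
    apply hlift
    · rw [hxe]
      refine bruhatCovBy_iff.2 ⟨?_, ?_⟩
      · have e : α * cs.simple r * x' = (α * cs.simple r * α⁻¹) * (α * x') := by group
        have ht : cs.IsReflection (α * cs.simple r * α⁻¹) := ⟨α, r, rfl⟩
        have e2 : α * x' = (α * cs.simple r * α⁻¹) * (α * cs.simple r * x') := by
          simp [mul_assoc]
        have h3 := bruhatLE_of_left_reflection (u := α * cs.simple r * x') ht
        rw [← e2, hadd hα, hadd hαr] at h3
        exact h3 (by rw [IsRightDescent] at hr; omega)
      · rw [hadd hα, hadd hαr, ← cs.isRightDescent_iff.1 hr]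
        omega
    · rw [IsLeftDescent, ← mul_assoc, hadd hαr, hadd (mul_mem hQ hαr)]
      have h1 := cs.isRightDescent_iff.1 hr
      have h2 := cs.not_isLeftDescent_iff.1 hqα
      have h3 := cs.length_mul_simple (cs.simple q * α) r
      rw [← mul_assoc]
      omega
  obtain ⟨β, hβ, hye⟩ := hbeta
  -- A right descent of `x'` would be a right descent of both `x` and `y`, impossible for distinct
  -- elements with equal coatoms.
  have hx'1 : x' = 1 := by
    by_contra hc
    obtain ⟨r, hr⟩ := cs.exists_rightDescent_of_ne_one hc
    have hdesc : ∀ γ ∈ cs.parabolic {p, q}, cs.IsRightDescent (γ * x') r := by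
      intro γ hγ
      rw [IsRightDescent, hadd hγ, mul_assoc]
      rw [IsRightDescent] at hr
      have := cs.length_mul_le γ (x' * cs.simple r)
      omega
    apply not_isRightDescent_of_coat_eq h hne (i := r)
    · rw [hxe]; exact hdesc α hα
    · rw [hye]; exact hdesc β hβ
  rw [hx'1, mul_one] at hxe hye
  exact ⟨p, q, hxe ▸ hα, hye ▸ hβ⟩

end CoxeterSystem

namespace CoxeterSystem

variable {B W : Type*} [Group W] {M : CoxeterMatrix B} {cs : CoxeterSystem M W}

/-! ### Dihedral subgroups -/

theorem length_wordProd_mod_two (cs : CoxeterSystem M W) (ω : List B) :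
    cs.length (cs.wordProd ω) % 2 = ω.length % 2 := by
  induction ω with
  | nil => simp
  | cons i ω ih =>
    rw [wordProd_cons, List.length_cons]
    rcases cs.length_simple_mul (cs.wordProd ω) i with h | h <;> omega

theorem not_isReduced_concat_concat (ω : List B) (i : B) :
    ¬ cs.IsReduced ((ω.concat i).concat i) := by
  intro h
  have h1 := cs.length_wordProd_le ω
  have h2 : cs.wordProd ((ω.concat i).concat i) = cs.wordProd ω := by
    rw [wordProd_concat, wordProd_concat, simple_mul_simple_cancel_right]
  rw [← h2, h.eq] at h1
  simp at h1

theorem eq_alternatingWord_of_isReduced {i j : B} {ω : List B} (hω : cs.IsReduced ω)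
    (h : ∀ k ∈ ω, k ∈ ({i, j} : Set B)) :
    ω = alternatingWord i j ω.length ∨ ω = alternatingWord j i ω.length := by
  induction ω using List.reverseRecOn with
  | nil => simp [alternatingWord]
  | append_singleton τ k ih =>
    have hk : k = i ∨ k = j := by simpa using h k (by simp)
    have ih' := ih hω.append_left (fun l hl => h l (by simp [hl]))
    have key : ∀ p q : B, τ = alternatingWord p q τ.length → k = p ∨ k = q →
        τ ++ [k] = alternatingWord p q (τ ++ [k]).length ∨
          τ ++ [k] = alternatingWord q p (τ ++ [k]).length := by
      intro p q hτ hk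
      have hl : (τ ++ [k]).length = τ.length + 1 := by simp
      rw [hl, alternatingWord_succ, alternatingWord_succ, ← hτ, List.concat_eq_append,
        List.concat_eq_append]
      rcases hk with rfl | rfl
      · right; rfl
      · rcases Nat.eq_zero_or_eq_succ_pred τ.length with h0 | h0
        · left
          have : τ = [] := List.length_eq_zero_iff.1 h0
          subst this
          rfl
        · exfalso
          rw [h0, alternatingWord_succ] at hτ
          rw [hτ] at hω
          rw [← List.concat_eq_append] at hω
          exact not_isReduced_concat_concat _ _ hω
    rcases ih' with h1 | h1
    · exact key i j h1 hk
    · exact (key j i h1 hk.symm).symm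

theorem dvd_of_alternatingWord_eq {i j : B} {k l : ℕ} (hlk : l ≤ k) (hp : k % 2 = l % 2)
    (h : cs.wordProd (alternatingWord i j k) = cs.wordProd (alternatingWord i j l)) :
    M i j ∣ (k - l) / 2 := by
  rw [prod_alternatingWord_eq_mul_pow, prod_alternatingWord_eq_mul_pow] at h
  have he : Even k ↔ Even l := by rw [Nat.even_iff, Nat.even_iff, hp]
  simp only [he, mul_right_inj] at h
  apply cs.dvd_of_simple_mul_simple_pow_eq_one
  have e : k / 2 = (k - l) / 2 + l / 2 := by omega
  rw [e, pow_add] at h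
  simpa using h

theorem dvd_of_alternatingWord_eq_swap {i j : B} {k l : ℕ} (hp : k % 2 = l % 2)
    (h : cs.wordProd (alternatingWord i j k) = cs.wordProd (alternatingWord j i l)) :
    M i j ∣ (k + l) / 2 := by
  rw [prod_alternatingWord_eq_mul_pow, prod_alternatingWord_eq_mul_pow] at h
  have hinv : cs.simple j * cs.simple i = (cs.simple i * cs.simple j)⁻¹ := by simp
  apply cs.dvd_of_simple_mul_simple_pow_eq_one
  rw [hinv, inv_pow] at h
  by_cases hk : Even k
  · have hl : Even l := by rw [Nat.even_iff] at hk ⊢; omega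
    rw [if_pos hk, if_pos hl, one_mul, one_mul] at h
    rw [Nat.even_iff] at hk hl
    have e : (k + l) / 2 = k / 2 + l / 2 := by omega
    rw [e, pow_add, h, inv_mul_cancel]
  · have hl : ¬ Even l := by rw [Nat.even_iff] at hk ⊢; omega
    rw [if_neg hk, if_neg hl] at h
    rw [Nat.even_iff] at hk hl
    have e : (k + l) / 2 = (1 + k / 2) + l / 2 := by omega
    have h' := congrArg (fun z => cs.simple i * z) h
    simp only [simple_mul_simple_cancel_left] at h'
    rw [e, pow_add, pow_add, pow_one, mul_assoc (cs.simple i), h', inv_mul_cancel]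

/-- A strictly shorter reduced subword with the same product is alternating with length of the same
parity. The resulting relation makes `M i j` divide a positive number smaller than itself. -/
theorem isReduced_alternatingWord {i j : B} {k : ℕ} (hk : k ≤ M i j) :
    cs.IsReduced (alternatingWord i j k) := by
  obtain ⟨ω, h1, h2, h3⟩ := cs.exists_isReduced_sublist (alternatingWord i j k)
  have hmem : ∀ l ∈ alternatingWord i j k, l ∈ ({i, j} : Set B) := by
    intro l hl
    obtain ⟨n, hn, rfl⟩ := List.mem_iff_getElem.1 hl
    rw [length_alternatingWord] at hn
    rw [getElem_alternatingWord i j k n hn]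
    split_ifs <;> simp
  have h4 := eq_alternatingWord_of_isReduced h2 (fun l hl => hmem l (h1.subset hl))
  have hle := h1.length_le
  have hpar := cs.length_wordProd_mod_two (alternatingWord i j k)
  rw [length_alternatingWord] at hle hpar
  rw [← h3, h2.eq] at hpar
  rw [IsReduced, ← h3, h2.eq, length_alternatingWord]
  by_contra hne
  rcases h4 with h4 | h4
  · rw [h4] at h3
    have := Nat.le_of_dvd (by omega) (dvd_of_alternatingWord_eq hle hpar.symm h3.symm)
    omega
  · rw [h4] at h3
    have := Nat.le_of_dvd (by omega) (dvd_of_alternatingWord_eq_swap hpar.symm h3.symm)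
    omega

theorem mem_of_mem_alternatingWord {i j l : B} {k : ℕ} (hl : l ∈ alternatingWord i j k) :
    l = i ∨ l = j := by
  obtain ⟨n, hn, rfl⟩ := List.mem_iff_getElem.1 hl
  rw [length_alternatingWord] at hn
  rw [getElem_alternatingWord i j k n hn]
  split_ifs <;> simp

theorem alternatingWord_mem_parabolic (cs : CoxeterSystem M W) (i j : B) (k : ℕ) :
    cs.wordProd (alternatingWord i j k) ∈ cs.parabolic {i, j} :=
  wordProd_mem_parabolic fun _ hl => by simpa using mem_of_mem_alternatingWord hl

/-- Alternating words that are shorter than the longest one are the only reduced words of their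
products. -/
theorem eq_alternatingWord_of_wordProd_eq {i j : B} {k : ℕ} (hk : k < M i j) {τ : List B}
    (hτ : cs.IsReduced τ) (h : cs.wordProd τ = cs.wordProd (alternatingWord i j k)) :
    τ = alternatingWord i j k := by
  have hred := isReduced_alternatingWord (cs := cs) (i := i) (j := j) hk.le
  have hl : τ.length = k := by rw [← hτ.eq, h, hred.eq, length_alternatingWord]
  have hmem : ∀ l ∈ τ, l ∈ ({i, j} : Set B) := fun l hl =>
    hτ.mem_of_mem_parabolic (h ▸ cs.alternatingWord_mem_parabolic i j k) hl
  rcases eq_alternatingWord_of_isReduced hτ hmem with h1 | h1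
  · rwa [hl] at h1
  · rw [hl] at h1
    rcases Nat.eq_zero_or_pos k with h0 | h0
    · subst h0; exact h1
    · exfalso
      rw [h1] at h
      have := Nat.le_of_dvd (by omega) (dvd_of_alternatingWord_eq_swap rfl h.symm)
      omega

theorem eq_wordProd_alternatingWord_of_mem {i j : B} (h0 : M i j ≠ 0) {x : W}
    (hx : x ∈ cs.parabolic {i, j}) : cs.length x ≤ M i j ∧
      (x = cs.wordProd (alternatingWord i j (cs.length x)) ∨
        x = cs.wordProd (alternatingWord j i (cs.length x))) := by
  obtain ⟨ω, h1, h2, rfl⟩ := exists_isReduced_of_mem_parabolic hx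
  have h3 := eq_alternatingWord_of_isReduced h2 h1
  rw [h2.eq]
  constructor
  · by_contra hc
    push Not at hc
    rcases h3 with h3 | h3
    · rw [h3] at h2
      exact cs.not_isReduced_alternatingWord i j h0 hc h2
    · rw [h3] at h2
      rw [M.symmetric i j] at hc h0
      exact cs.not_isReduced_alternatingWord j i h0 hc h2
  · exact h3.imp (congrArg _) (congrArg _)

theorem three_le_of_not_commute {i j : B} (h0 : M i j ≠ 0)
    (h : cs.simple i * cs.simple j ≠ cs.simple j * cs.simple i) : 3 ≤ M i j := by
  by_contra hc
  have hpow := cs.simple_mul_simple_pow i j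
  have h12 : M i j = 1 ∨ M i j = 2 := by omega
  rcases h12 with h1 | h1
  · rw [h1, pow_one] at hpow
    apply h
    have : cs.simple j * cs.simple i = (cs.simple i * cs.simple j)⁻¹ := by simp
    rw [this, hpow, inv_one]
  · rw [h1, pow_two] at hpow
    apply h
    have : cs.simple j * cs.simple i = (cs.simple i * cs.simple j)⁻¹ := by simp
    rw [this]
    exact eq_inv_of_mul_eq_one_left hpow

theorem alternatingWord_two (i j : B) : alternatingWord i j 2 = [i, j] := rfl

theorem isReduced_pair {i j : B} (hij : i ≠ j) : cs.IsReduced [i, j] := by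
  rw [isReduced_cons_iff]
  refine ⟨isReduced_singleton j, fun h => hij ?_⟩
  obtain ⟨ω, h1, h2⟩ := exists_isReduced_cons h
  rw [wordProd_singleton] at h2
  have := eq_singleton_of_wordProd_eq_simple h1 h2
  simp at this
  exact this.1

/-- As `i` and `j` do not commute, `[i, j]` is the only reduced word of its product, so the Bruhat
relation becomes a subword relation for every reduced word of the larger element. -/
theorem pair_sublist_of_bruhatLE {i j : B} (h0 : M i j ≠ 0)
    (h : cs.simple i * cs.simple j ≠ cs.simple j * cs.simple i) {ω : List B}
    (hω : cs.IsReduced ω) (hle : cs.BruhatLE (cs.simple i * cs.simple j) (cs.wordProd ω)) :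
    [i, j].Sublist ω := by
  obtain ⟨τ, h1, h2, h3⟩ := exists_sublist_of_bruhatLE hω hle
  have : τ = alternatingWord i j 2 := by
    apply eq_alternatingWord_of_wordProd_eq (three_le_of_not_commute h0 h) h2
    rw [h3, alternatingWord_two]
    simp [wordProd_cons]
  rw [this, alternatingWord_two] at h1
  exact h1

theorem isReduced_triple {v a u : B} (huv : u ≠ v) (hva : v ≠ a) (hau : a ≠ u) :
    cs.IsReduced [v, a, u] := by
  rw [isReduced_cons_iff]
  refine ⟨isReduced_pair hau, fun h => ?_⟩
  obtain ⟨ω, h1, h2⟩ := exists_isReduced_cons h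
  have h3 : cs.wordProd (v :: ω) ∈ cs.parabolic {a, u} := by
    rw [h2]
    exact wordProd_mem_parabolic (by simp)
  have h4 := h1.mem_of_mem_parabolic h3 (i := v) (by simp)
  simp at h4
  rcases h4 with h4 | h4
  · exact hva h4
  · exact huv h4.symm

theorem triple_sublist_of_bruhatLE {v a u : B} (huv : u ≠ v) (hva0 : M v a ≠ 0) (hau0 : M a u ≠ 0)
    (hva : cs.simple v * cs.simple a ≠ cs.simple a * cs.simple v)
    (hau : cs.simple a * cs.simple u ≠ cs.simple u * cs.simple a) {ω : List B}
    (hω : cs.IsReduced ω) (hle : cs.BruhatLE (cs.wordProd [v, a, u]) (cs.wordProd ω)) :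
    [v, a, u].Sublist ω := by
  have hva' : v ≠ a := by rintro rfl; exact hva rfl
  have hau' : a ≠ u := by rintro rfl; exact hau rfl
  have hred := isReduced_triple (cs := cs) huv hva' hau'
  obtain ⟨τ, h1, h2, h3⟩ := exists_sublist_of_bruhatLE hω hle
  have hl : τ.length = 3 := by rw [← h2.eq, h3, hred.eq]; rfl
  have s1 : [v, a].Sublist τ := by
    apply pair_sublist_of_bruhatLE hva0 hva h2
    have := bruhatLE_of_sublist (cs := cs) (τ := [v, a]) (ω := [v, a, u]) (by simp) hred
    rw [h3]
    simpa [wordProd_cons] using this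
  have s2 : [a, u].Sublist τ := by
    apply pair_sublist_of_bruhatLE hau0 hau h2
    have := bruhatLE_of_sublist (cs := cs) (τ := [a, u]) (ω := [v, a, u]) (by simp) hred
    rw [h3]
    simpa [wordProd_cons] using this
  obtain ⟨x, y, z, rfl⟩ := List.length_eq_three.1 hl
  have : [x, y, z] = [v, a, u] := by
    clear h1 h2 h3 hl hred hva hau hle
    grind
  rw [← this]
  exact h1

end CoxeterSystem

namespace CoxeterSystem

variable {B W : Type*} [Group W] {M : CoxeterMatrix B} {cs : CoxeterSystem M W}

/-! ### Partial matchings -/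

namespace IsPartialMatching

variable {Q : Set W} {φ : W → W}

theorem exists_of_covBy (hP : cs.IsPartialMatching Q φ) {x c : W} (hx : x ∈ Q)
    (hup : cs.BruhatCovBy x (φ x)) (hc : cs.BruhatCovBy c (φ x)) :
    c = x ∨ ∃ v, cs.BruhatCovBy v x ∧ cs.BruhatCovBy v (φ v) ∧ c = φ v := by
  have h : c ∈ cs.coat (φ x) := hc
  rw [hP.coat_eq x hx hup] at h
  exact h

theorem map_covBy (hP : cs.IsPartialMatching Q φ) {x v : W} (hx : x ∈ Q)
    (hup : cs.BruhatCovBy x (φ x)) (hv : cs.BruhatCovBy v x) (hv' : cs.BruhatCovBy v (φ v)) :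
    cs.BruhatCovBy (φ v) (φ x) := by
  have h : φ v ∈ cs.coat (φ x) := by
    rw [hP.coat_eq x hx hup]
    exact Or.inr ⟨v, hv, hv', rfl⟩
  exact h

/-- The lifting property for matchings. A coatom `c ≥ x` of `y` is either `φ v` with `v ⋖ φ y`
matched upwards, to which induction applies, or `φ y` itself. In the latter case pass to a coatom of
`φ y` above `x`: matched upwards it leads to another coatom of `y`; matched downwards, induction
applies to it. -/
theorem map_le_of_le (hP : cs.IsPartialMatching Q φ) {x y : W} (hy : y ∈ Q)
    (hdown : cs.BruhatCovBy (φ y) y) (hxy : cs.BruhatLE x y) : cs.BruhatLE (φ x) y := by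
  induction hn : cs.length y using Nat.strong_induction_on generalizing y with
  | _ n ih =>
    subst hn
    by_cases hne : x = y
    · rw [hne]; exact hdown.le
    obtain ⟨c, hxc, hcy⟩ := exists_le_covBy hxy hne
    have htQ := hP.mapsTo y hy
    have hty := hP.involutive y hy
    have htup : cs.BruhatCovBy (φ y) (φ (φ y)) := by rw [hty]; exact hdown
    have hcy' : cs.BruhatCovBy c (φ (φ y)) := by rw [hty]; exact hcy
    have hlt : ∀ {c}, cs.BruhatCovBy c y → cs.length c < cs.length y := fun h => by
      have := h.length_eq
      omega
    have upcase : ∀ v ∈ Q, cs.BruhatCovBy v (φ v) → cs.BruhatCovBy (φ v) y →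
        cs.BruhatLE x (φ v) → cs.BruhatLE (φ x) y := by
      intro v hvQ hv1 hv2 hxv
      refine (ih _ (hlt hv2) (hP.mapsTo v hvQ) ?_ hxv rfl).trans hv2.le
      rw [hP.involutive v hvQ]
      exact hv1
    rcases hP.exists_of_covBy htQ htup hcy' with rfl | ⟨v, hv1, hv2, rfl⟩
    · by_cases hxt : x = φ y
      · rw [hxt, hty]; exact BruhatLE.refl cs y
      obtain ⟨c', hxc', hc't⟩ := exists_le_covBy hxc hxt
      have hc'Q := hP.lower _ htQ _ hc't.le
      rcases hP.covBy c' hc'Q with h | h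
      · have h1 := hP.map_covBy htQ htup hc't h
        rw [hty] at h1
        exact upcase c' hc'Q h h1 (hxc'.trans h.le)
      · have := hc't.length_eq
        have := hdown.length_eq
        exact (ih _ (by omega) hc'Q h hxc' rfl).trans (hc't.le.trans hdown.le)
    · exact upcase v (hP.lower _ htQ _ hv1.le) hv2 hcy hxc

theorem map_le_map (hP : cs.IsPartialMatching Q φ) {x y : W} (hy : y ∈ Q)
    (hup : cs.BruhatCovBy y (φ y)) (hxy : cs.BruhatLE x y) : cs.BruhatLE (φ x) (φ y) := by
  refine hP.map_le_of_le (hP.mapsTo y hy) ?_ (hxy.trans hup.le)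
  rw [hP.involutive y hy]
  exact hup

theorem exists_map_one (hP : cs.IsPartialMatching Q φ) (h1 : (1 : W) ∈ Q) :
    ∃ a : B, φ 1 = cs.simple a := by
  rw [← length_eq_one_iff]
  rcases hP.covBy 1 h1 with h | h
  · rw [h.length_eq, length_one]
  · have := h.length_eq
    simp at this

theorem up_of_not_le (hP : cs.IsPartialMatching Q φ) {y : W} (hy : y ∈ Q)
    (h : ¬ cs.BruhatLE (φ 1) y) : cs.BruhatCovBy y (φ y) := by
  rcases hP.covBy y hy with h1 | h1
  · exact h1
  · exact absurd (hP.map_le_of_le hy h1 (cs.one_bruhatLE y)) h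

theorem map_one_le (hP : cs.IsPartialMatching Q φ) {y : W} (hy : y ∈ Q)
    (h : cs.BruhatCovBy y (φ y)) : cs.BruhatLE (φ 1) (φ y) :=
  hP.map_le_map hy h (cs.one_bruhatLE y)

/-- If `x ≠ 1` is matched upwards, each letter of `φ x` lies below some coatom of `φ x`. The coatoms
are `x` and elements `φ v` with `v` shorter, which lie in the parabolic subgroup by induction. -/
theorem map_mem_parabolic (hP : cs.IsPartialMatching Q φ) {J : Set B}
    (h1 : φ 1 ∈ cs.parabolic J) {x : W} (hx : x ∈ Q) (hxJ : x ∈ cs.parabolic J) :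
    φ x ∈ cs.parabolic J := by
  induction hn : cs.length x using Nat.strong_induction_on generalizing x with
  | _ n ih =>
    subst hn
    rcases hP.covBy x hx with hup | hdown
    · by_cases hx1 : x = 1
      · rw [hx1]; exact h1
      obtain ⟨ζ, hζ, hze⟩ := cs.exists_isReduced (φ x)
      rw [hze]
      apply wordProd_mem_parabolic
      intro i hi
      have hle := simple_bruhatLE_of_mem hζ hi
      rw [← hze] at hle
      have hne : cs.simple i ≠ φ x := by
        intro he
        have h2 := hup.length_eq
        rw [← he, length_simple] at h2
        exact hx1 (cs.length_eq_zero_iff.1 (by omega))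
      obtain ⟨c, h2, h3⟩ := exists_le_covBy hle hne
      rw [← simple_mem_parabolic_iff (cs := cs)]
      rcases hP.exists_of_covBy hx hup h3 with rfl | ⟨v, hv1, hv2, rfl⟩
      · exact h2.mem_parabolic hxJ
      · refine h2.mem_parabolic (ih _ ?_ (hP.lower x hx v hv1.le) (hv1.le.mem_parabolic hxJ) rfl)
        rw [hv1.length_eq]
        omega
    · exact hdown.le.mem_parabolic hxJ

theorem inv (hP : cs.IsPartialMatching Q φ) :
    cs.IsPartialMatching Q⁻¹ (fun x => (φ x⁻¹)⁻¹) where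
  lower q hq x hx := hP.lower _ hq _ hx.inv
  mapsTo u hu := by
    simpa using hP.mapsTo _ hu
  involutive u hu := by
    simp [hP.involutive _ hu]
  covBy u hu := by
    have := hP.covBy _ hu
    rwa [← bruhatCovBy_inv_iff, ← bruhatCovBy_inv_iff (y := u⁻¹), inv_inv] at this
  coat_eq u hu hup := by
    have hup' : cs.BruhatCovBy u⁻¹ (φ u⁻¹) := by
      rw [← bruhatCovBy_inv_iff, inv_inv]
      exact hup
    have h := hP.coat_eq _ hu hup'
    ext y
    have h1 : y ∈ cs.coat (φ u⁻¹)⁻¹ ↔ y⁻¹ ∈ cs.coat (φ u⁻¹) := by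
      change cs.BruhatCovBy _ _ ↔ cs.BruhatCovBy _ _
      rw [← bruhatCovBy_inv_iff, inv_inv]
    rw [h1, h]
    simp only [Set.mem_union, Set.mem_singleton_iff, Set.mem_ofPred_eq, inv_inj]
    refine or_congr Iff.rfl ⟨?_, ?_⟩
    · rintro ⟨v, h2, h3, h4⟩
      refine ⟨v⁻¹, ?_, ?_, ?_⟩
      · rwa [← bruhatCovBy_inv_iff, inv_inv]
      · rw [inv_inv]; exact bruhatCovBy_inv_iff.2 h3
      · rw [inv_inv, ← h4, inv_inv]
    · rintro ⟨v, h2, h3, h4⟩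
      refine ⟨v⁻¹, bruhatCovBy_inv_iff.2 h2, ?_, ?_⟩
      · rwa [← bruhatCovBy_inv_iff, inv_inv]
      · rw [h4, inv_inv]

/-- Combines the coatom recursions of `φ` and of left multiplication, for use both in extending
matchings and in proving regularity. A `v` matched upwards with descent `i` is excluded when `s_i φ
v` is longer than `φ v`: otherwise `φ (s_i v) = s_i φ v` would differ from `s_i v` in length by 3.
-/
theorem coat_simple_mul_map (hP : cs.IsPartialMatching Q φ) {x : W} {i : B} (hx : x ∈ Q)
    (hup : cs.BruhatCovBy x (φ x)) (hsz : ¬ cs.IsLeftDescent (φ x) i)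
    (hcomm : ∀ v, cs.BruhatCovBy v x → cs.simple i * v ∈ Q →
      φ (cs.simple i * v) = cs.simple i * φ v) {y : W} :
    cs.BruhatCovBy y (cs.simple i * φ x) ↔ y = cs.simple i * x ∧ ¬ cs.IsLeftDescent x i ∨
      y = φ x ∨ ∃ v, cs.BruhatCovBy v x ∧ ¬ cs.IsLeftDescent v i ∧
        cs.BruhatCovBy (cs.simple i * v) (cs.simple i * φ v) ∧ y = cs.simple i * φ v := by
  rw [covBy_simple_mul_iff hsz]
  constructor
  · rintro (rfl | ⟨w, h1, h2, rfl⟩)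
    · exact Or.inr (Or.inl rfl)
    · rcases hP.exists_of_covBy hx hup h1 with rfl | ⟨v, hv1, hv2, rfl⟩
      · exact Or.inl ⟨rfl, h2⟩
      · refine Or.inr (Or.inr ⟨v, hv1, ?_, ?_, rfl⟩)
        · intro hd
          have hsv : cs.simple i * v ∈ Q :=
            hP.lower x hx _ ((simple_mul_bruhatLE_self hd).trans hv1.le)
          have h3 := hcomm v hv1 hsv
          have h4 := hv2.length_eq
          have h5 := cs.not_isLeftDescent_iff.1 h2
          have h6 := cs.isLeftDescent_iff.1 hd
          rcases hP.covBy _ hsv with h | h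
          · have := h.length_eq
            rw [h3] at this
            omega
          · have := h.length_eq
            rw [h3] at this
            omega
        · by_cases hd : cs.IsLeftDescent v i
          · exfalso
            have hsv : cs.simple i * v ∈ Q :=
              hP.lower x hx _ ((simple_mul_bruhatLE_self hd).trans hv1.le)
            have h3 := hcomm v hv1 hsv
            have h4 := hv2.length_eq
            have h5 := cs.not_isLeftDescent_iff.1 h2
            have h6 := cs.isLeftDescent_iff.1 hd
            rcases hP.covBy _ hsv with h | h
            · have := h.length_eq
              rw [h3] at this
              omega
            · have := h.length_eq
              rw [h3] at this
              omega
          · exact (covBy_simple_mul_iff h2).2 (Or.inr ⟨v, hv2, hd, rfl⟩)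
  · rintro (⟨rfl, h⟩ | rfl | ⟨v, hv1, hv2, hv3, rfl⟩)
    · exact Or.inr ⟨x, hup, h, rfl⟩
    · exact Or.inl rfl
    · right
      have h1 := hv3.length_eq
      have h2 := cs.not_isLeftDescent_iff.1 hv2
      have h3 := cs.length_simple_mul (φ v) i
      rcases hP.covBy v (hP.lower x hx v hv1.le) with h | h
      · refine ⟨φ v, hP.map_covBy hx hup hv1 h, ?_, rfl⟩
        rw [not_isLeftDescent_iff]
        have := h.length_eq
        omega
      · exfalso
        have := h.length_eq
        omega

end IsPartialMatching

/-! ### Maximality and the extension of a matching to translates -/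

namespace IsMaximalMatching

variable {Q : Set W} {φ : W → W}

theorem inv (hM : cs.IsMaximalMatching Q φ) :
    cs.IsMaximalMatching Q⁻¹ (fun x => (φ x⁻¹)⁻¹) where
  isPartialMatching := hM.isPartialMatching.inv
  maximal Q' φ' hP hQ h := by
    have := hM.maximal Q'⁻¹ _ hP.inv (fun x hx => hQ (Set.inv_mem_inv.2 hx)) (fun x hx => by
      rw [h _ (Set.inv_mem_inv.2 hx)]
      simp)
    rw [← this, inv_inv]

/-- If a maximal matching commutes with left multiplication by a generator wherever both sides are
defined, then the generator is left regular. -/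
theorem isLeftRegular (hM : cs.IsMaximalMatching Q φ) {i : B}
    (hcomm : ∀ x ∈ Q, cs.simple i * x ∈ Q → φ (cs.simple i * x) = cs.simple i * φ x) :
    cs.IsLeftRegular Q φ i := by
  classical
  have hP := hM.isPartialMatching
  -- Extend the matching equivariantly to `Q ∪ s_i Q`; maximality then gives `s_i Q ⊆ Q`.
  set Q' : Set W := {y | y ∈ Q ∨ cs.simple i * y ∈ Q} with hQ'
  set φ' : W → W := fun y => if y ∈ Q then φ y else cs.simple i * φ (cs.simple i * y) with hφ'
  have φ'_mem : ∀ y ∈ Q, φ' y = φ y := fun y hy => if_pos hy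
  have φ'_mul : ∀ x ∈ Q, φ' (cs.simple i * x) = cs.simple i * φ x := by
    intro x hx
    by_cases h : cs.simple i * x ∈ Q
    · rw [φ'_mem _ h, hcomm x hx h]
    · simp only [hφ', if_neg h, simple_mul_simple_cancel_left]
  have desc1 : ∀ x ∈ Q, cs.simple i * x ∉ Q → ¬ cs.IsLeftDescent x i := fun x hx h hd =>
    h (hP.lower x hx _ (simple_mul_bruhatLE_self hd))
  have notin : ∀ x ∈ Q, cs.simple i * x ∉ Q → cs.simple i * φ x ∉ Q := by
    intro x hx h hc
    apply h
    have h1 := hcomm _ (hP.mapsTo x hx) hc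
    rw [hP.involutive x hx] at h1
    rw [← h1]
    exact hP.mapsTo _ hc
  have desc2 : ∀ x ∈ Q, cs.simple i * x ∉ Q → ¬ cs.IsLeftDescent (φ x) i := fun x hx h =>
    desc1 _ (hP.mapsTo x hx) (notin x hx h)
  have hcov : ∀ {u v : W}, cs.BruhatCovBy u v → ¬ cs.IsLeftDescent u i →
      ¬ cs.IsLeftDescent v i → cs.BruhatCovBy (cs.simple i * u) (cs.simple i * v) :=
    fun h hu hv => (covBy_simple_mul_iff hv).2 (Or.inr ⟨_, h, hu, rfl⟩)
  have hP' : cs.IsPartialMatching Q' φ' := by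
    have ind : ∀ (p : W → Prop), (∀ x ∈ Q, p x) →
        (∀ x ∈ Q, cs.simple i * x ∉ Q → p (cs.simple i * x)) → ∀ y ∈ Q', p y := by
      intro p h1 h2 y hy
      by_cases hyQ : y ∈ Q
      · exact h1 y hyQ
      · have h3 := h2 _ (hy.resolve_left hyQ) (by rwa [simple_mul_simple_cancel_left])
        rwa [simple_mul_simple_cancel_left] at h3
    refine ⟨?_, ?_, ?_, ?_, ?_⟩
    · refine ind _ (fun q hq x hx => Or.inl (hP.lower q hq x hx)) (fun q hq hsq x hx => ?_)
      have hd : cs.IsLeftDescent (cs.simple i * q) i := by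
        rw [isLeftDescent_iff_not_isLeftDescent_mul, simple_mul_simple_cancel_left]
        exact desc1 q hq hsq
      by_cases hdx : cs.IsLeftDescent x i
      · have h1 := ((simple_mul_bruhatLE_self hdx).trans hx).le_simple_mul hd
          (cs.isLeftDescent_iff_not_isLeftDescent_mul.1 hdx)
        rw [simple_mul_simple_cancel_left] at h1
        exact Or.inr (hP.lower q hq _ h1)
      · have h1 := hx.le_simple_mul hd hdx
        rw [simple_mul_simple_cancel_left] at h1
        exact Or.inl (hP.lower q hq _ h1)
    · refine ind _ (fun x hx => ?_) (fun x hx _ => ?_)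
      · rw [φ'_mem x hx]; exact Or.inl (hP.mapsTo x hx)
      · rw [φ'_mul x hx]
        right
        rw [simple_mul_simple_cancel_left]
        exact hP.mapsTo x hx
    · refine ind _ (fun x hx => ?_) (fun x hx _ => ?_)
      · rw [φ'_mem x hx, φ'_mem _ (hP.mapsTo x hx), hP.involutive x hx]
      · rw [φ'_mul x hx, φ'_mul _ (hP.mapsTo x hx), hP.involutive x hx]
    · refine ind _ (fun x hx => ?_) (fun x hx h => ?_)
      · rw [φ'_mem x hx]; exact hP.covBy x hx
      · rw [φ'_mul x hx]
        exact (hP.covBy x hx).imp (fun hc => hcov hc (desc1 x hx h) (desc2 x hx h))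
          (fun hc => hcov hc (desc2 x hx h) (desc1 x hx h))
    · refine ind _ (fun u hu hup => ?_) (fun x hx h hup => ?_)
      · rw [φ'_mem u hu] at hup ⊢
        rw [hP.coat_eq u hu hup]
        ext y
        simp only [Set.mem_union, Set.mem_ofPred_eq]
        refine or_congr Iff.rfl (exists_congr fun v => and_congr_right fun hv => ?_)
        rw [φ'_mem v (hP.lower u hu v hv.le)]
      · rw [φ'_mul x hx] at hup ⊢
        have d1 := desc1 x hx h
        have d2 := desc2 x hx h
        have hup' : cs.BruhatCovBy x (φ x) := by
          rcases hP.covBy x hx with hc | hc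
          · exact hc
          · exfalso
            have h1 := hc.length_eq
            have h2 := hup.length_eq
            rw [not_isLeftDescent_iff] at d1 d2
            omega
        ext y
        have hK := hP.coat_simple_mul_map hx hup' d2
          (fun v hv hsv => hcomm v (hP.lower x hx v hv.le) hsv) (y := y)
        change cs.BruhatCovBy _ _ ↔ _
        rw [hK]
        simp only [d1, not_false_iff, and_true, Set.mem_union, Set.mem_singleton_iff,
          Set.mem_ofPred_eq]
        refine or_congr Iff.rfl ⟨?_, ?_⟩
        · rintro (rfl | ⟨v, h1, h2, h3, rfl⟩)
          · refine ⟨x, covBy_simple_mul d1, ?_, ?_⟩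
            · rwa [φ'_mem x hx]
            · rw [φ'_mem x hx]
          · have hvQ := hP.lower x hx v h1.le
            refine ⟨cs.simple i * v, hcov h1 h2 d1, ?_, ?_⟩
            · rwa [φ'_mul v hvQ]
            · rw [φ'_mul v hvQ]
        · rintro ⟨v', h1, h2, rfl⟩
          rcases (covBy_simple_mul_iff d1).1 h1 with rfl | ⟨v, h3, h4, rfl⟩
          · left; rw [φ'_mem _ hx]
          · have hvQ := hP.lower x hx v h3.le
            rw [φ'_mul v hvQ] at h2 ⊢
            exact Or.inr ⟨v, h3, h4, h2, rfl⟩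
  have hQQ := hM.maximal Q' φ' hP' (fun x hx => Or.inl hx) φ'_mem
  intro x hx
  have hsx : cs.simple i * x ∈ Q := by
    rw [← hQQ]
    right
    rwa [simple_mul_simple_cancel_left]
  exact ⟨hsx, hcomm x hx hsx⟩

end IsMaximalMatching

end CoxeterSystem

namespace CoxeterSystem

variable {B W : Type*} [Group W] {M : CoxeterMatrix B} {cs : CoxeterSystem M W}

/-! ### Sublists -/

section Lists

variable {a u v : B}

theorem mem_left_of_pair_sublist {l₁ l₂ : List B} (hua : u ≠ a)
    (h2 : a ∉ l₂) (h : [u, a].Sublist (l₁ ++ a :: l₂)) : u ∈ l₁ := by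
  obtain ⟨s, t, he, hs, ht⟩ := List.sublist_append_iff.1 h
  cases s with
  | nil =>
    rw [List.nil_append] at he
    subst he
    exfalso
    cases ht with
    | cons _ ht => exact h2 (ht.subset (by simp))
    | cons_cons _ ht => exact hua rfl
  | cons x s =>
    simp only [List.cons_append, List.cons.injEq] at he
    rw [he.1]
    exact hs.subset (by simp)

theorem mem_right_of_pair_sublist {l₁ l₂ : List B} (h1 : a ∉ l₁)
    (h : [a, v].Sublist (l₁ ++ a :: l₂)) : v ∈ l₂ := by
  obtain ⟨s, t, he, hs, ht⟩ := List.sublist_append_iff.1 h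
  cases s with
  | nil =>
    rw [List.nil_append] at he
    subst he
    cases ht with
    | cons _ ht => exact ht.subset (by simp)
    | cons_cons _ ht => exact ht.subset (by simp)
  | cons x s =>
    simp only [List.cons_append, List.cons.injEq] at he
    exfalso
    apply h1
    rw [he.1]
    exact hs.subset (by simp)

theorem sublist_right_of_cons_sublist {l₁ l₂ l : List B} (h1 : a ∉ l₁)
    (h : (a :: l).Sublist (l₁ ++ l₂)) : (a :: l).Sublist l₂ := by
  obtain ⟨s, t, he, hs, ht⟩ := List.sublist_append_iff.1 h
  cases s with
  | nil =>
    rw [List.nil_append] at he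
    rwa [he]
  | cons x s =>
    simp only [List.cons_append, List.cons.injEq] at he
    exact absurd (he.1 ▸ hs.subset (by simp)) h1

theorem five_le_length_of_sublist {l : List B} (hua : u ≠ a) (hva : v ≠ a) (huv : u ≠ v)
    (h1 : [u, a, v].Sublist l) (h2 : [v, a, u].Sublist l) : 5 ≤ l.length := by
  by_contra hc
  rcases l with _ | ⟨x, _ | ⟨y, _ | ⟨z, _ | ⟨w, _ | ⟨t, l⟩⟩⟩⟩⟩
  · simp at h1
  · simp at h1
  · have := h1.length_le; simp at this
  · grind
  · grind
  · simp only [List.length_cons] at hc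
    omega

/-- Write `l = α v γ a δ` with the first `v` and the first `a` after it. No `u` occurs in `δ`, so
the word `X a u` ends before that `a`; since `γ` contains no `a`, at most its final `u` comes after
the `v`. -/
theorem sublist_interleave (hau : a ≠ u) {X Y l : List B} (hvX : v ∉ X) (hav : a ≠ v)
    (huv : u ≠ v) (h1 : (X ++ [a, u]).Sublist l) (h2 : (v :: a :: Y).Sublist l)
    (h3 : ¬ [v, a, u].Sublist l) :
    (X ++ [a, u] ++ v :: a :: Y).Sublist l ∨ (X ++ [a, v, u] ++ a :: Y).Sublist l := by
  have hv : v ∈ l := h2.subset (by simp)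
  obtain ⟨α, β, rfl, hα⟩ := List.eq_append_cons_of_mem hv
  have h2' := sublist_right_of_cons_sublist hα h2
  rw [List.cons_sublist_cons] at h2'
  have ha : a ∈ β := h2'.subset (by simp)
  obtain ⟨γ, δ, rfl, hγ⟩ := List.eq_append_cons_of_mem ha
  have h2'' := sublist_right_of_cons_sublist hγ h2'
  rw [List.cons_sublist_cons] at h2''
  have huδ : u ∉ δ := by
    intro hc
    apply h3
    refine List.Sublist.trans ?_ (List.sublist_append_right _ _)
    refine List.Sublist.cons_cons _ (List.Sublist.trans ?_ (List.sublist_append_right _ _))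
    exact List.Sublist.cons_cons _ (List.singleton_sublist.2 hc)
  obtain ⟨P, R, he, hP, hR⟩ := List.sublist_append_iff.1 h1
  have hvXau : v ∉ X ++ [a, u] := by
    simp [hvX, hav.symm, huv.symm]
  have hvR : v ∉ R := fun h => hvXau (he ▸ List.mem_append_right _ h)
  have hR' : R.Sublist (γ ++ a :: δ) := by
    cases hR with
    | cons _ h => exact h
    | cons_cons _ h => simp at hvR
  have hRγ : R.Sublist γ := by
    obtain ⟨R₁, R₂, rfl, hR₁, hR₂⟩ := List.sublist_append_iff.1 hR'
    rcases List.eq_nil_or_concat R₂ with rfl | ⟨R₂, x, rfl⟩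
    · simpa using hR₁
    · exfalso
      have hx : x = u := by
        have := congrArg List.getLast? he
        simpa [List.getLast?_append] using this.symm
      subst hx
      have := hR₂.subset (a := x) (by simp)
      simp [huδ, hau.symm] at this
  have haR : a ∉ R := fun h => hγ (hRγ.subset h)
  rcases List.eq_nil_or_concat R with rfl | ⟨R, x, rfl⟩
  · left
    rw [List.append_nil] at he
    rw [he]
    refine hP.append (List.Sublist.cons_cons _ ?_)
    exact (List.Sublist.cons_cons _ h2'').trans (List.sublist_append_right _ _)
  · right
    rw [show X ++ [a, u] = (X ++ [a]) ++ [u] by simp, List.concat_eq_append, ← List.append_assoc]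
      at he
    obtain ⟨he1, he2⟩ := List.append_inj' he rfl
    simp only [List.cons.injEq, and_true] at he2
    subst he2
    rcases List.eq_nil_or_concat R with rfl | ⟨R, y, rfl⟩
    · rw [List.append_nil] at he1
      rw [show X ++ [a, v, u] ++ a :: Y = (X ++ [a]) ++ v :: ([u] ++ a :: Y) by simp, he1]
      refine hP.append (List.Sublist.cons_cons _ ?_)
      exact List.Sublist.append (by simpa using hRγ) (List.Sublist.cons_cons _ h2'')
    · exfalso
      rw [List.concat_eq_append, ← List.append_assoc] at he1
      obtain ⟨_, he3⟩ := List.append_inj' he1 rfl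
      simp only [List.cons.injEq, and_true] at he3
      apply haR
      rw [he3]
      simp

theorem alternatingWord_succ_eq (i j : B) (k : ℕ) :
    alternatingWord i j (k + 1) = j :: alternatingWord i j k ∨
      ∃ n, k = n + 1 ∧ alternatingWord i j (k + 1) = i :: j :: alternatingWord i j n := by
  rw [alternatingWord_succ']
  by_cases h : Even k
  · left; rw [if_pos h]
  · right
    rw [if_neg h]
    obtain ⟨n, hn⟩ := Nat.not_even_iff_odd.1 h
    refine ⟨2 * n, by omega, ?_⟩
    rw [hn, alternatingWord_succ', if_pos (by simp)]

theorem not_alternatingWord_succ_sublist (hau : a ≠ u) {A : List B} (hA : u ∉ A) (k : ℕ) :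
    ¬ (alternatingWord a u (k + 1)).Sublist (alternatingWord a u k ++ A) := by
  classical
  intro h
  have hcA : A.count u = 0 := List.count_eq_zero_of_not_mem hA
  rcases alternatingWord_succ_eq a u k with h1 | ⟨n, rfl, h1⟩
  · rw [h1] at h
    have := h.count_le u
    simp [hcA] at this
  · rcases alternatingWord_succ_eq a u n with h2 | ⟨n', rfl, h2⟩
    · rw [h1, h2, List.cons_append] at h
      cases h with
      | cons _ h =>
        have := h.count_le u
        rw [List.count_cons_of_ne hau, List.count_cons_self] at this
        simp [hcA] at this
      | cons_cons _ h => exact hau rfl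
    · rw [alternatingWord_succ', h2] at h1
      simp only [List.cons.injEq] at h1
      exact hau h1.2.1

/-- There are too few letters `u` if the longer word starts with `u`. If it starts with `a`, the
shorter one starts with `u`, and no letter `u` can be skipped; hence the additional `a` must precede
everything. -/
theorem eq_nil_of_alternatingWord_succ_sublist (hau : a ≠ u) {A f₁ f₂ : List B} (hA : u ∉ A)
    {k : ℕ} (he : f₁ ++ f₂ = alternatingWord a u k ++ A)
    (h : (alternatingWord a u (k + 1)).Sublist (f₁ ++ a :: f₂)) : f₁ = [] := by
  classical
  have hcA : A.count u = 0 := List.count_eq_zero_of_not_mem hA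
  have hc := congrArg (List.count u) he
  simp only [List.count_append, hcA] at hc
  rcases alternatingWord_succ_eq a u k with h1 | ⟨n, rfl, h1⟩
  · exfalso
    rw [h1] at h
    have := h.count_le u
    rw [List.count_cons_self, List.count_append, List.count_cons_of_ne hau] at this
    omega
  · have h2 : alternatingWord a u (n + 1) = u :: alternatingWord a u n := by
      rw [alternatingWord_succ', List.cons.injEq] at h1
      exact h1.2
    rw [← h2] at h1
    cases f₁ with
    | nil => rfl
    | cons x f =>
      exfalso
      have hx : x = u := by
        rw [h2] at he
        simp only [List.cons_append, List.cons.injEq] at he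
        exact he.1
      subst hx
      rw [h1, List.cons_append] at h
      cases h with
      | cons _ h =>
        have := h.count_le x
        rw [List.count_cons_of_ne hau, List.count_append, List.count_cons_of_ne hau] at this
        rw [List.count_cons_self] at hc
        omega
      | cons_cons _ h => exact hau rfl

end Lists

end CoxeterSystem

namespace CoxeterSystem

variable {B W : Type*} [Group W] {M : CoxeterMatrix B} {cs : CoxeterSystem M W}

/-! ### Full matchings -/

theorem alternatingWord_sublist (i j : B) {n m : ℕ} (h : n ≤ m) :
    (alternatingWord i j n).Sublist (alternatingWord i j m) := by
  induction m, h using Nat.le_induction with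
  | base => exact List.Sublist.refl _
  | succ m _ ih =>
    rw [alternatingWord_succ' i j m]
    exact ih.cons _

theorem IsFull.le_of_mem_parabolic {w : W} (hw : cs.IsFull w) {i j : B} {x : W}
    (hx : x ∈ cs.parabolic {i, j}) : cs.BruhatLE x w := by
  have key : ∀ i j : B, ∀ n ≤ M i j, cs.BruhatLE (cs.wordProd (alternatingWord i j n)) w := by
    intro i j n hn
    refine BruhatLE.trans ?_ (hw i j).2
    have hred := isReduced_alternatingWord (cs := cs) (i := i) (j := j) le_rfl
    exact bruhatLE_of_sublist (alternatingWord_sublist i j hn) hred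
  obtain ⟨h1, h2 | h2⟩ := eq_wordProd_alternatingWord_of_mem (hw i j).1 hx
  · rw [h2]; exact key i j _ h1
  · rw [h2]; exact key j i _ (M.symmetric i j ▸ h1)

theorem IsFull.inv {w : W} (hw : cs.IsFull w) : cs.IsFull w⁻¹ := by
  intro i j
  refine ⟨(hw i j).1, ?_⟩
  rw [← bruhatLE_inv_iff, inv_inv]
  exact hw.le_of_mem_parabolic (inv_mem (cs.alternatingWord_mem_parabolic i j _))

/-- A full partial matching together with the generator `a = φ e`. -/
structure IsFullPartialMatching (cs : CoxeterSystem M W) (Q : Set W) (φ : W → W) (a : B) :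
    Prop where
  isPartialMatching : cs.IsPartialMatching Q φ
  map_one : φ 1 = cs.simple a
  isFullMatching : cs.IsFullMatching Q

/-- The transported matching on the set of inverses. -/
def invMap (φ : W → W) (x : W) : W := (φ x⁻¹)⁻¹

namespace IsFullPartialMatching

variable {Q : Set W} {φ : W → W} {a u v : B}

theorem inv (hF : cs.IsFullPartialMatching Q φ a) :
    cs.IsFullPartialMatching Q⁻¹ (invMap φ) a where
  isPartialMatching := hF.isPartialMatching.inv
  map_one := by rw [invMap, inv_one, hF.map_one, inv_simple]
  isFullMatching := by
    obtain ⟨w, h1, h2⟩ := hF.isFullMatching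
    exact ⟨w⁻¹, Set.inv_mem_inv.2 h1, h2.inv⟩

theorem M_ne_zero (hF : cs.IsFullPartialMatching Q φ a) (i j : B) : M i j ≠ 0 := by
  obtain ⟨w, _, h⟩ := hF.isFullMatching
  exact (h i j).1

theorem mem_of_mem_parabolic (hF : cs.IsFullPartialMatching Q φ a) {i j : B} {x : W}
    (hx : x ∈ cs.parabolic {i, j}) : x ∈ Q := by
  obtain ⟨w, h1, h2⟩ := hF.isFullMatching
  exact hF.isPartialMatching.lower w h1 x (h2.le_of_mem_parabolic hx)

theorem one_mem (hF : cs.IsFullPartialMatching Q φ a) : (1 : W) ∈ Q :=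
  hF.mem_of_mem_parabolic (i := a) (j := a) (Subgroup.one_mem _)

theorem simple_mem (hF : cs.IsFullPartialMatching Q φ a) (i : B) : cs.simple i ∈ Q :=
  hF.mem_of_mem_parabolic (i := i) (j := i) (simple_mem_parabolic (by simp))

theorem map_simple_self (hF : cs.IsFullPartialMatching Q φ a) : φ (cs.simple a) = 1 := by
  rw [← hF.map_one]
  exact hF.isPartialMatching.involutive 1 hF.one_mem

theorem not_commute_of_mem_setU (hF : cs.IsFullPartialMatching Q φ a) (hu : u ∈ cs.setU Q φ) :
    cs.simple u * cs.simple a ≠ cs.simple a * cs.simple u := by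
  rw [← hF.map_one]
  exact hu.1

theorem not_commute_of_mem_setV (hF : cs.IsFullPartialMatching Q φ a) (hv : v ∈ cs.setV Q φ) :
    cs.simple v * cs.simple a ≠ cs.simple a * cs.simple v := by
  rw [← hF.map_one]
  exact hv.1

theorem map_of_mem_setU (hF : cs.IsFullPartialMatching Q φ a) (hu : u ∈ cs.setU Q φ) :
    φ (cs.simple u) = cs.simple u * cs.simple a := by
  rw [hu.2.2, hF.map_one]

theorem map_of_mem_setV (hF : cs.IsFullPartialMatching Q φ a) (hv : v ∈ cs.setV Q φ) :
    φ (cs.simple v) = cs.simple a * cs.simple v := by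
  rw [hv.2.2, hF.map_one]

theorem mem_setC_iff (hF : cs.IsFullPartialMatching Q φ a) {c : B} :
    c ∈ cs.setC φ ↔ cs.simple c * cs.simple a = cs.simple a * cs.simple c := by
  rw [← hF.map_one]
  rfl

theorem self_mem_setC (hF : cs.IsFullPartialMatching Q φ a) : a ∈ cs.setC φ :=
  hF.mem_setC_iff.2 rfl

theorem ne_of_mem_setU (hF : cs.IsFullPartialMatching Q φ a) (hu : u ∈ cs.setU Q φ) : u ≠ a := by
  rintro rfl
  exact hu.1 hF.self_mem_setC

theorem ne_of_mem_setV (hF : cs.IsFullPartialMatching Q φ a) (hv : v ∈ cs.setV Q φ) : v ≠ a := by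
  rintro rfl
  exact hv.1 hF.self_mem_setC

theorem notMem_setU_of_mem_setV (hF : cs.IsFullPartialMatching Q φ a) (hv : v ∈ cs.setV Q φ) :
    v ∉ cs.setU Q φ := fun hu =>
  hF.not_commute_of_mem_setV hv (by rw [← hF.map_of_mem_setU hu, hF.map_of_mem_setV hv])

theorem ne_of_mem (hF : cs.IsFullPartialMatching Q φ a) (hu : u ∈ cs.setU Q φ)
    (hv : v ∈ cs.setV Q φ) : u ≠ v := by
  rintro rfl
  exact hF.notMem_setU_of_mem_setV hv hu

theorem _root_.CoxeterSystem.invMap_simple (cs : CoxeterSystem M W) (φ : W → W) (i : B) :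
    invMap φ (cs.simple i) = (φ (cs.simple i))⁻¹ := by rw [invMap, inv_simple]

theorem setC_inv (hF : cs.IsFullPartialMatching Q φ a) :
    cs.setC (invMap φ) = cs.setC φ := by
  ext c
  rw [hF.inv.mem_setC_iff, hF.mem_setC_iff]

theorem setU_inv (hF : cs.IsFullPartialMatching Q φ a) :
    cs.setU Q⁻¹ (invMap φ) = cs.setV Q φ := by
  ext s
  simp only [setU, setV, hF.setC_inv, Set.mem_ofPred_eq, Set.mem_inv, inv_simple,
    cs.invMap_simple, hF.inv.map_one, hF.map_one]
  rw [inv_eq_iff_eq_inv, mul_inv_rev, inv_simple, inv_simple]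

theorem setV_inv (hF : cs.IsFullPartialMatching Q φ a) :
    cs.setV Q⁻¹ (invMap φ) = cs.setU Q φ := by
  ext s
  simp only [setU, setV, hF.setC_inv, Set.mem_ofPred_eq, Set.mem_inv, inv_simple,
    cs.invMap_simple, hF.inv.map_one, hF.map_one]
  rw [inv_eq_iff_eq_inv, mul_inv_rev, inv_simple, inv_simple]

/-! ### Inserting `a`: commutation of `U` with `V`, and the forbidden word `v a u` -/

/-- The image of an element which is not above `a` arises by inserting `a` into a reduced word. -/
theorem exists_insert (hF : cs.IsFullPartialMatching Q φ a) {y : W} (hy : y ∈ Q)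
    (hay : ¬ cs.BruhatLE (cs.simple a) y) :
    ∃ ζ₁ ζ₂ : List B, cs.IsReduced (ζ₁ ++ ζ₂) ∧ cs.wordProd (ζ₁ ++ ζ₂) = y ∧
      cs.IsReduced (ζ₁ ++ a :: ζ₂) ∧ cs.wordProd (ζ₁ ++ a :: ζ₂) = φ y ∧ a ∉ ζ₁ ∧ a ∉ ζ₂ ∧
      cs.BruhatCovBy y (φ y) := by
  have hP := hF.isPartialMatching
  have hup := hP.up_of_not_le hy (by rwa [hF.map_one])
  have ha := hP.map_one_le hy hup
  rw [hF.map_one] at ha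
  obtain ⟨ζ, hζ, he⟩ := cs.exists_isReduced (φ y)
  have hup' := hup
  rw [he] at hup' ha
  obtain ⟨ζ₁, r, ζ₂, rfl, h1, rfl⟩ := exists_erase_of_covBy hζ hup'
  rw [simple_bruhatLE_iff_mem hζ] at ha
  rw [simple_bruhatLE_iff_mem h1, List.mem_append, not_or] at hay
  have har : a = r := by
    rw [List.mem_append, List.mem_cons] at ha
    rcases ha with h | h | h
    · exact absurd h hay.1
    · exact h
    · exact absurd h hay.2
  subst har
  exact ⟨ζ₁, ζ₂, h1, rfl, hζ, he.symm, hay.1, hay.2, hup⟩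

theorem exists_insert_of_le (hF : cs.IsFullPartialMatching Q φ a) (hu : u ∈ cs.setU Q φ)
    (hv : v ∈ cs.setV Q φ) {y : W} (hy : y ∈ Q) (hay : ¬ cs.BruhatLE (cs.simple a) y)
    (huy : cs.BruhatLE (cs.simple u) y) (hvy : cs.BruhatLE (cs.simple v) y) :
    ∃ ζ₁ ζ₂ : List B, cs.IsReduced (ζ₁ ++ ζ₂) ∧ cs.wordProd (ζ₁ ++ ζ₂) = y ∧
      cs.wordProd (ζ₁ ++ a :: ζ₂) = φ y ∧ u ∈ ζ₁ ∧ v ∈ ζ₂ := by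
  have hP := hF.isPartialMatching
  obtain ⟨ζ₁, ζ₂, h1, h2, h3, h4, h5, h6, h7⟩ := hF.exists_insert hy hay
  refine ⟨ζ₁, ζ₂, h1, h2, h4, ?_, ?_⟩
  · have h8 := hP.map_le_map hy h7 huy
    rw [hF.map_of_mem_setU hu, ← h4] at h8
    exact mem_left_of_pair_sublist (hF.ne_of_mem_setU hu) h6
      (pair_sublist_of_bruhatLE (hF.M_ne_zero _ _) (hF.not_commute_of_mem_setU hu) h3 h8)
  · have h8 := hP.map_le_map hy h7 hvy
    rw [hF.map_of_mem_setV hv, ← h4] at h8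
    exact mem_right_of_pair_sublist h5
      (pair_sublist_of_bruhatLE (hF.M_ne_zero _ _) (hF.not_commute_of_mem_setV hv).symm h3 h8)

/-- Inserting `a` yields a reduced word of the element with a `u` to the left of a `v`. If its first
letter were `v`, cancelling it would leave another `v` in an element whose letters are `p` and `u`.
So the first letter lies in `U ∪ C`. -/
theorem exists_isLeftDescent (hF : cs.IsFullPartialMatching Q φ a) (hu : u ∈ cs.setU Q φ)
    (hv : v ∈ cs.setV Q φ) {p : List B} (hp : ∀ c ∈ p, c ∈ cs.setC φ) (hap : a ∉ p)
    (hred : cs.IsReduced (v :: (p ++ [u]))) (hQ : cs.wordProd (v :: (p ++ [u])) ∈ Q) :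
    ∃ s ∈ cs.setU Q φ ∪ cs.setC φ, cs.IsLeftDescent (cs.wordProd (v :: (p ++ [u]))) s := by
  by_contra hcon
  push Not at hcon
  have hay : ¬ cs.BruhatLE (cs.simple a) (cs.wordProd (v :: (p ++ [u]))) := by
    rw [simple_bruhatLE_iff_mem hred]
    simp [hap, (hF.ne_of_mem_setU hu).symm, (hF.ne_of_mem_setV hv).symm]
  obtain ⟨ζ₁, ζ₂, h1, h2, -, h4, h5⟩ := hF.exists_insert_of_le hu hv hQ hay
    (simple_bruhatLE_of_mem hred (by simp)) (simple_bruhatLE_of_mem hred (by simp))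
  cases ζ₁ with
  | nil => simp at h4
  | cons h ζ₁ =>
    rw [List.cons_append] at h1 h2
    have hd := h1.isLeftDescent
    rw [h2] at hd
    have hh : h ∈ v :: (p ++ [u]) := by
      rw [← simple_bruhatLE_iff_mem hred, ← h2]
      exact simple_bruhatLE_of_mem h1 (by simp)
    have hhv : h = v := by
      by_contra hne
      refine hcon h ?_ hd
      simp only [List.mem_cons, List.mem_append, List.not_mem_nil, or_false, hne, false_or] at hh
      rcases hh with hh | rfl
      · exact Or.inr (hp h hh)
      · exact Or.inl hu
    subst hhv
    rw [wordProd_cons, wordProd_cons, mul_right_inj] at h2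
    have h6 := simple_bruhatLE_of_mem h1.tail (List.mem_append_right ζ₁ h5)
    rw [h2, simple_bruhatLE_iff_mem hred.tail] at h6
    simp only [List.mem_append, List.mem_singleton] at h6
    rcases h6 with h6 | h6
    · exact hv.1 (hp _ h6)
    · exact hF.ne_of_mem hu hv h6.symm

theorem commute_of_mem (hF : cs.IsFullPartialMatching Q φ a) (hu : u ∈ cs.setU Q φ)
    (hv : v ∈ cs.setV Q φ) : cs.simple u * cs.simple v = cs.simple v * cs.simple u := by
  have huv := hF.ne_of_mem hu hv
  have hred : cs.IsReduced (v :: ([] ++ [u])) := isReduced_pair huv.symm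
  obtain ⟨s, hs, hd⟩ := hF.exists_isLeftDescent hu hv (p := []) (by simp) (by simp) hred
    (hF.mem_of_mem_parabolic (i := v) (j := u) (wordProd_mem_parabolic (by simp)))
  obtain ⟨ω, h1, h2⟩ := exists_isReduced_cons hd
  have hs' : s ∈ v :: ([] ++ [u]) := by
    rw [← simple_bruhatLE_iff_mem hred, ← h2]
    exact simple_bruhatLE_of_mem h1 (by simp)
  have hsv : s ≠ v := by
    rintro rfl
    exact hs.elim (hF.notMem_setU_of_mem_setV hv) hv.1
  have hsu : s = u := by simpa [hsv] using hs'
  subst hsu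
  have hl : ω.length = 1 := by
    have h3 := congrArg cs.length h2
    rw [h1.eq, hred.eq] at h3
    simpa using h3
  obtain ⟨x, rfl⟩ := List.length_eq_one_iff.1 hl
  have hx : x ∈ v :: ([] ++ [s]) := by
    rw [← simple_bruhatLE_iff_mem hred, ← h2]
    exact simple_bruhatLE_of_mem h1 (by simp)
  have hxs : x ≠ s := by
    rintro rfl
    exact not_isReduced_concat_concat [] x h1
  have hxv : x = v := by simpa [hxs] using hx
  subst hxv
  simpa [wordProd_cons] using h2

/-- Inserting `a` gives `φ (vu) = uav`. If `vau ∈ Q`, then `uav` and `vau` lie below `vau` or below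
`φ (vau)`, of length at most 4, whereas a word containing both as subwords has at least 5 letters.
-/
theorem wordProd_notMem (hF : cs.IsFullPartialMatching Q φ a) (hu : u ∈ cs.setU Q φ)
    (hv : v ∈ cs.setV Q φ) : cs.wordProd [v, a, u] ∉ Q := by
  intro hQ
  have hP := hF.isPartialMatching
  have huv := hF.ne_of_mem hu hv
  have hua := hF.ne_of_mem_setU hu
  have hva := hF.ne_of_mem_setV hv
  have hred := isReduced_triple (cs := cs) huv hva hua.symm
  have hle : cs.BruhatLE (cs.wordProd [v, u]) (cs.wordProd [v, a, u]) :=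
    bruhatLE_of_sublist (by simp) hred
  have hred2 : cs.IsReduced [v, u] := isReduced_pair huv.symm
  have hvuQ := hP.lower _ hQ _ hle
  obtain ⟨ζ₁, ζ₂, h1, h2, h3, h4, h5⟩ := hF.exists_insert_of_le hu hv hvuQ
    (by rw [simple_bruhatLE_iff_mem hred2]; simp [hua.symm, hva.symm])
    (simple_bruhatLE_of_mem hred2 (by simp)) (simple_bruhatLE_of_mem hred2 (by simp))
  have hl : (ζ₁ ++ ζ₂).length = 2 := by rw [← h1.eq, h2, hred2.eq]; rfl
  have hl1 := List.length_pos_of_mem h4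
  have hl2 := List.length_pos_of_mem h5
  rw [List.length_append] at hl
  obtain ⟨x, rfl⟩ := List.length_eq_one_iff.1 (show ζ₁.length = 1 by omega)
  obtain ⟨y, rfl⟩ := List.length_eq_one_iff.1 (show ζ₂.length = 1 by omega)
  rw [List.mem_singleton] at h4 h5
  subst h4 h5
  have key : ∃ ζ, cs.IsReduced ζ ∧ ζ.length ≤ 4 ∧
      cs.BruhatLE (cs.wordProd [u, a, v]) (cs.wordProd ζ) ∧
      cs.BruhatLE (cs.wordProd [v, a, u]) (cs.wordProd ζ) := by
    rcases hP.covBy _ hQ with hup | hdown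
    · obtain ⟨ζ, hζ, he⟩ := cs.exists_isReduced (φ (cs.wordProd [v, a, u]))
      refine ⟨ζ, hζ, ?_, ?_, ?_⟩
      · rw [← hζ.eq, ← he, hup.length_eq, hred.eq]
        simp
      · rw [← he]
        have := hP.map_le_map hQ hup hle
        rwa [← h3] at this
      · rw [← he]
        exact hup.le
    · refine ⟨_, hred, by simp, ?_, BruhatLE.refl cs _⟩
      have := hP.map_le_of_le hQ hdown hle
      rwa [← h3] at this
  obtain ⟨ζ, hζ, hl4, hz1, hz2⟩ := key
  have s1 := triple_sublist_of_bruhatLE huv.symm (hF.M_ne_zero _ _) (hF.M_ne_zero _ _)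
    (hF.not_commute_of_mem_setU hu) (hF.not_commute_of_mem_setV hv).symm hζ hz1
  have s2 := triple_sublist_of_bruhatLE huv (hF.M_ne_zero _ _) (hF.M_ne_zero _ _)
    (hF.not_commute_of_mem_setV hv) (hF.not_commute_of_mem_setU hu).symm hζ hz2
  have := five_le_length_of_sublist hua hva huv s1 s2
  omega

theorem triple_not_sublist (hF : cs.IsFullPartialMatching Q φ a) (hu : u ∈ cs.setU Q φ)
    (hv : v ∈ cs.setV Q φ) {ω : List B} (hω : cs.IsReduced ω) (hQ : cs.wordProd ω ∈ Q) :
    ¬ [v, a, u].Sublist ω := fun h =>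
  hF.wordProd_notMem hu hv (hF.isPartialMatching.lower _ hQ _ (bruhatLE_of_sublist h hω))

theorem mem_union (hF : cs.IsFullPartialMatching Q φ a) (r : B) :
    r ∈ cs.setU Q φ ∪ cs.setC φ ∨ r ∈ cs.setV Q φ := by
  by_cases hr : r ∈ cs.setC φ
  · exact Or.inl (Or.inr hr)
  have hrQ := hF.simple_mem r
  have hra : r ≠ a := by
    rintro rfl
    exact hr hF.self_mem_setC
  have hn : ¬ cs.BruhatLE (cs.simple a) (cs.simple r) := by
    rw [← cs.wordProd_singleton r, simple_bruhatLE_iff_mem (isReduced_singleton r),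
      List.mem_singleton]
    exact hra.symm
  have hup := hF.isPartialMatching.up_of_not_le hrQ (by rwa [hF.map_one])
  have hmem : φ (cs.simple r) ∈ cs.parabolic {a, r} :=
    hF.isPartialMatching.map_mem_parabolic
      (by rw [hF.map_one]; exact simple_mem_parabolic (by simp)) hrQ
      (simple_mem_parabolic (by simp))
  have h := (eq_wordProd_alternatingWord_of_mem (hF.M_ne_zero a r) hmem).2
  rw [hup.length_eq, length_simple, alternatingWord_two, alternatingWord_two] at h
  rcases h with h | h
  · right
    refine ⟨hr, hrQ, ?_⟩
    rw [h, hF.map_one]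
    simp [wordProd_cons]
  · left
    left
    refine ⟨hr, hrQ, ?_⟩
    rw [h, hF.map_one]
    simp [wordProd_cons]

end IsFullPartialMatching

end CoxeterSystem

namespace CoxeterSystem

variable {B W : Type*} [Group W] {M : CoxeterMatrix B} {cs : CoxeterSystem M W}

/-! ### Products of dihedral elements -/

theorem alternatingWord_sublist_of_bruhatLE {i j : B} {k : ℕ} (hk : k < M i j) {ω : List B}
    (hω : cs.IsReduced ω) (h : cs.BruhatLE (cs.wordProd (alternatingWord i j k)) (cs.wordProd ω)) :
    (alternatingWord i j k).Sublist ω := by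
  obtain ⟨τ, h2, h3, h4⟩ := exists_sublist_of_bruhatLE hω h
  rwa [eq_alternatingWord_of_wordProd_eq hk h3 h4] at h2

theorem reverse_alternatingWord_sublist_of_bruhatLE {i j : B} {k : ℕ} (hk : k < M i j)
    {ω : List B} (hω : cs.IsReduced ω)
    (h : cs.BruhatLE (cs.wordProd (alternatingWord i j k).reverse) (cs.wordProd ω)) :
    (alternatingWord i j k).reverse.Sublist ω := by
  have h' := h.inv
  rw [wordProd_reverse, inv_inv, ← wordProd_reverse] at h'
  have := (alternatingWord_sublist_of_bruhatLE hk hω.reverse h').reverse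
  rwa [List.reverse_reverse] at this

theorem alternatingWord_add_two (i j : B) (k : ℕ) :
    alternatingWord i j (k + 2) = alternatingWord i j k ++ [i, j] := by
  rw [alternatingWord_succ, alternatingWord_succ]
  simp

theorem reverse_alternatingWord_add_two (i j : B) (k : ℕ) :
    (alternatingWord i j (k + 2)).reverse = j :: i :: (alternatingWord i j k).reverse := by
  rw [alternatingWord_add_two]
  simp

/-- The word `⋯ a u v a ⋯` with `k` letters in `{a, u}` followed by `l` letters in `{a, v}`. -/
def crossWord (a u v : B) (k l : ℕ) : List B :=
  alternatingWord a u k ++ (alternatingWord a v l).reverse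

/-- The word obtained from `crossWord a u v (k + 2) (l + 2)` by exchanging the middle letters. -/
def crossWordSwap (a u v : B) (k l : ℕ) : List B :=
  alternatingWord a u k ++ [a, v, u] ++ a :: (alternatingWord a v l).reverse

theorem length_crossWord (a u v : B) (k l : ℕ) : (crossWord a u v k l).length = k + l := by
  simp [crossWord]

theorem length_crossWordSwap (a u v : B) (k l : ℕ) :
    (crossWordSwap a u v k l).length = k + 2 + (l + 2) := by
  simp [crossWordSwap]; omega

theorem filter_crossWordSwap (a u v : B) (k l : ℕ) (p : B → Bool) (hp : p u = false ∨ p v = false) :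
    (crossWordSwap a u v k l).filter p = (crossWord a u v (k + 2) (l + 2)).filter p := by
  rw [crossWord, crossWordSwap, alternatingWord_add_two, reverse_alternatingWord_add_two]
  rcases hp with hp | hp <;> simp [List.filter_cons, hp]

namespace IsFullPartialMatching

variable {Q : Set W} {φ : W → W} {a u v : B}

theorem wordProd_crossWordSwap (hF : cs.IsFullPartialMatching Q φ a) (hu : u ∈ cs.setU Q φ)
    (hv : v ∈ cs.setV Q φ) (k l : ℕ) :
    cs.wordProd (crossWordSwap a u v k l) = cs.wordProd (crossWord a u v (k + 2) (l + 2)) := by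
  rw [crossWord, crossWordSwap, alternatingWord_add_two, reverse_alternatingWord_add_two]
  have h := hF.commute_of_mem hu hv
  simp only [wordProd_append, wordProd_cons, wordProd_nil, mul_assoc, mul_one]
  rw [← mul_assoc (cs.simple u) (cs.simple v), h, mul_assoc]

theorem three_le_u (hF : cs.IsFullPartialMatching Q φ a) (hu : u ∈ cs.setU Q φ) : 3 ≤ M a u :=
  three_le_of_not_commute (hF.M_ne_zero a u) (hF.not_commute_of_mem_setU hu).symm

/-- A word `va⋯` shorter than the longest one has no left descent other than `v`, so it is a minimal
representative for left multiplication by `⟨a, u⟩`. -/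
theorem isReduced_crossWord (hF : cs.IsFullPartialMatching Q φ a) (hu : u ∈ cs.setU Q φ)
    (hv : v ∈ cs.setV Q φ) {k l : ℕ} (hk : k < M a u) (hl : l < M a v) :
    cs.IsReduced (crossWord a u v k l) := by
  have r1 := isReduced_alternatingWord (cs := cs) hk.le
  have r2 := (isReduced_alternatingWord (cs := cs) hl.le).reverse
  have hnd : ∀ s ∈ ({a, u} : Set B),
      ¬ cs.IsLeftDescent (cs.wordProd (alternatingWord a v l).reverse) s := by
    intro s hs hd
    obtain ⟨ω, h1, h2⟩ := exists_isReduced_cons hd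
    have h3 : cs.wordProd (s :: ω).reverse = cs.wordProd (alternatingWord a v l) := by
      rw [wordProd_reverse, h2, wordProd_reverse, inv_inv]
    have h4 := eq_alternatingWord_of_wordProd_eq hl h1.reverse h3
    have hav := hF.ne_of_mem_setV hv
    have huv := hF.ne_of_mem hu hv
    cases l with
    | zero => simp [alternatingWord] at h4
    | succ l =>
      rw [alternatingWord_succ, List.reverse_cons, List.concat_eq_append] at h4
      obtain ⟨_, h5⟩ := List.append_inj' h4 rfl
      have h6 : s = v := by simpa using h5
      subst h6
      rcases hs with hs | hs
      · exact hav hs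
      · exact huv (Set.mem_singleton_iff.1 hs).symm
  have h := length_mul_of_not_isLeftDescent hnd (cs.alternatingWord_mem_parabolic a u k)
  rw [crossWord, IsReduced, wordProd_append, h, r1.eq, r2.eq, List.length_append]

theorem sublist_crossWord (hF : cs.IsFullPartialMatching Q φ a) (hu : u ∈ cs.setU Q φ)
    (hv : v ∈ cs.setV Q φ) {k l : ℕ} {ω : List B} (hω : cs.IsReduced ω)
    (hQ : cs.wordProd ω ∈ Q) (h1 : (alternatingWord a u (k + 2)).Sublist ω)
    (h2 : (alternatingWord a v (l + 2)).reverse.Sublist ω) :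
    (crossWord a u v (k + 2) (l + 2)).Sublist ω ∨ (crossWordSwap a u v k l).Sublist ω := by
  have hau := (hF.ne_of_mem_setU hu).symm
  have hav := (hF.ne_of_mem_setV hv).symm
  have huv := hF.ne_of_mem hu hv
  rw [crossWord, crossWordSwap]
  rw [alternatingWord_add_two] at h1 ⊢
  rw [reverse_alternatingWord_add_two] at h2 ⊢
  refine sublist_interleave hau ?_ hav huv h1 h2 (hF.triple_not_sublist hu hv hω hQ)
  intro hc
  rcases mem_of_mem_alternatingWord hc with h | h
  · exact hav h.symm
  · exact huv h.symm

/-- A reduced word of a full element contains both alternating words but not `v, a, u`. So it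
contains them side by side, up to swapping the commuting middle letters. -/
theorem wordProd_crossWord_mem (hF : cs.IsFullPartialMatching Q φ a) (hu : u ∈ cs.setU Q φ)
    (hv : v ∈ cs.setV Q φ) {k l : ℕ} (hk : k + 2 < M a u) (hl : l + 2 < M a v) :
    cs.wordProd (crossWord a u v (k + 2) (l + 2)) ∈ Q := by
  obtain ⟨w, hwQ, hw⟩ := hF.isFullMatching
  obtain ⟨ω, hω, rfl⟩ := cs.exists_isReduced w
  have h1 := alternatingWord_sublist_of_bruhatLE hk hω
    (hw.le_of_mem_parabolic (cs.alternatingWord_mem_parabolic a u (k + 2)))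
  have h2 := reverse_alternatingWord_sublist_of_bruhatLE hl hω
    (hw.le_of_mem_parabolic (i := a) (j := v) (by
      rw [wordProd_reverse]
      exact inv_mem (cs.alternatingWord_mem_parabolic a v (l + 2))))
  apply hF.isPartialMatching.lower _ hwQ
  rcases hF.sublist_crossWord hu hv hω hwQ h1 h2 with h | h
  · exact bruhatLE_of_sublist h hω
  · rw [← hF.wordProd_crossWordSwap hu hv]
    exact bruhatLE_of_sublist h hω

theorem eq_crossWord (hF : cs.IsFullPartialMatching Q φ a) (hu : u ∈ cs.setU Q φ)
    (hv : v ∈ cs.setV Q φ) {k l : ℕ} (hk : k + 2 < M a u) (hl : l + 2 < M a v) {τ : List B}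
    (hτ : cs.IsReduced τ) (h : cs.wordProd τ = cs.wordProd (crossWord a u v (k + 2) (l + 2))) :
    τ = crossWord a u v (k + 2) (l + 2) ∨ τ = crossWordSwap a u v k l := by
  have hred := hF.isReduced_crossWord hu hv hk hl
  have hQ := hF.wordProd_crossWord_mem hu hv hk hl
  have hlen : τ.length = k + 2 + (l + 2) := by
    rw [← hτ.eq, h, hred.eq, length_crossWord]
  have h1 : (alternatingWord a u (k + 2)).Sublist τ := by
    apply alternatingWord_sublist_of_bruhatLE hk hτ
    rw [h]
    exact bruhatLE_of_sublist (List.sublist_append_left _ _) hred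
  have h2 : (alternatingWord a v (l + 2)).reverse.Sublist τ := by
    apply reverse_alternatingWord_sublist_of_bruhatLE hl hτ
    rw [h]
    exact bruhatLE_of_sublist (List.sublist_append_right _ _) hred
  refine (hF.sublist_crossWord hu hv hτ (h ▸ hQ) h1 h2).imp (fun h => ?_) (fun h => ?_)
  · exact (h.eq_of_length (by rw [length_crossWord, hlen])).symm
  · exact (h.eq_of_length (by rw [length_crossWordSwap, hlen])).symm

theorem filter_eq_of_wordProd_eq (hF : cs.IsFullPartialMatching Q φ a) (hu : u ∈ cs.setU Q φ)
    (hv : v ∈ cs.setV Q φ) {k l : ℕ} (hk : k + 2 < M a u) (hl : l + 2 < M a v) {τ : List B}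
    (hτ : cs.IsReduced τ) (h : cs.wordProd τ = cs.wordProd (crossWord a u v (k + 2) (l + 2)))
    (p : B → Bool) (hp : p u = false ∨ p v = false) :
    τ.filter p = (crossWord a u v (k + 2) (l + 2)).filter p := by
  rcases hF.eq_crossWord hu hv hk hl hτ h with rfl | rfl
  · rfl
  · exact filter_crossWordSwap a u v k l p hp

/-- Up to replacing `y = ⋯ a u v a ⋯` by `φ y`, the images of the elements below `y` lie below an
element with a reduced word `ζ` which is a word of `y` with at most one additional letter. -/
theorem exists_word_map_le (hF : cs.IsFullPartialMatching Q φ a) {y : W} (hy : y ∈ Q) :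
    ∃ ζ, cs.IsReduced ζ ∧ cs.wordProd ζ ∈ Q ∧
      (∀ x, cs.BruhatLE x y → cs.BruhatLE (φ x) (cs.wordProd ζ)) ∧
      (cs.wordProd ζ = y ∨ ∃ ζ₁ r ζ₂, ζ = ζ₁ ++ r :: ζ₂ ∧ cs.IsReduced (ζ₁ ++ ζ₂) ∧
        cs.wordProd (ζ₁ ++ ζ₂) = y) := by
  have hP := hF.isPartialMatching
  rcases hP.covBy y hy with hup | hdown
  · obtain ⟨ζ, hζ, he⟩ := cs.exists_isReduced (φ y)
    refine ⟨ζ, hζ, he ▸ hP.mapsTo y hy, fun x hx => he ▸ hP.map_le_map hy hup hx, Or.inr ?_⟩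
    rw [he] at hup
    obtain ⟨ζ₁, r, ζ₂, h1, h2, h3⟩ := exists_erase_of_covBy hζ hup
    exact ⟨ζ₁, r, ζ₂, h1, h2, h3.symm⟩
  · obtain ⟨ζ, hζ, rfl⟩ := cs.exists_isReduced y
    exact ⟨ζ, hζ, hy, fun x hx => hP.map_le_of_le hy hdown hx, Or.inl rfl⟩

end IsFullPartialMatching

/-! ### Deviations from one-sided multiplication -/

open scoped Classical in
theorem filter_alternatingWord_eq_self (i j : B) (k : ℕ) :
    (alternatingWord i j k).filter (fun x => decide (x = i ∨ x = j)) = alternatingWord i j k := by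
  rw [List.filter_eq_self]
  intro x hx
  simpa using mem_of_mem_alternatingWord hx

namespace IsFullPartialMatching

variable {Q : Set W} {φ : W → W} {a u v : B}

open scoped Classical in
theorem filter_left_crossWord (hF : cs.IsFullPartialMatching Q φ a) (hu : u ∈ cs.setU Q φ)
    (hv : v ∈ cs.setV Q φ) (k l : ℕ) : ∃ A : List B, u ∉ A ∧
      (crossWord a u v k l).filter (fun x => decide (x = a ∨ x = u)) =
        alternatingWord a u k ++ A := by
  refine ⟨(alternatingWord a v l).reverse.filter (fun x => decide (x = a ∨ x = u)), ?_, ?_⟩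
  · intro h
    rw [List.mem_filter, List.mem_reverse] at h
    rcases mem_of_mem_alternatingWord h.1 with h | h
    · exact hF.ne_of_mem_setU hu h
    · exact hF.ne_of_mem hu hv h
  · rw [crossWord, List.filter_append, filter_alternatingWord_eq_self]

open scoped Classical in
theorem filter_right_crossWord (hF : cs.IsFullPartialMatching Q φ a) (hu : u ∈ cs.setU Q φ)
    (hv : v ∈ cs.setV Q φ) (k l : ℕ) : ∃ A : List B, v ∉ A ∧
      ((crossWord a u v k l).filter (fun x => decide (x = a ∨ x = v))).reverse =
        alternatingWord a v l ++ A := by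
  refine ⟨((alternatingWord a u k).filter (fun x => decide (x = a ∨ x = v))).reverse, ?_, ?_⟩
  · intro h
    rw [List.mem_reverse, List.mem_filter] at h
    rcases mem_of_mem_alternatingWord h.1 with h | h
    · exact hF.ne_of_mem_setV hv h
    · exact (hF.ne_of_mem hu hv).symm h
  · rw [crossWord, List.filter_append, List.filter_reverse, filter_alternatingWord_eq_self,
      List.reverse_append, List.reverse_reverse]

/-- With `y = ⋯auva⋯`, both deviating images lie below `y` or `φ y`, hence are subwords of a word of
`y` with at most one added letter `r`. Seen in `{a, u}` and in `{a, v}` the word of `y` is too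
short, so `r` belongs to both sets and is `a`. It must then stand before all letters `a, u` and
after all letters `a, v`, but `y` already contains an `a`. -/
theorem false_of_deviations (hF : cs.IsFullPartialMatching Q φ a) (hu : u ∈ cs.setU Q φ)
    (hv : v ∈ cs.setV Q φ) {k l : ℕ} (hk : k + 3 < M a u) (hl : l + 3 < M a v)
    (hφu : φ (cs.wordProd (alternatingWord a u (k + 2))) =
      cs.wordProd (alternatingWord a u (k + 3)))
    (hφv : φ (cs.wordProd (alternatingWord a v (l + 2)).reverse) =
      cs.wordProd (alternatingWord a v (l + 3)).reverse) : False := by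
  classical
  have hau := (hF.ne_of_mem_setU hu).symm
  have hav := (hF.ne_of_mem_setV hv).symm
  have huv := hF.ne_of_mem hu hv
  have hk' : k + 2 < M a u := by omega
  have hl' : l + 2 < M a v := by omega
  have hred := hF.isReduced_crossWord hu hv hk' hl'
  have hQ := hF.wordProd_crossWord_mem hu hv hk' hl'
  obtain ⟨ζ, hζ, -, hle, hcase⟩ := hF.exists_word_map_le hQ
  have h1 := hle _ (bruhatLE_of_sublist (List.sublist_append_left _ _) hred)
  have h2 := hle _ (bruhatLE_of_sublist (List.sublist_append_right _ _) hred)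
  rw [hφu] at h1
  rw [hφv] at h2
  have s1 := (alternatingWord_sublist_of_bruhatLE hk hζ h1).filter
    (fun x => decide (x = a ∨ x = u))
  have s2 := ((reverse_alternatingWord_sublist_of_bruhatLE hl hζ h2).filter
    (fun x => decide (x = a ∨ x = v))).reverse
  rw [filter_alternatingWord_eq_self] at s1
  rw [List.filter_reverse, filter_alternatingWord_eq_self, List.reverse_reverse] at s2
  obtain ⟨A₁, hA₁, e1⟩ := hF.filter_left_crossWord hu hv (k + 2) (l + 2)
  obtain ⟨A₂, hA₂, e2⟩ := hF.filter_right_crossWord hu hv (k + 2) (l + 2)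
  have f1 : ∀ τ, cs.IsReduced τ → cs.wordProd τ = cs.wordProd (crossWord a u v (k + 2) (l + 2)) →
      τ.filter (fun x => decide (x = a ∨ x = u)) = alternatingWord a u (k + 2) ++ A₁ := by
    intro τ hτ hp
    rw [← e1]
    exact hF.filter_eq_of_wordProd_eq hu hv hk' hl' hτ hp _ (Or.inr (by
      simp [hav.symm, huv.symm]))
  have f2 : ∀ τ, cs.IsReduced τ → cs.wordProd τ = cs.wordProd (crossWord a u v (k + 2) (l + 2)) →
      (τ.filter (fun x => decide (x = a ∨ x = v))).reverse = alternatingWord a v (l + 2) ++ A₂ := by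
    intro τ hτ hp
    rw [← e2]
    exact congrArg List.reverse (hF.filter_eq_of_wordProd_eq hu hv hk' hl' hτ hp _ (Or.inl (by
      simp [hau.symm, huv])))
  have n1 := not_alternatingWord_succ_sublist hau hA₁ (k + 2)
  have n2 := not_alternatingWord_succ_sublist hav hA₂ (l + 2)
  rcases hcase with hcase | ⟨ζ₁, r, ζ₂, rfl, h3, h4⟩
  · rw [f1 ζ hζ hcase] at s1
    exact n1 s1
  · have g1 := f1 _ h3 h4
    have g2 := f2 _ h3 h4
    rw [List.filter_append] at s1 s2 g1 g2
    have hr1 : r = a ∨ r = u := by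
      by_contra hc
      rw [List.filter_cons_of_neg (by simpa using hc), g1] at s1
      exact n1 s1
    have hr2 : r = a ∨ r = v := by
      by_contra hc
      rw [List.filter_cons_of_neg (by simpa using hc), g2] at s2
      exact n2 s2
    have hra : r = a := by
      rcases hr1 with h | h
      · exact h
      · rcases hr2 with h' | h'
        · exact h'
        · exact absurd (h.symm.trans h') huv
    subst hra
    rw [List.filter_cons_of_pos (by simp)] at s1 s2
    have z1 := eq_nil_of_alternatingWord_succ_sublist hau hA₁ g1 s1
    rw [List.reverse_append] at g2
    rw [List.reverse_append, List.reverse_cons, List.append_assoc, List.singleton_append] at s2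
    have z2 := eq_nil_of_alternatingWord_succ_sublist hav hA₂ g2 s2
    have hmem : r ∈ ζ₁ ++ ζ₂ := by
      rw [← simple_bruhatLE_iff_mem h3, h4, simple_bruhatLE_iff_mem hred, crossWord,
        alternatingWord_add_two]
      simp
    rw [List.mem_append] at hmem
    rcases hmem with hm | hm
    · rw [List.filter_eq_nil_iff] at z1
      simpa using z1 r hm
    · rw [List.reverse_eq_nil_iff, List.filter_eq_nil_iff] at z2
      simpa using z2 r hm

/-- Take `y = a u v a ⋯`. An image `vava⋯` of `ava⋯` has one letter more than the `{a, v}`-part of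
`y` and starts differently. The letter added by `φ` must then be a `v` before every `a`; since `au ≤
y`, the forbidden word `v, a, u` appears. -/
theorem map_simple_mul_ne (hF : cs.IsFullPartialMatching Q φ a) (hu : u ∈ cs.setU Q φ)
    (hv : v ∈ cs.setV Q φ) {l : ℕ} (hl : l + 4 < M a v) :
    φ (cs.simple a * cs.wordProd (alternatingWord a v (l + 2)).reverse) ≠
      cs.wordProd (alternatingWord a v (l + 4)).reverse := by
  classical
  intro hφ
  have hau := (hF.ne_of_mem_setU hu).symm
  have hav := (hF.ne_of_mem_setV hv).symm
  have huv := hF.ne_of_mem hu hv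
  have hk' : 0 + 2 < M a u := by
    have := hF.three_le_u hu
    omega
  have hl' : l + 2 < M a v := by omega
  have hred := hF.isReduced_crossWord hu hv hk' hl'
  have hQ := hF.wordProd_crossWord_mem hu hv hk' hl'
  obtain ⟨ζ, hζ, hζQ, hle, hcase⟩ := hF.exists_word_map_le hQ
  have ecross : crossWord a u v (0 + 2) (l + 2) =
      a :: u :: (alternatingWord a v (l + 2)).reverse := rfl
  have h1 := hle (cs.wordProd (a :: (alternatingWord a v (l + 2)).reverse))
    (bruhatLE_of_sublist (by rw [ecross]; simp) hred)
  rw [wordProd_cons, hφ] at h1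
  have s1 := (reverse_alternatingWord_sublist_of_bruhatLE hl hζ h1).filter
    (fun x => decide (x = a ∨ x = v))
  rw [List.filter_reverse, filter_alternatingWord_eq_self] at s1
  have f1 : ∀ τ, cs.IsReduced τ → cs.wordProd τ = cs.wordProd (crossWord a u v (0 + 2) (l + 2)) →
      τ.filter (fun x => decide (x = a ∨ x = v)) =
        a :: (alternatingWord a v (l + 2)).reverse := by
    intro τ hτ hp
    rw [hF.filter_eq_of_wordProd_eq hu hv hk' hl' hτ hp _ (Or.inl (by simp [hau.symm, huv])),
      ecross, List.filter_cons_of_pos (by simp), List.filter_cons_of_neg (by simp [hau.symm, huv]),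
      List.filter_reverse, filter_alternatingWord_eq_self]
  have len := s1.length_le
  rcases hcase with hcase | ⟨ζ₁, r, ζ₂, rfl, h3, h4⟩
  · rw [f1 ζ hζ hcase] at len
    simp at len
  · have g1 := f1 _ h3 h4
    rw [List.filter_append] at s1 g1 len
    have glen := congrArg List.length g1
    simp only [List.length_append, List.length_cons, List.length_reverse,
      length_alternatingWord] at glen
    have hr : r = a ∨ r = v := by
      by_contra hc
      rw [List.filter_cons_of_neg (by simpa using hc), List.length_append, List.length_reverse,
        length_alternatingWord] at len
      omega
    rw [List.filter_cons_of_pos (by simpa using hr)] at s1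
    have heq := s1.eq_of_length (by
      simp only [List.length_append, List.length_cons, List.length_reverse,
        length_alternatingWord]
      omega)
    rw [reverse_alternatingWord_add_two] at heq
    have hnil : ζ₁.filter (fun x => decide (x = a ∨ x = v)) = [] := by
      cases hf : ζ₁.filter (fun x => decide (x = a ∨ x = v)) with
      | nil => rfl
      | cons x f =>
        rw [hf, List.cons_append, List.cons.injEq] at g1 heq
        exact absurd (g1.1.symm.trans heq.1.symm) hav
    have hrv : r = v := by
      rw [hnil, List.nil_append, List.cons.injEq] at heq
      exact heq.1.symm
    subst hrv
    have haζ : a ∉ ζ₁ := by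
      intro ha
      rw [List.filter_eq_nil_iff] at hnil
      simpa using hnil a ha
    have hpair : [a, u].Sublist (ζ₁ ++ ζ₂) := by
      apply pair_sublist_of_bruhatLE (hF.M_ne_zero _ _) (hF.not_commute_of_mem_setU hu).symm h3
      rw [h4]
      have := bruhatLE_of_sublist (cs := cs) (τ := [a, u]) (by rw [ecross]; simp) hred
      simpa [wordProd_cons] using this
    have h5 := sublist_right_of_cons_sublist haζ hpair
    exact hF.triple_not_sublist hu hv hζ hζQ
      ((h5.cons_cons r).trans (List.sublist_append_right _ _))

end IsFullPartialMatching

end CoxeterSystem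

namespace CoxeterSystem

variable {B W : Type*} [Group W] {M : CoxeterMatrix B} {cs : CoxeterSystem M W}

theorem wordProd_alternatingWord_eq_swap (cs : CoxeterSystem M W) (i j : B) :
    cs.wordProd (alternatingWord i j (M i j)) = cs.wordProd (alternatingWord j i (M i j)) := by
  have h := cs.wordProd_braidWord_eq i j
  rwa [braidWord, braidWord, M.symmetric j i] at h

namespace IsFullPartialMatching

variable {Q : Set W} {φ : W → W} {a u v : B}

/-! ### Regularity -/

theorem map_mem_parabolic_pair (hF : cs.IsFullPartialMatching Q φ a) {r : B} {x : W}
    (hx : x ∈ cs.parabolic {a, r}) : φ x ∈ cs.parabolic {a, r} :=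
  hF.isPartialMatching.map_mem_parabolic
    (by rw [hF.map_one]; exact simple_mem_parabolic (by simp)) (hF.mem_of_mem_parabolic hx) hx

/-- Words `alternatingWord a u k` end in `u`. Matched upwards, such a word gains an `a` on the
right, since the left extension is excluded by hypothesis or, at full length, is the same element.
Matched downwards, its partner would already have a different partner by induction. -/
theorem map_alternatingWord (hF : cs.IsFullPartialMatching Q φ a) (hu : u ∈ cs.setU Q φ)
    (hdev : ∀ k, k + 3 < M a u → φ (cs.wordProd (alternatingWord a u (k + 2))) ≠
      cs.wordProd (alternatingWord a u (k + 3))) {k : ℕ} (hk : k < M a u) :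
    φ (cs.wordProd (alternatingWord a u k)) =
      cs.wordProd (alternatingWord u a (k + 1)) := by
  have hP := hF.isPartialMatching
  have hau := (hF.ne_of_mem_setU hu).symm
  induction k using Nat.strong_induction_on with
  | _ k ih =>
    match k, ih, hk with
    | 0, _, _ => simp [alternatingWord, hF.map_one]
    | 1, _, _ => simp [alternatingWord, hF.map_of_mem_setU hu, wordProd_cons]
    | k + 2, ih, hk =>
      set x := cs.wordProd (alternatingWord a u (k + 2)) with hx
      have hxJ : x ∈ cs.parabolic {a, u} := cs.alternatingWord_mem_parabolic a u _
      have hxQ : x ∈ Q := hF.mem_of_mem_parabolic hxJ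
      have hxl : cs.length x = k + 2 := by
        rw [hx, (isReduced_alternatingWord hk.le).eq, length_alternatingWord]
      have hz := (eq_wordProd_alternatingWord_of_mem (hF.M_ne_zero a u)
        (hF.map_mem_parabolic_pair hxJ))
      have hinv := hP.involutive x hxQ
      rcases hP.covBy x hxQ with hup | hdown
      · rw [hup.length_eq, hxl] at hz
        rcases hz.2 with h | h
        · rcases Nat.lt_or_ge (k + 3) (M a u) with hlt | hge
          · exact absurd h (hdev k hlt)
          · have he : k + 2 + 1 = M a u := by omega
            rw [h, he]
            exact cs.wordProd_alternatingWord_eq_swap a u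
        · exact h
      · exfalso
        have hl : cs.length (φ x) = k + 1 := by
          have := hdown.length_eq
          omega
        rw [hl] at hz
        rcases hz.2 with h | h
        · have h1 := ih (k + 1) (by omega) (by omega)
          rw [← h, hinv, hx] at h1
          have hr : cs.IsReduced (alternatingWord u a (k + 2)) :=
            isReduced_alternatingWord (by rw [M.symmetric u a]; exact hk.le)
          have h2 := eq_alternatingWord_of_wordProd_eq hk hr h1.symm
          rw [alternatingWord_add_two u a, alternatingWord_add_two a u] at h2
          obtain ⟨_, h3⟩ := List.append_inj' h2 rfl
          simp only [List.cons.injEq, and_true] at h3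
          exact hau h3.2
        · have h1 := ih k (by omega) (by omega)
          rw [← h] at h1
          have hQk : cs.wordProd (alternatingWord a u k) ∈ Q :=
            hF.mem_of_mem_parabolic (cs.alternatingWord_mem_parabolic a u k)
          have h2 := hP.involutive _ hQk
          rw [h1, hinv] at h2
          have h3 := cs.length_wordProd_le (alternatingWord a u k)
          rw [← h2, hxl, length_alternatingWord] at h3
          omega

theorem map_eq_mul_of_mem_setU (hF : cs.IsFullPartialMatching Q φ a) (hu : u ∈ cs.setU Q φ)
    (hdev : ∀ k, k + 3 < M a u → φ (cs.wordProd (alternatingWord a u (k + 2))) ≠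
      cs.wordProd (alternatingWord a u (k + 3))) {x : W} (hx : x ∈ cs.parabolic {a, u}) :
    φ x = x * cs.simple a := by
  have hP := hF.isPartialMatching
  have hsucc : ∀ k, cs.wordProd (alternatingWord u a (k + 1)) =
      cs.wordProd (alternatingWord a u k) * cs.simple a := fun k => by
    rw [alternatingWord_succ, wordProd_concat]
  have h1 : ∀ k, k < M a u → φ (cs.wordProd (alternatingWord a u k)) =
      cs.wordProd (alternatingWord a u k) * cs.simple a := fun k hk => by
    rw [hF.map_alternatingWord hu hdev hk, hsucc]
  have h2 : ∀ k, k < M a u → φ (cs.wordProd (alternatingWord u a (k + 1))) =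
      cs.wordProd (alternatingWord u a (k + 1)) * cs.simple a := fun k hk => by
    have h3 := hP.involutive _ (hF.mem_of_mem_parabolic (cs.alternatingWord_mem_parabolic a u k))
    rw [h1 k hk, ← hsucc] at h3
    rw [h3, hsucc, simple_mul_simple_cancel_right]
  have hpos := hF.M_ne_zero a u
  have h3 : ∀ n ≤ M a u, φ (cs.wordProd (alternatingWord u a n)) =
      cs.wordProd (alternatingWord u a n) * cs.simple a := by
    intro n hn
    cases n with
    | zero => exact h1 0 (by omega)
    | succ n => exact h2 n (by omega)
  obtain ⟨hle, h | h⟩ := eq_wordProd_alternatingWord_of_mem hpos hx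
  · rcases Nat.lt_or_ge (cs.length x) (M a u) with hlt | hge
    · rw [h]; exact h1 _ hlt
    · have he : cs.length x = M a u := le_antisymm hle hge
      rw [h, he, cs.wordProd_alternatingWord_eq_swap a u]
      exact h3 _ le_rfl
  · rw [h]; exact h3 _ hle

theorem map_eq_mul_of_mem_setC (hF : cs.IsFullPartialMatching Q φ a) {c : B}
    (hc : c ∈ cs.setC φ) {x : W} (hx : x ∈ cs.parabolic {a, c}) : φ x = x * cs.simple a := by
  have hP := hF.isPartialMatching
  rw [hF.mem_setC_iff] at hc
  have hca : φ (cs.simple c) = cs.simple c * cs.simple a := by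
    by_cases hne : c = a
    · subst hne
      rw [hF.map_simple_self, simple_mul_simple_self]
    have hn : ¬ cs.BruhatLE (cs.simple a) (cs.simple c) := by
      rw [← cs.wordProd_singleton c, simple_bruhatLE_iff_mem (isReduced_singleton c),
        List.mem_singleton]
      exact Ne.symm hne
    have hup := hP.up_of_not_le (hF.simple_mem c) (by rwa [hF.map_one])
    have h := (eq_wordProd_alternatingWord_of_mem (hF.M_ne_zero a c)
      (hF.map_mem_parabolic_pair (r := c) (x := cs.simple c) (simple_mem_parabolic (by simp)))).2
    rw [hup.length_eq, length_simple, alternatingWord_two, alternatingWord_two] at h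
    rcases h with h | h
    · rw [h, hc]; simp [wordProd_cons]
    · rw [h]; simp [wordProd_cons]
  have hca' : φ (cs.simple c * cs.simple a) = cs.simple c := by
    rw [← hca]
    exact hP.involutive _ (hF.simple_mem c)
  obtain ⟨ω, h1, rfl⟩ := exists_word_of_mem_parabolic hx
  have hfour : cs.wordProd ω = 1 ∨ cs.wordProd ω = cs.simple a ∨ cs.wordProd ω = cs.simple c ∨
      cs.wordProd ω = cs.simple c * cs.simple a := by
    clear hx
    induction ω with
    | nil => simp
    | cons i ω ih =>
      have hi : i = a ∨ i = c := by simpa using h1 i (by simp)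
      rw [wordProd_cons]
      rcases ih (fun j hj => h1 j (List.mem_cons_of_mem _ hj)) with h | h | h | h <;> rw [h] <;>
        rcases hi with rfl | rfl
      · simp
      · simp
      · simp
      · simp
      · simp [hc]
      · simp
      · right; right; left
        rw [hc, simple_mul_simple_cancel_left]
      · simp
  rcases hfour with h | h | h | h <;> rw [h]
  · rw [hF.map_one, one_mul]
  · rw [hF.map_simple_self, simple_mul_simple_self]
  · exact hca
  · rw [hca', simple_mul_simple_cancel_right]

/-- Without left descent `a`, `x` is `vav⋯`. Its image is the next such word: the alternative `a x`
would be matched downwards. By length, `φ (a x)` is either `a φ x` or the word `vav⋯` two letters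
longer than `x`; the latter agrees with `a φ x` at full length, is excluded by `map_simple_mul_ne`
for longer `x`, and contradicts the given values when `x` has length 0 or 1. -/
theorem map_simple_mul_of_mem_setV (hF : cs.IsFullPartialMatching Q φ a)
    (hU : (cs.setU Q φ).Nonempty) (hv : v ∈ cs.setV Q φ) {x : W} (hx : x ∈ cs.parabolic {a, v})
    (hd : ¬ cs.IsLeftDescent x a) (hup : cs.BruhatCovBy x (φ x))
    (hup' : cs.BruhatCovBy (cs.simple a * x) (φ (cs.simple a * x))) :
    φ (cs.simple a * x) = cs.simple a * φ x := by
  obtain ⟨u, hu⟩ := hU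
  by_contra hne
  have hA : cs.simple a ∈ cs.parabolic {a, v} := simple_mem_parabolic (by simp)
  have hax := mul_mem hA hx
  have hlax := cs.not_isLeftDescent_iff.1 hd
  -- elements of the dihedral group are described by their inverses
  have key : ∀ y ∈ cs.parabolic {a, v}, cs.length y ≤ M a v ∧
      (y = cs.wordProd (alternatingWord a v (cs.length y)).reverse ∨
        ∀ n, cs.length y = n + 1 →
          y = cs.simple a * cs.wordProd (alternatingWord a v n).reverse) := by
    intro y hy
    obtain ⟨h1, h2⟩ := eq_wordProd_alternatingWord_of_mem (hF.M_ne_zero a v) (inv_mem hy)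
    rw [length_inv] at h1 h2
    refine ⟨h1, h2.imp (fun h => ?_) (fun h n hn => ?_)⟩
    · rw [wordProd_reverse, ← h, inv_inv]
    · rw [hn, alternatingWord_succ, wordProd_concat] at h
      rw [wordProd_reverse, ← inv_inv y, h, mul_inv_rev, inv_simple]
  have hxn : x = cs.wordProd (alternatingWord a v (cs.length x)).reverse := by
    rcases (key x hx).2 with h | h
    · exact h
    · rcases Nat.eq_zero_or_eq_succ_pred (cs.length x) with h0 | h0
      · rw [h0]
        rw [length_eq_zero_iff] at h0
        simp [h0, alternatingWord]
      · exfalso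
        apply hd
        have h1 := h _ h0
        have h2 := cs.length_wordProd_le (alternatingWord a v (cs.length x).pred).reverse
        rw [List.length_reverse, length_alternatingWord] at h2
        rw [IsLeftDescent]
        conv_lhs => rw [h1, simple_mul_simple_cancel_left]
        omega
  have hz : φ x = cs.wordProd (alternatingWord a v (cs.length x + 1)).reverse := by
    rcases (key _ (hF.map_mem_parabolic_pair hx)).2 with h | h
    · rwa [hup.length_eq] at h
    · exfalso
      have h1 := h _ hup.length_eq
      rw [← hxn] at h1
      rw [← h1, hF.isPartialMatching.involutive x (hF.mem_of_mem_parabolic hx), h1] at hup'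
      have := hup'.length_eq
      omega
  obtain ⟨hle, hor⟩ := key _ (hF.map_mem_parabolic_pair hax)
  have hlz : cs.length (φ (cs.simple a * x)) = cs.length x + 1 + 1 := by
    rw [hup'.length_eq, hlax]
  have hz' : φ (cs.simple a * x) =
      cs.wordProd (alternatingWord a v (cs.length x + 1 + 1)).reverse := by
    rcases hor with h | h
    · rwa [hlz] at h
    · exfalso
      have h1 := h _ hlz
      rw [← hz] at h1
      exact hne h1
  rw [hlz] at hle
  have hlt : cs.length x + 2 < M a v := by
    by_contra hc
    have he : cs.length x + 1 + 1 = M a v := by omega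
    apply hne
    have hb := cs.wordProd_alternatingWord_eq_swap a v
    rw [← he] at hb
    rw [hz', hz, wordProd_reverse, hb, alternatingWord_succ, wordProd_concat, wordProd_reverse,
      mul_inv_rev, inv_simple]
  generalize cs.length x = n at *
  match n, hxn, hz, hz', hlt with
  | 0, hxn, _, _, _ =>
    have : x = 1 := by simpa [alternatingWord] using hxn
    subst this
    rw [mul_one, hF.map_simple_self] at hne
    exact hne (by rw [hF.map_one, simple_mul_simple_self])
  | 1, hxn, _, _, _ =>
    have : x = cs.simple v := by simpa [alternatingWord] using hxn
    subst this
    apply hne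
    rw [hF.map_of_mem_setV hv, ← hF.map_of_mem_setV hv,
      hF.isPartialMatching.involutive _ (hF.simple_mem v), hF.map_of_mem_setV hv,
      simple_mul_simple_cancel_left]
  | l + 2, hxn, _, hz', hlt =>
    rw [hxn] at hz'
    exact hF.map_simple_mul_ne hu hv (l := l) hlt hz'

theorem map_simple_mul (hF : cs.IsFullPartialMatching Q φ a) (hU : (cs.setU Q φ).Nonempty)
    (hreg : ∀ r ∈ cs.setU Q φ ∪ cs.setC φ, ∀ x ∈ cs.parabolic {a, r}, φ x = x * cs.simple a)
    {s : B} (hs : s ∈ cs.setU Q φ ∪ cs.setC φ) {x : W} (hx : x ∈ Q)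
    (hsx : cs.simple s * x ∈ Q) : φ (cs.simple s * x) = cs.simple s * φ x := by
  have hP := hF.isPartialMatching
  -- it suffices to treat elements without left descent `s`
  have red : ∀ y ∈ Q, cs.simple s * y ∈ Q →
      φ (cs.simple s * (cs.simple s * y)) = cs.simple s * φ (cs.simple s * y) →
      φ (cs.simple s * y) = cs.simple s * φ y := by
    intro y _ _ h
    rw [simple_mul_simple_cancel_left] at h
    rw [h, simple_mul_simple_cancel_left]
  suffices H : ∀ n, ∀ x ∈ Q, cs.length x = n → ¬ cs.IsLeftDescent x s → cs.simple s * x ∈ Q →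
      φ (cs.simple s * x) = cs.simple s * φ x by
    by_cases hd : cs.IsLeftDescent x s
    · exact red x hx hsx (H _ _ hsx rfl (cs.isLeftDescent_iff_not_isLeftDescent_mul.1 hd)
        (by rwa [simple_mul_simple_cancel_left]))
    · exact H _ x hx rfl hd hsx
  clear hx hsx x
  intro n
  induction n using Nat.strong_induction_on with
  | _ n ih =>
    intro x hx hn hd hsx
    subst hn
    have hlsx := cs.not_isLeftDescent_iff.1 hd
    have ih' : ∀ y ∈ Q, cs.length y < cs.length x → cs.simple s * y ∈ Q →
        φ (cs.simple s * y) = cs.simple s * φ y := by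
      intro y hy hlt hsy
      by_cases hdy : cs.IsLeftDescent y s
      · refine red y hy hsy (ih _ (lt_trans hdy hlt) _ hsy rfl
          (cs.isLeftDescent_iff_not_isLeftDescent_mul.1 hdy)
          (by rwa [simple_mul_simple_cancel_left]))
      · exact ih _ hlt y hy rfl hdy hsy
    rcases hP.covBy x hx with hup | hdown
    · rcases hP.covBy _ hsx with hup' | hdown'
      · -- both `x` and `s x` are matched upwards
        -- Otherwise `s x ≤ φ x` with equal lengths, so `s x = φ x` would be matched downwards.
        have hdz : ¬ cs.IsLeftDescent (φ x) s := by
          intro hc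
          have h1 := hup.le.simple_mul_le hc
          have h2 := h1.eq_of_length_le (by rw [hup.length_eq, hlsx])
          have h3 := hP.involutive x hx
          rw [← h2] at h3
          have h4 := hup'.length_eq
          rw [h3] at h4
          omega
        have hcomm : ∀ w, cs.BruhatCovBy w x → cs.simple s * w ∈ Q →
            φ (cs.simple s * w) = cs.simple s * φ w := fun w hw hsw =>
          ih' w (hP.lower x hx w hw.le) (by rw [hw.length_eq]; omega) hsw
        -- By induction `φ` commutes with `s` on the coatoms of `x`, so the two coatom recursions
        -- produce the same set.
        have hcoat : cs.coat (φ (cs.simple s * x)) = cs.coat (cs.simple s * φ x) := by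
          have hmem : ∀ {w}, cs.BruhatCovBy w x → ¬ cs.IsLeftDescent w s →
              cs.simple s * w ∈ Q := fun hw hdw =>
            hP.lower _ hsx _ (hw.le.simple_mul_simple_mul hd)
          rw [hP.coat_eq _ hsx hup']
          ext y
          rw [show (y ∈ cs.coat (cs.simple s * φ x)) =
            cs.BruhatCovBy y (cs.simple s * φ x) from rfl, hP.coat_simple_mul_map hx hup hdz hcomm]
          simp only [hd, not_false_iff, and_true, Set.mem_union, Set.mem_singleton_iff,
            Set.mem_ofPred_eq]
          refine or_congr Iff.rfl ⟨?_, ?_⟩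
          · rintro ⟨w', h1, h2, rfl⟩
            rcases (covBy_simple_mul_iff hd).1 h1 with rfl | ⟨w, h3, h4, rfl⟩
            · exact Or.inl rfl
            · rw [hcomm w h3 (hmem h3 h4)] at h2 ⊢
              exact Or.inr ⟨w, h3, h4, h2, rfl⟩
          · rintro (rfl | ⟨w, h1, h2, h3, rfl⟩)
            · exact ⟨x, covBy_simple_mul hd, hup, rfl⟩
            · refine ⟨cs.simple s * w, (covBy_simple_mul_iff hd).2 (Or.inr ⟨w, h1, h2, rfl⟩), ?_, ?_⟩
              · rwa [hcomm w h1 (hmem h1 h2)]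
              · rw [hcomm w h1 (hmem h1 h2)]
        by_contra hne
        -- The dihedral subgroup contains `s` and `a`, hence is `⟨a, r⟩`. For `r ∈ U ∪ C` the
        -- matching is right multiplication by `a`; for `r ∈ V` necessarily `s = a`.
        obtain ⟨p, q, h1, h2⟩ := exists_mem_parabolic_pair_of_coat_eq hcoat hne
        have hsxJ := hup'.le.mem_parabolic h1
        have hxJ := (bruhatLE_simple_mul_self hd).mem_parabolic hsxJ
        have hsJ : s ∈ ({p, q} : Set B) := by
          rw [← simple_mem_parabolic_iff (cs := cs)]
          have := mul_mem hsxJ (inv_mem hxJ)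
          rwa [mul_inv_cancel_right] at this
        have haJ : a ∈ ({p, q} : Set B) := by
          rw [← simple_mem_parabolic_iff (cs := cs)]
          have := hP.map_one_le hsx hup'
          rw [hF.map_one] at this
          exact this.mem_parabolic h1
        obtain ⟨r, hr⟩ : ∃ r, ({p, q} : Set B) = {a, r} := by
          rcases haJ with rfl | h
          · exact ⟨q, rfl⟩
          · rw [Set.mem_singleton_iff] at h
            subst h
            exact ⟨p, Set.pair_comm p a⟩
        rw [hr] at hsJ hxJ hsxJ
        rcases hF.mem_union r with hr' | hr'
        · apply hne
          rw [hreg r hr' _ hsxJ, hreg r hr' _ hxJ, mul_assoc]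
        · have hsa : s = a := by
            rcases hsJ with h | h
            · exact h
            · rw [Set.mem_singleton_iff] at h
              subst h
              exact absurd hs (fun h => h.elim (hF.notMem_setU_of_mem_setV hr') hr'.1)
          subst hsa
          exact hne (hF.map_simple_mul_of_mem_setV hU hr' hxJ hd hup hup')
      -- Here `s x` is matched downwards, so `φ x ≤ s x`; both have length one more than `x`, so
      -- they coincide.
      · have h1 := hP.map_le_of_le hsx hdown' (bruhatLE_simple_mul_self hd)
        have h2 := h1.eq_of_length_le (by rw [hup.length_eq, hlsx])
        rw [← h2, hP.involutive x hx, h2, simple_mul_simple_cancel_left]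
    -- If `x` is matched downwards, commutation at the shorter element `φ x` is available by
    -- induction and transfers to `x` by the involution.
    · have htQ := hP.mapsTo x hx
      have hlt : cs.length (φ x) < cs.length x := by
        rw [hdown.length_eq]; omega
      have hinv := hP.involutive x hx
      by_cases hdt : cs.IsLeftDescent (φ x) s
      · exfalso
        have hstQ := hP.lower _ htQ _ (simple_mul_bruhatLE_self hdt)
        have h1 := ih' _ htQ hlt hstQ
        rw [hinv] at h1
        have h2 := cs.isLeftDescent_iff.1 hdt
        have h3 := hdown.length_eq
        rcases hP.covBy _ hstQ with h | h
        · have := h.length_eq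
          rw [h1] at this
          omega
        · have := h.length_eq
          rw [h1] at this
          omega
      · have hstQ := hP.lower _ hsx _ (hdown.le.simple_mul_simple_mul hd)
        have h1 := ih' _ htQ hlt hstQ
        rw [hinv] at h1
        rw [← h1, hP.involutive _ hstQ]

/-! ### The factorization -/

/-- If `ω` has a letter in `U`, then `v` followed by the letters up to the first one has a left
descent in `U ∪ C`. Exchange moves this generator to the front, deleting a letter of `ω`, and
induction treats the remaining word. -/
theorem exists_word_simple_mul (hF : cs.IsFullPartialMatching Q φ a)
    (hv : v ∈ cs.setV Q φ) {ω : List B} (hω : ∀ i ∈ ω, i ∈ cs.setU Q φ ∪ cs.setC φ)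
    (hred : cs.IsReduced (v :: ω)) (hQ : cs.wordProd (v :: ω) ∈ Q) :
    ∃ ω₁ ω₂ : List B, (∀ i ∈ ω₁, i ∈ cs.setU Q φ ∪ cs.setC φ) ∧
      (∀ i ∈ ω₂, i ∈ cs.setV Q φ ∪ cs.setC φ) ∧ cs.wordProd (ω₁ ++ ω₂) = cs.wordProd (v :: ω) ∧
      ω₁.length + ω₂.length = ω.length + 1 := by
  induction hn : ω.length using Nat.strong_induction_on generalizing ω with
  | _ n ih =>
    subst hn
    by_cases hC : ∀ i ∈ ω, i ∈ cs.setC φ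
    · refine ⟨[], v :: ω, by simp, ?_, by simp, by simp⟩
      intro i hi
      rcases List.mem_cons.1 hi with rfl | hi
      · exact Or.inl hv
      · exact Or.inr (hC i hi)
    -- the first letter in `U` yields a left descent of the whole element
    have hdesc : ∃ s ∈ cs.setU Q φ ∪ cs.setC φ, cs.IsLeftDescent (cs.wordProd (v :: ω)) s := by
      have hsplit : ∃ p u τ, ω = p ++ u :: τ ∧ (∀ i ∈ p, i ∈ cs.setC φ) ∧ u ∈ cs.setU Q φ := by
        clear ih hred hQ
        induction ω with
        | nil => simp at hC
        | cons i ω ih =>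
          by_cases hi : i ∈ cs.setC φ
          · obtain ⟨p, u, τ, h1, h2, h3⟩ := ih (fun j hj => hω j (List.mem_cons_of_mem _ hj))
              (fun h => hC (by simpa [hi] using h))
            refine ⟨i :: p, u, τ, by rw [h1, List.cons_append], ?_, h3⟩
            simpa [hi] using h2
          · exact ⟨[], i, ω, rfl, by simp, (hω i (by simp)).resolve_right hi⟩
      obtain ⟨p, u, τ, rfl, hp, hu⟩ := hsplit
      have e : v :: (p ++ u :: τ) = (v :: (p ++ [u])) ++ τ := by simp
      rw [e] at hred hQ ⊢
      have hred' := hred.append_left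
      have hQ' := hF.isPartialMatching.lower _ hQ _
        (bruhatLE_of_sublist (List.sublist_append_left _ _) hred)
      have hap : a ∉ p := by
        intro ha
        refine hF.triple_not_sublist hu hv hred' hQ' ?_
        exact ((List.singleton_sublist.2 ha).append (List.Sublist.refl [u])).cons_cons v
      obtain ⟨s, hs, hd⟩ := hF.exists_isLeftDescent hu hv hp hap hred' hQ'
      refine ⟨s, hs, ?_⟩
      obtain ⟨σ, h1, h2⟩ := exists_isReduced_cons hd
      rw [IsLeftDescent, hred.eq, wordProd_append, ← h2, wordProd_cons, mul_assoc,
        simple_mul_simple_cancel_left, ← wordProd_append]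
      have h3 := cs.length_wordProd_le (σ ++ τ)
      have h4 := congrArg cs.length h2
      rw [h1.eq, hred'.eq] at h4
      simp only [List.length_append, List.length_cons] at h3 h4 ⊢
      omega
    obtain ⟨s, hs, hd⟩ := hdesc
    obtain ⟨j, hj, he⟩ := cs.left_exchange _ hd
    cases j with
    -- Deleting `v` itself would force `s = v`, but `v` is not in `U ∪ C`.
    | zero =>
      exfalso
      rw [List.eraseIdx_zero, List.tail_cons, wordProd_cons, ← mul_assoc] at he
      have h1 : cs.simple s * cs.simple v = 1 := by simpa using he
      have h2 : cs.simple s = cs.simple v := by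
        rw [mul_eq_one_iff_eq_inv, inv_simple] at h1
        exact h1
      have h3 := cs.simple_injective h2
      subst h3
      exact hs.elim (hF.notMem_setU_of_mem_setV hv) hv.1
    | succ j =>
      rw [List.eraseIdx_cons_succ] at he
      have hj' : j < ω.length := by simpa using hj
      have hlen := List.length_eraseIdx_add_one hj'
      have hsub := List.eraseIdx_sublist ω j
      have hred' : cs.IsReduced (v :: ω.eraseIdx j) := by
        have h1 := cs.isLeftDescent_iff.1 hd
        rw [he, hred.eq, List.length_cons] at h1
        rw [IsReduced, List.length_cons]
        omega
      have hQ' := hF.isPartialMatching.lower _ hQ _ (bruhatLE_of_sublist (hsub.cons_cons v) hred)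
      obtain ⟨ω₁, ω₂, h1, h2, h3, h4⟩ := ih _ (by omega)
        (fun i hi => hω i (hsub.subset hi)) hred' hQ' rfl
      refine ⟨s :: ω₁, ω₂, ?_, h2, ?_, ?_⟩
      · intro i hi
        rcases List.mem_cons.1 hi with rfl | hi
        · exact hs
        · exact h1 i hi
      · rw [List.cons_append, wordProd_cons, h3, ← he, simple_mul_simple_cancel_left]
      · rw [List.length_cons]
        omega

theorem exists_factor (hF : cs.IsFullPartialMatching Q φ a) {ω : List B} (hω : cs.IsReduced ω)
    (hQ : cs.wordProd ω ∈ Q) :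
    ∃ ω₁ ω₂ : List B, (∀ i ∈ ω₁, i ∈ cs.setU Q φ ∪ cs.setC φ) ∧
      (∀ i ∈ ω₂, i ∈ cs.setV Q φ ∪ cs.setC φ) ∧ cs.IsReduced (ω₁ ++ ω₂) ∧
      cs.wordProd (ω₁ ++ ω₂) = cs.wordProd ω := by
  induction ω with
  | nil => exact ⟨[], [], by simp, by simp, hω, rfl⟩
  | cons s ω ih =>
    obtain ⟨ω₁, ω₂, h1, h2, h3, h4⟩ := ih hω.tail
      (hF.isPartialMatching.lower _ hQ _ (bruhatLE_of_sublist (by simp) hω))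
    have hlen : (ω₁ ++ ω₂).length = ω.length := by rw [← h3.eq, h4, hω.tail.eq]
    have e : cs.wordProd (s :: (ω₁ ++ ω₂)) = cs.wordProd (s :: ω) := by
      rw [wordProd_cons, h4, wordProd_cons]
    have hred : cs.IsReduced (s :: (ω₁ ++ ω₂)) := by
      rw [IsReduced, e, hω.eq, List.length_cons, List.length_cons, hlen]
    rcases hF.mem_union s with hs | hs
    · refine ⟨s :: ω₁, ω₂, ?_, h2, hred, e⟩
      intro i hi
      rcases List.mem_cons.1 hi with rfl | hi
      · exact hs
      · exact h1 i hi
    · rw [← List.cons_append] at hred e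
      have hvQ := hF.isPartialMatching.lower _ (e ▸ hQ) _
        (bruhatLE_of_sublist (List.sublist_append_left _ _) hred)
      obtain ⟨τ₁, τ₂, h5, h6, h7, h8⟩ := hF.exists_word_simple_mul hs h1 hred.append_left hvQ
      have e' : cs.wordProd (τ₁ ++ (τ₂ ++ ω₂)) = cs.wordProd (s :: ω) := by
        rw [← List.append_assoc, wordProd_append, h7, ← wordProd_append, e]
      refine ⟨τ₁, τ₂ ++ ω₂, h5, ?_, ?_, e'⟩
      · intro i hi
        rcases List.mem_append.1 hi with hi | hi
        · exact h6 i hi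
        · exact h2 i hi
      · rw [IsReduced, e', hω.eq]
        simp only [List.length_append, List.length_cons] at hlen ⊢
        omega

/-! ### The main alternative -/

/-- Without deviations in `U`, the matching is `x ↦ xa` on each `⟨a, r⟩` with `r ∈ U ∪ C`, so all
these generators are left regular; the reduced factorization supplies the product description of
`Q`. -/
theorem left_alternative (hF : cs.IsFullPartialMatching Q φ a) (hM : cs.IsMaximalMatching Q φ)
    (hU : (cs.setU Q φ).Nonempty)
    (hdev : ∀ u ∈ cs.setU Q φ, ∀ k, k + 3 < M a u →
      φ (cs.wordProd (alternatingWord a u (k + 2))) ≠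
        cs.wordProd (alternatingWord a u (k + 3))) :
    (∀ s ∈ cs.setU Q φ ∪ cs.setC φ, cs.IsLeftRegular Q φ s) ∧
    Q = (cs.parabolic (cs.setU Q φ ∪ cs.setC φ) : Set W) *
      ((cs.parabolic (cs.setV Q φ ∪ cs.setC φ) : Set W) ∩ Q) ∧
    ∀ x ∈ cs.parabolic (cs.setU Q φ ∪ cs.setC φ),
      ∀ y ∈ (cs.parabolic (cs.setV Q φ ∪ cs.setC φ) : Set W) ∩ Q, φ (x * y) = x * φ y := by
  have hreg : ∀ r ∈ cs.setU Q φ ∪ cs.setC φ, ∀ x ∈ cs.parabolic {a, r},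
      φ x = x * cs.simple a := by
    rintro r (hr | hr) x hx
    · exact hF.map_eq_mul_of_mem_setU hr (hdev r hr) hx
    · exact hF.map_eq_mul_of_mem_setC hr hx
  have hleft : ∀ s ∈ cs.setU Q φ ∪ cs.setC φ, cs.IsLeftRegular Q φ s := fun s hs =>
    hM.isLeftRegular fun x hx hsx => hF.map_simple_mul hU hreg hs hx hsx
  have hmul : ∀ x ∈ cs.parabolic (cs.setU Q φ ∪ cs.setC φ), ∀ y ∈ Q,
      x * y ∈ Q ∧ φ (x * y) = x * φ y := by
    intro x hx y hy
    obtain ⟨ω, h1, rfl⟩ := exists_word_of_mem_parabolic hx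
    clear hx
    induction ω with
    | nil => simpa using hy
    | cons s ω ih =>
      obtain ⟨h2, h3⟩ := ih fun i hi => h1 i (List.mem_cons_of_mem _ hi)
      obtain ⟨h4, h5⟩ := hleft s (h1 s (by simp)) _ h2
      rw [wordProd_cons, mul_assoc]
      exact ⟨h4, by rw [h5, h3, mul_assoc]⟩
  refine ⟨hleft, ?_, fun x hx y hy => (hmul x hx y hy.2).2⟩
  ext q
  rw [Set.mem_mul]
  constructor
  · intro hq
    obtain ⟨ω, hω, rfl⟩ := cs.exists_isReduced q
    obtain ⟨ω₁, ω₂, h1, h2, h3, h4⟩ := hF.exists_factor hω hq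
    refine ⟨cs.wordProd ω₁, wordProd_mem_parabolic h1, cs.wordProd ω₂,
      ⟨wordProd_mem_parabolic h2, ?_⟩, by rw [← wordProd_append, h4]⟩
    rw [← h4] at hq
    exact hF.isPartialMatching.lower _ hq _ (bruhatLE_of_sublist (List.sublist_append_right _ _) h3)
  · rintro ⟨x, hx, y, hy, rfl⟩
    exact (hmul x hx y hy.2).1

/-- If there is no such descent, the left factor in `exists_factor` is empty, so `m` and then `φ m`
lie in `⟨V ∪ C⟩`. But a full element lies above every `u ∈ U`. -/
theorem exists_isLeftDescent_of_isFull (hF : cs.IsFullPartialMatching Q φ a)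
    (hU : (cs.setU Q φ).Nonempty) {m : W} (hm : m ∈ Q) (hfull : cs.IsFull (φ m)) :
    ∃ s ∈ cs.setU Q φ ∪ cs.setC φ, cs.IsLeftDescent m s := by
  by_contra hcon
  push Not at hcon
  obtain ⟨u, hu⟩ := hU
  obtain ⟨ω, hω, he⟩ := cs.exists_isReduced m
  obtain ⟨ω₁, ω₂, h1, h2, h3, h4⟩ := hF.exists_factor hω (he ▸ hm)
  rw [← he] at h4
  have hmJ : m ∈ cs.parabolic (cs.setV Q φ ∪ cs.setC φ) := by
    cases ω₁ with
    | nil =>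
      rw [← h4, List.nil_append]
      exact wordProd_mem_parabolic h2
    | cons s ω₁ =>
      have hd : cs.IsLeftDescent (cs.wordProd (s :: ω₁ ++ ω₂)) s := h3.isLeftDescent
      rw [h4] at hd
      exact absurd hd (hcon s (h1 s (by simp)))
  have hφJ := hF.isPartialMatching.map_mem_parabolic
    (by rw [hF.map_one]; exact simple_mem_parabolic (Or.inr hF.self_mem_setC)) hm hmJ
  have hle := hfull.le_of_mem_parabolic (i := u) (j := u) (x := cs.simple u)
    (simple_mem_parabolic (by simp))
  have huJ := hle.mem_parabolic hφJ
  rw [simple_mem_parabolic_iff] at huJ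
  exact huJ.elim (fun h => hF.notMem_setU_of_mem_setV h hu) hu.1

/-- The structure of full crossed maximal matchings. -/
theorem alternative (hF : cs.IsFullPartialMatching Q φ a) (hM : cs.IsMaximalMatching Q φ)
    (hcr : cs.IsCrossed Q φ) :
    (∀ m ∈ Q, cs.IsFull (φ m) → cs.IsReducibleOrbit Q φ m) ∧
    ((Q = (cs.parabolic (cs.setU Q φ ∪ cs.setC φ) : Set W) *
        ((cs.parabolic (cs.setV Q φ ∪ cs.setC φ) : Set W) ∩ Q) ∧
      ∀ x ∈ cs.parabolic (cs.setU Q φ ∪ cs.setC φ),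
        ∀ y ∈ (cs.parabolic (cs.setV Q φ ∪ cs.setC φ) : Set W) ∩ Q, φ (x * y) = x * φ y) ∨
    (Q = ((cs.parabolic (cs.setU Q φ ∪ cs.setC φ) : Set W) ∩ Q) *
        (cs.parabolic (cs.setV Q φ ∪ cs.setC φ) : Set W) ∧
      ∀ x ∈ (cs.parabolic (cs.setU Q φ ∪ cs.setC φ) : Set W) ∩ Q,
        ∀ y ∈ cs.parabolic (cs.setV Q φ ∪ cs.setC φ), φ (x * y) = φ x * y)) := by
  by_cases hdev : ∀ u ∈ cs.setU Q φ, ∀ k, k + 3 < M a u →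
      φ (cs.wordProd (alternatingWord a u (k + 2))) ≠ cs.wordProd (alternatingWord a u (k + 3))
  · obtain ⟨h1, h2⟩ := hF.left_alternative hM hcr.1 hdev
    refine ⟨fun m hm hfull => ?_, Or.inl h2⟩
    obtain ⟨s, hs, hd⟩ := hF.exists_isLeftDescent_of_isFull hcr.1 hm hfull
    exact Or.inl ⟨s, hd, h1 s hs⟩
  -- A deviation in `U` excludes deviations in `V`. Inversion exchanges the two sets, so the left
  -- alternative applies to the inverse matching.
  · push Not at hdev
    obtain ⟨u, hu, k, hk, hφu⟩ := hdev
    have hdev' : ∀ v ∈ cs.setU Q⁻¹ (invMap φ), ∀ l, l + 3 < M a v →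
        invMap φ (cs.wordProd (alternatingWord a v (l + 2))) ≠
          cs.wordProd (alternatingWord a v (l + 3)) := by
      intro v hv l hl he
      rw [hF.setU_inv] at hv
      refine hF.false_of_deviations hu hv hk hl hφu ?_
      rw [invMap, inv_eq_iff_eq_inv] at he
      rw [wordProd_reverse, he, wordProd_reverse]
    have hU' : (cs.setU Q⁻¹ (invMap φ)).Nonempty := hF.setU_inv.symm ▸ hcr.2
    obtain ⟨h1, h2, h3⟩ := hF.inv.left_alternative hM.inv hU' hdev'
    have hinv : ∀ x, φ x = (invMap φ x⁻¹)⁻¹ := fun x => by rw [invMap, inv_inv, inv_inv]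
    refine ⟨fun m hm hfull => ?_, Or.inr ⟨?_, ?_⟩⟩
    · obtain ⟨s, hs, hd⟩ := hF.inv.exists_isLeftDescent_of_isFull hU' (m := m⁻¹)
        (Set.inv_mem_inv.2 hm) (by rw [invMap, inv_inv]; exact hfull.inv)
      refine Or.inr ⟨s, cs.isLeftDescent_inv_iff.1 hd, fun x hx => ?_⟩
      obtain ⟨h4, h5⟩ := h1 s hs x⁻¹ (Set.inv_mem_inv.2 hx)
      rw [Set.mem_inv, mul_inv_rev, inv_inv, inv_simple] at h4
      refine ⟨h4, ?_⟩
      rw [hinv (x * cs.simple s), mul_inv_rev, inv_simple, h5, mul_inv_rev, ← hinv, inv_simple]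
    · rw [hF.setU_inv, hF.setV_inv, hF.setC_inv] at h2
      have h4 := congrArg (fun S : Set W => S⁻¹) h2
      simp only [mul_inv_rev, inv_inv, Set.inter_inv, inv_coe_set] at h4
      exact h4
    · intro x hx y hy
      rw [hF.setU_inv, hF.setV_inv, hF.setC_inv] at h3
      have h4 := h3 y⁻¹ (inv_mem hy) x⁻¹ ⟨inv_mem hx.1, Set.inv_mem_inv.2 hx.2⟩
      rw [hinv (x * y), mul_inv_rev, h4, mul_inv_rev, inv_inv, ← hinv]

end IsFullPartialMatching

end CoxeterSystem

theorem mainTheorem5 {B W : Type*} [Group W] {M : CoxeterMatrix B} (cs : CoxeterSystem M W)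
    (Q : Set W) (φ : W → W) (hφ : cs.IsMaximalMatching Q φ) (hcr : cs.IsCrossed Q φ) :
    cs.IsReducibleMatching Q φ ∧
    (cs.IsFullMatching Q →
      (Q = (cs.parabolic (cs.setU Q φ ∪ cs.setC φ) : Set W) *
            ((cs.parabolic (cs.setV Q φ ∪ cs.setC φ) : Set W) ∩ Q) ∧
        ∀ x ∈ cs.parabolic (cs.setU Q φ ∪ cs.setC φ),
          ∀ y ∈ (cs.parabolic (cs.setV Q φ ∪ cs.setC φ) : Set W) ∩ Q,
            φ (x * y) = x * φ y) ∨
      (Q = ((cs.parabolic (cs.setU Q φ ∪ cs.setC φ) : Set W) ∩ Q) *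
            (cs.parabolic (cs.setV Q φ ∪ cs.setC φ) : Set W) ∧
        ∀ x ∈ (cs.parabolic (cs.setU Q φ ∪ cs.setC φ) : Set W) ∩ Q,
          ∀ y ∈ cs.parabolic (cs.setV Q φ ∪ cs.setC φ),
            φ (x * y) = φ x * y)) := by
  have hP := hφ.isPartialMatching
  have h1 : (1 : W) ∈ Q := by
    obtain ⟨u, hu⟩ := hcr.1
    exact hP.lower _ hu.2.1 1 (cs.one_bruhatLE _)
  obtain ⟨a, ha⟩ := hP.exists_map_one h1
  have hF : cs.IsFullMatching Q → cs.IsFullPartialMatching Q φ a := fun h => ⟨hP, ha, h⟩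
  -- A full orbit makes the matching full, so reducibility needs no separate fullness hypothesis.
  refine ⟨Or.inr fun m hm _ hfull => ?_, fun h => ((hF h).alternative hφ hcr).2⟩
  exact ((hF ⟨_, hP.mapsTo m hm, hfull⟩).alternative hφ hcr).1 m hm hfull
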